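/- Let $n\ge 4$, and let $[x,y]=x^{-1}y^{-1}xy$. Let $\mathcal G_n$ be the group generated by $a,b,c,d$ subject to $$c=[b,a],\quad d=[c,a],\quad [d,a]=c^{-3}d^{-3},\quad [d,b]=[d,c]=1,$$ together with $c^{3^{(n-2)/2}}=d^{3^{(n-2)/2}}=1$ if $n$ is even, and $c^{3^{(n-1)/2}}=d^{3^{(n-3)/2}}=1$ if $n$ is odd. Put $z=d^{(-3)^{(n-4)/2}}$ if $n$ is even and $z=c^{(-3)^{(n-3)/2}}$ if $n$ is odd. Let $T_1,\dots,T_7$ be the quotients of $\mathcal G_n$ by the following additional relations ($T_5,T_6,T_7$ are considered only for $n\ge5$): - $T_1$: $a^3=1,\ b^3=c^{-3}d^{-1},\ [c,b]=1$; - $T_2$: $a^3=1,\ b^3=c^{-3}d^{-1}z,\ [c,b]=1$; - $T_3$: $a^3=1,\ b^3=c^{-3}d^{-1}z^{-1},\ [c,b]=1$; - $T_4$: $a^3=z,\ b^3=c^{-3}d^{-1},\ [c,b]=1$; - $T_5$: $a^3=1,\ b^3=c^{-3}d^{-1},\ [c,b]=z^{-1}$; - $T_6$: $a^3=z,\ b^3=c^{-3}d^{-1},\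 [c,b]=z^{-1}$; - $T_7$: $a^3=z^{-1},\ b^3=c^{-3}d^{-1},\ [c,b]=z^{-1}$. Let $F$ be a field of characteristic $3$, and let $G$ be a group of order $3^n$ and of maximal class, that is, of nilpotency class $n-1$. Then $G$ is isomorphic to (at least) one of the groups $T_1,T_2,T_3,T_4$ or, if $n\ge5$, $T_1,\dots,T_7$, and the dimension over $F$ of the first Hochschild cohomology group $HH^1(FG)$ of the group algebra $FG$ (with coefficients in $FG$) is $$\dim_F HH^1(FG)=\begin{cases} 16+2\cdot 3^{n-2} & (G\cong T_1),\\ 12+2\cdot 3^{n-2} & (G\cong T_2 \text{ and } n\ne 4),\\ 38 & (G\cong T_2 \text{ and } n=4),\\ 12+2\cdot 3^{n-2} & (G\cong T_3),\\ 10+2\cdot 3^{n-2} & (G\cong T_4),\\ 12+22\cdot 3^{n-5} & (n\ge 5,\ G\cong T_5),\\ 10+22\cdot 3^{n-5} & (n\ge 5,\ G\cong T_6),\\ 14+22\cdot 3^{n-5} & (n\ge 5,\ G\cong T_7). \end{cases}$$ -/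

import Mathlib

universe u v

namespace MaxClassThree

/-- The cohomology `ker g / im f` at the middle term of a complex `X → Y → Z` of modules with
maps `f` and `g`, `g ∘ f = 0`. -/
abbrev MidCohomology {R X Y Z : Type*} [CommRing R] [AddCommGroup X] [AddCommGroup Y]
    [AddCommGroup Z] [Module R X] [Module R Y] [Module R Z] (f : X →ₗ[R] Y) (g : Y →ₗ[R] Z) :=
  LinearMap.ker g ⧸ (LinearMap.range f).submoduleOf (LinearMap.ker g)

/-! ### First Hochschild cohomology of an algebra -/

section Hochschild

variable (R : Type u) (A : Type v) [CommRing R] [Ring A] [Algebra R A]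

/-- The differential `C⁰(A, A) = A → C¹(A, A) = Hom_R(A, A)` of the Hochschild cochain complex,
`(d⁰ x) a = a x - x a`. -/
def hochschildD0 : A →ₗ[R] (A →ₗ[R] A) :=
  (LinearMap.mul R A).flip - LinearMap.mul R A

/-- The differential `C¹(A, A) = Hom_R(A, A) → C²(A, A)` of the Hochschild cochain complex, where
2-cochains are `R`-bilinear maps `A × A → A`: `(d¹ f) (a, b) = a f(b) - f(a b) + f(a) b`. -/
def hochschildD1 : (A →ₗ[R] A) →ₗ[R] (A →ₗ[R] A →ₗ[R] A) where
  toFun f := LinearMap.mk₂ R (fun a b => a * f b - f (a * b) + f a * b)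
    (by intro a a' b; simp only [add_mul, map_add]; abel)
    (by intro r a b; simp only [smul_mul_assoc, map_smul, smul_add, smul_sub])
    (by intro a b b'; simp only [mul_add, map_add]; abel)
    (by intro r a b; simp only [mul_smul_comm, map_smul, smul_add, smul_sub])
  map_add' f g := by
    ext a b
    simp only [LinearMap.mk₂_apply, LinearMap.add_apply, mul_add, add_mul]
    abel
  map_smul' r f := by
    ext a b
    simp only [LinearMap.mk₂_apply, LinearMap.smul_apply, mul_smul_comm, smul_mul_assoc,
      smul_add, smul_sub, RingHom.id_apply]

theorem hochschildD0_apply (x a : A) : hochschildD0 R A x a = a * x - x * a := rfl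

theorem hochschildD1_apply (f : A →ₗ[R] A) (a b : A) :
    hochschildD1 R A f a b = a * f b - f (a * b) + f a * b := rfl

theorem hochschildD1_comp_D0 : hochschildD1 R A ∘ₗ hochschildD0 R A = 0 := by
  ext x a b
  simp only [LinearMap.comp_apply, hochschildD1_apply, hochschildD0_apply, LinearMap.zero_apply]
  noncomm_ring

/-- The first Hochschild cohomology `HH¹(A) = ker d¹ / im d⁰` of the `R`-algebra `A` with
coefficients in `A`. -/
abbrev HH1 : Type v :=
  MidCohomology (Y := A →ₗ[R] A) (Z := A →ₗ[R] A →ₗ[R] A) (hochschildD0 R A) (hochschildD1 R A)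

end Hochschild

/-! ### The 3-groups of maximal class -/

/-- `G` is a group of order `3 ^ n` and of maximal class: its nilpotency class is `n - 1`,
with the convention `n ≥ 4`. (The nilpotency class of a non-nilpotent group is `0` in Mathlib, so
that the last condition contains the nilpotency of `G`.) -/
structure IsMaximalClass (n : ℕ) (G : Type*) [Group G] : Prop where
  four_le : 4 ≤ n
  card_eq : Nat.card G = 3 ^ n
  class_eq : Group.nilpotencyClass G = n - 1

/-- The names of the four generators. -/
inductive Gen : Type
  | a | b | c | d

/-- The generators as elements of the free group. -/
def a : FreeGroup Gen := FreeGroup.of Gen.a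
/-- See `MaxClassThree.a`. -/
def b : FreeGroup Gen := FreeGroup.of Gen.b
/-- See `MaxClassThree.a`. -/
def c : FreeGroup Gen := FreeGroup.of Gen.c
/-- See `MaxClassThree.a`. -/
def d : FreeGroup Gen := FreeGroup.of Gen.d

/-- The commutator `[x, y] = x⁻¹ y⁻¹ x y` (Mathlib's `⁅x, y⁆` is `x y x⁻¹ y⁻¹`). -/
def comm {H : Type*} [Group H] (x y : H) : H := x⁻¹ * y⁻¹ * x * y

/-- The relator of the relation `x = y`. -/
def rel {H : Type*} [Group H] (x y : H) : H := x * y⁻¹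

/-- The relators of the group `𝒢_n`. -/
def baseRels (n : ℕ) : Set (FreeGroup Gen) :=
  {rel c (comm b a), rel d (comm c a), rel (comm d a) (c ^ (-3 : ℤ) * d ^ (-3 : ℤ)),
    rel (comm d b) 1, rel (comm d c) 1} ∪
  (if Even n then
    {rel (c ^ (3 ^ ((n - 2) / 2))) 1, rel (d ^ (3 ^ ((n - 2) / 2))) 1}
  else
    {rel (c ^ (3 ^ ((n - 1) / 2))) 1, rel (d ^ (3 ^ ((n - 3) / 2))) 1})

/-- The element `z`. -/
def z (n : ℕ) : FreeGroup Gen :=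
  if Even n then d ^ ((-3 : ℤ) ^ ((n - 4) / 2)) else c ^ ((-3 : ℤ) ^ ((n - 3) / 2))

/-- The quotient of `𝒢_n` by the relations
`a³ = z ^ α`, `b³ = c⁻³ d⁻¹ z ^ β`, `[c, b] = z ^ γ`. -/
abbrev MaxQuot (n : ℕ) (α β γ : ℤ) : Type :=
  PresentedGroup (baseRels n ∪
    {rel (a ^ 3) (z n ^ α),
      rel (b ^ 3) (c ^ (-3 : ℤ) * d⁻¹ * z n ^ β),
      rel (comm c b) (z n ^ γ)})

/-- `a³ = 1`, `b³ = c⁻³d⁻¹`, `[c, b] = 1`. -/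
abbrev T1 (n : ℕ) : Type := MaxQuot n 0 0 0
/-- `a³ = 1`, `b³ = c⁻³d⁻¹z`, `[c, b] = 1`. -/
abbrev T2 (n : ℕ) : Type := MaxQuot n 0 1 0
/-- `a³ = 1`, `b³ = c⁻³d⁻¹z⁻¹`, `[c, b] = 1`. -/
abbrev T3 (n : ℕ) : Type := MaxQuot n 0 (-1) 0
/-- `a³ = z`, `b³ = c⁻³d⁻¹`, `[c, b] = 1`. -/
abbrev T4 (n : ℕ) : Type := MaxQuot n 1 0 0
/-- `a³ = 1`, `b³ = c⁻³d⁻¹`, `[c, b] = z⁻¹` (used for `n ≥ 5` only). -/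
abbrev T5 (n : ℕ) : Type := MaxQuot n 0 0 (-1)
/-- `a³ = z`, `b³ = c⁻³d⁻¹`, `[c, b] = z⁻¹` (used for `n ≥ 5` only). -/
abbrev T6 (n : ℕ) : Type := MaxQuot n 1 0 (-1)
/-- `a³ = z⁻¹`, `b³ = c⁻³d⁻¹`, `[c, b] = z⁻¹` (used for `n ≥ 5` only). -/
abbrev T7 (n : ℕ) : Type := MaxQuot n (-1) 0 (-1)

end MaxClassThree

/-!
The dimension of `HH¹(FG)` is computed from centralizers. A derivation of `FG` is the same as a
functor from the conjugation groupoid of `G` to the additive group of `F`, and the inner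
derivations are the coboundaries; restriction to the automorphism groups of representatives of the
classes gives `HH¹(FG) ≃ ∏ Hom(C_G(x), F)` over the conjugacy classes (`hh1Equiv`), hence
`|G| dim HH¹(FG) = ∑ g, |C_G(g)| dim Hom(C_G(g), F)` (`finrank_HH1_mul_card`).

The classification is an induction along central quotients. The predicate `Std n a b c d α β γ`
says that `a, b, c, d` generate the group and satisfy the defining relations with `a³ = z ^ α`,
`b³ = c⁻³ d⁻¹ z ^ β`, `[c, b] = z ^ γ`. If `G` has maximal class, so has `G ⧸ Z(G)`, and lifts to `G`
of standard generators of the quotient are standard again (`relations_of_lift`,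
`std_succ_of_lift`). The only input is that the lift of the old `z` commutes with `b`: for larger
`n` this follows from the relations (`commute_lift_b`), while for `n = 4` the generator `b` is
chosen accordingly (`exists_generators_four`). As `G` has order `3 ^ n`, the map from the presented
group to `G` is an isomorphism, because normal forms `a ^ i b ^ j c ^ k d ^ l` bound the order of
the presented group (`Std.nonempty_mulEquiv`). The changes of generators `a ↦ a b` and `b ↦ b⁻¹`
reduce `(α, β, γ)` to the seven listed triples (`Std.exists_normalForm`).

For the sum over `g`, let `N` be the derived subgroup `⟨c, d⟩` of index `9` and `B = ⟨b⟩ N`. The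
centralizer of `a` is `⟨a, z⟩` of order `9`, so that the coset `a N` is a conjugacy class; the same
holds for `a b` and `a b²`, which may serve as the generator `a` with `α` replaced by `α + β - γ`
and `α + 2β - γ`. This settles the elements outside `B` (`Std.sum_outside`), and shows that the
noncentral elements of `B` have their centralizers in `B` (`Std.centralizer_le_maxSub`). If
`γ = 0`, then `B` is abelian, of rank `2` with the exception of one group of order `81`, where `B` is
elementary abelian. If `γ ≠ 0`, then the center of `B` is `⟨c³, d⟩`, and the remaining elements of
`B` have abelian centralizers of rank `2`.
-/

namespace MaxClassThree

/-! ### The first Hochschild cohomology of a group algebra -/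

section HochschildGroupAlgebra

variable {F : Type u} [Field F] {G : Type v} [Group G]

open MonoidAlgebra

/-- The space `Hom(K, F)` of homomorphisms from a group `K` to the additive group of a field,
that is, `H¹(K, F)` for the trivial action. -/
abbrev AddChar1 (F : Type u) [Field F] (K : Type v) [Group K] : Type (max u v) :=
  Additive K →+ F

/-- A representative of a conjugacy class. -/
noncomputable def classRep (C : ConjClasses G) : G := Quotient.out C

theorem mk_classRep (C : ConjClasses G) : ConjClasses.mk (classRep C) = C := Quotient.out_eq C

theorem isConj_classRep (g : G) : IsConj (classRep (ConjClasses.mk g)) g :=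
  ConjClasses.mk_eq_mk_iff_isConj.1 (mk_classRep _)

/-- A chosen element conjugating the representative of its class to `g`. -/
noncomputable def transporter (g : G) : G := (isConj_iff.1 (isConj_classRep g)).choose

theorem transporter_spec (g : G) :
    transporter g * classRep (ConjClasses.mk g) * (transporter g)⁻¹ = g :=
  (isConj_iff.1 (isConj_classRep g)).choose_spec

theorem conjClasses_mk_conj (g x : G) : ConjClasses.mk (g * x * g⁻¹) = ConjClasses.mk x :=
  (ConjClasses.mk_eq_mk_iff_isConj.2 (isConj_iff.2 ⟨g, rfl⟩)).symm

theorem ker_hochschildD1_mul {D : MonoidAlgebra F G →ₗ[F] MonoidAlgebra F G}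
    (hD : D ∈ LinearMap.ker (hochschildD1 F (MonoidAlgebra F G))) (x y : MonoidAlgebra F G) :
    D (x * y) = x * D y + D x * y := by
  have h := LinearMap.congr_fun (LinearMap.congr_fun (LinearMap.mem_ker.1 hD) x) y
  rw [hochschildD1_apply] at h
  simp only [LinearMap.zero_apply] at h
  have h2 : x * D y + D x * y - D (x * y) = 0 := by rw [← h]; abel
  exact (sub_eq_zero.1 h2).symm

/-- The coefficient of a derivation `D` of the group algebra attached to the arrow
`x ⟶ g x g⁻¹` of the conjugation groupoid of `G`: the coefficient of `g x` in `D g`. -/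
noncomputable def arrowCoeff (D : MonoidAlgebra F G →ₗ[F] MonoidAlgebra F G) (g x : G) : F :=
  (D (single g 1)).coeff (g * x)

/-- A derivation of the group algebra is a functor from the conjugation groupoid to `F`. -/
theorem arrowCoeff_mul {D : MonoidAlgebra F G →ₗ[F] MonoidAlgebra F G}
    (hD : D ∈ LinearMap.ker (hochschildD1 F (MonoidAlgebra F G))) (g h x : G) :
    arrowCoeff D (g * h) x = arrowCoeff D g (h * x * h⁻¹) + arrowCoeff D h x := by
  unfold arrowCoeff
  have h1 : (single (g * h) (1 : F) : MonoidAlgebra F G) = single g 1 * single h 1 := by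
    rw [single_mul_single, mul_one]
  rw [h1, ker_hochschildD1_mul hD, coeff_add, Finsupp.add_apply, coeff_single_mul_apply,
    coeff_mul_single_apply, one_mul, mul_one, add_comm]
  congr 2 <;> group

theorem hochschildD1_eq_zero_iff (D : MonoidAlgebra F G →ₗ[F] MonoidAlgebra F G) :
    D ∈ LinearMap.ker (hochschildD1 F (MonoidAlgebra F G)) ↔
      ∀ g h : G, D (single (g * h) 1) = single g 1 * D (single h 1) + D (single g 1) * single h 1 := by
  constructor
  · intro hD g h
    rw [← ker_hochschildD1_mul hD, single_mul_single, mul_one]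
  · intro h
    rw [LinearMap.mem_ker]
    ext g g' : 4
    simp only [LinearMap.comp_apply, lsingle_apply, hochschildD1_apply, LinearMap.zero_apply,
      single_mul_single, mul_one, h]
    abel

/-- Restriction of a derivation to the automorphism groups of the representatives of the
conjugacy classes. -/
noncomputable def restrictDer :
    LinearMap.ker (hochschildD1 F (MonoidAlgebra F G)) →ₗ[F]
      ((C : ConjClasses G) → AddChar1 F (Subgroup.centralizer {classRep C})) where
  toFun D C := AddMonoidHom.mk' (fun c => arrowCoeff D.1 (c.toMul : G) (classRep C)) (by
    intro c c'
    have hc : ((c'.toMul : Subgroup.centralizer {classRep C}) : G) * classRep C =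
        classRep C * (c'.toMul : Subgroup.centralizer {classRep C}) :=
      (Subgroup.mem_centralizer_singleton_iff.1 c'.toMul.2)
    have := arrowCoeff_mul D.2 (c.toMul : G) (c'.toMul : G) (classRep C)
    rw [hc, mul_inv_cancel_right] at this
    exact this)
  map_add' D D' := by
    funext C
    ext c
    simp [arrowCoeff]
  map_smul' r D := by
    funext C
    ext c
    simp [arrowCoeff]

theorem restrictDer_apply (D : LinearMap.ker (hochschildD1 F (MonoidAlgebra F G)))
    (C : ConjClasses G) (c : Subgroup.centralizer {classRep C}) :
    restrictDer D C (Additive.ofMul c) = arrowCoeff D.1 (c : G) (classRep C) := rfl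

theorem transporter_conj_mem (g x : G) : (transporter (g * x * g⁻¹))⁻¹ * (g * transporter x) ∈
    Subgroup.centralizer {classRep (ConjClasses.mk x)} := by
  rw [Subgroup.mem_centralizer_singleton_iff]
  have h1 := transporter_spec x
  have h2 := transporter_spec (g * x * g⁻¹)
  rw [conjClasses_mk_conj] at h2
  generalize hr : classRep (ConjClasses.mk x) = r at *
  generalize transporter (g * x * g⁻¹) = s at *
  generalize transporter x = t at *
  have h3 : s * r * s⁻¹ = g * (t * r * t⁻¹) * g⁻¹ := by rw [h1, h2]
  have h4 : s⁻¹ * (g * (t * r * t⁻¹) * g⁻¹) * s = r := by rw [← h3]; group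
  calc s⁻¹ * (g * t) * r = (s⁻¹ * (g * (t * r * t⁻¹) * g⁻¹) * s) * (s⁻¹ * (g * t)) := by group
    _ = r * (s⁻¹ * (g * t)) := by rw [h4]

/-- The inner derivations are those that vanish on all automorphism groups: such a functor from the
conjugation groupoid to `F` is the coboundary of a function on `G`, namely of its values on the
arrows `transporter g`. -/
theorem ker_restrictDer [Finite G] : LinearMap.ker (restrictDer (F := F) (G := G)) =
    (LinearMap.range (hochschildD0 F (MonoidAlgebra F G))).submoduleOf
      (LinearMap.ker (hochschildD1 F (MonoidAlgebra F G))) := by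
  have : Fintype G := Fintype.ofFinite G
  ext D
  rw [LinearMap.mem_ker, Submodule.submoduleOf, Submodule.mem_comap, Submodule.subtype_apply,
    LinearMap.mem_range]
  constructor
  · intro hD
    refine ⟨ofCoeff (Finsupp.equivFunOnFinite.symm
      fun g => - arrowCoeff D.1 (transporter g) (classRep (ConjClasses.mk g))), ?_⟩
    ext g : 2
    ext y
    simp only [LinearMap.comp_apply, lsingle_apply, hochschildD0_apply]
    obtain ⟨x, rfl⟩ : ∃ x, y = g * x := ⟨g⁻¹ * y, by group⟩
    rw [coeff_sub, Finsupp.sub_apply, coeff_single_mul_apply, coeff_mul_single_apply]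
    simp only [inv_mul_cancel_left, one_mul, mul_one,
      Finsupp.equivFunOnFinite_symm_apply_apply]
    change _ = arrowCoeff D.1 g x
    -- the coefficient on the automorphism part of the arrow vanishes
    have h0 := DFunLike.congr_fun (congr_fun hD (ConjClasses.mk x))
      (Additive.ofMul ⟨_, transporter_conj_mem g x⟩)
    rw [restrictDer_apply] at h0
    simp only [Pi.zero_apply, AddMonoidHom.zero_apply] at h0
    have h1 := arrowCoeff_mul D.2 g (transporter x) (classRep (ConjClasses.mk x))
    rw [transporter_spec] at h1
    have h2 := arrowCoeff_mul D.2 (transporter (g * x * g⁻¹))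
      ((transporter (g * x * g⁻¹))⁻¹ * (g * transporter x)) (classRep (ConjClasses.mk x))
    rw [mul_inv_cancel_left, h0, add_zero, Subgroup.mem_centralizer_singleton_iff.1
      (transporter_conj_mem g x), mul_inv_cancel_right, h1] at h2
    rw [conjClasses_mk_conj, ← h2]
    ring
  · rintro ⟨x, hx⟩
    funext C
    ext c
    change arrowCoeff D.1 (c : G) (classRep C) = 0
    rw [arrowCoeff, ← hx, hochschildD0_apply, coeff_sub, Finsupp.sub_apply,
      coeff_single_mul_apply, coeff_mul_single_apply, Subgroup.mem_centralizer_singleton_iff.1 c.2]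
    simp only [mul_inv_cancel_right, one_mul, mul_one]
    rw [← Subgroup.mem_centralizer_singleton_iff.1 c.2, inv_mul_cancel_left, sub_self]

/-- Homomorphisms on the automorphism groups extend to the conjugation groupoid, by transport along
the arrows `transporter g`. -/
theorem restrictDer_surjective [Finite G] : Function.Surjective (restrictDer (F := F) (G := G)) := by
  have : Fintype G := Fintype.ofFinite G
  intro χ
  have key : ∀ (C C' : ConjClasses G) (hC : C = C') (u : G) (hu : u ∈ Subgroup.centralizer
      {classRep C}) (hu' : u ∈ Subgroup.centralizer {classRep C'}),
      χ C (Additive.ofMul ⟨u, hu⟩) = χ C' (Additive.ofMul ⟨u, hu'⟩) := by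
    intro C C' hC u hu hu'
    subst hC
    rfl
  let ψ : G → G → F := fun g x =>
    χ (ConjClasses.mk x) (Additive.ofMul ⟨_, transporter_conj_mem g x⟩)
  have hψ : ∀ g h x, ψ (g * h) x = ψ g (h * x * h⁻¹) + ψ h x := by
    intro g h x
    simp only [ψ]
    rw [key _ _ (conjClasses_mk_conj h x) _ _
      (by rw [← conjClasses_mk_conj h x]; exact transporter_conj_mem g (h * x * h⁻¹)), ← map_add,
      ← ofMul_mul]
    congr 2
    ext
    have h1 : g * h * x * (g * h)⁻¹ = g * (h * x * h⁻¹) * g⁻¹ := by group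
    simp only [Subgroup.coe_mul, h1]
    group
  let D : MonoidAlgebra F G →ₗ[F] MonoidAlgebra F G :=
    (Finsupp.linearCombination F (fun g => (ofCoeff (Finsupp.equivFunOnFinite.symm
      fun y => ψ g (g⁻¹ * y)) : MonoidAlgebra F G))) ∘ₗ
      (coeffLinearEquiv F : MonoidAlgebra F G ≃ₗ[F] (G →₀ F)).toLinearMap
  have hDg : ∀ g, D (single g 1) = ofCoeff (Finsupp.equivFunOnFinite.symm
      fun y => ψ g (g⁻¹ * y)) := by
    intro g
    simp [D]
  have hDker : D ∈ LinearMap.ker (hochschildD1 F (MonoidAlgebra F G)) := by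
    rw [hochschildD1_eq_zero_iff]
    intro g h
    ext y
    rw [coeff_add, Finsupp.add_apply, coeff_single_mul_apply, coeff_mul_single_apply, hDg, hDg, hDg]
    simp only [Finsupp.equivFunOnFinite_symm_apply_apply, one_mul, mul_one, hψ]
    rw [add_comm]
    congr 2 <;> group
  refine ⟨⟨D, hDker⟩, ?_⟩
  funext C
  ext ⟨c, hc⟩
  change arrowCoeff D c (classRep C) = χ C (Additive.ofMul ⟨c, hc⟩)
  have hC := mk_classRep C
  have hc1 : c * classRep C * c⁻¹ = classRep C := by
    rw [Subgroup.mem_centralizer_singleton_iff.1 hc, mul_inv_cancel_right]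
  have ht : transporter (classRep C) ∈ Subgroup.centralizer {classRep C} := by
    have h := transporter_spec (classRep C)
    rw [hC] at h
    rw [Subgroup.mem_centralizer_singleton_iff]
    exact mul_inv_eq_iff_eq_mul.1 h
  rw [arrowCoeff, hDg, coeff_ofCoeff, Finsupp.equivFunOnFinite_symm_apply_apply,
    inv_mul_cancel_left]
  simp only [ψ]
  have h1 := transporter_conj_mem c (classRep C)
  rw [hC] at h1
  rw [key _ _ hC _ _ h1]
  have h2 : (⟨_, h1⟩ : Subgroup.centralizer {classRep C}) = ⟨_, ht⟩⁻¹ * (⟨c, hc⟩ * ⟨_, ht⟩) := by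
    ext
    simp [hc1]
  rw [h2, ofMul_mul, ofMul_mul, ofMul_inv, map_add, map_add, map_neg]
  abel

/-- `HH¹(FG)` is the direct sum of the groups `Hom(C_G(x), F)`, where `x` runs over
representatives of the conjugacy classes. -/
noncomputable def hh1Equiv [Finite G] : HH1 F (MonoidAlgebra F G) ≃ₗ[F]
    ((C : ConjClasses G) → AddChar1 F (Subgroup.centralizer {classRep C})) :=
  (Submodule.quotEquivOfEq _ _ ker_restrictDer.symm).trans
    (LinearMap.quotKerEquivOfSurjective _ restrictDer_surjective)

/-- The dimension of `Hom(K, F)`; the minimal number of generators of `K` if `K` is a `3`-group and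
`F` has characteristic `3`. -/
noncomputable def homRank (F : Type u) [Field F] (K : Type v) [Group K] : ℕ :=
  Module.finrank F (AddChar1 F K)

theorem homRank_congr {K K' : Type v} [Group K] [Group K'] (e : K ≃* K') :
    homRank F K = homRank F K' := by
  refine LinearEquiv.finrank_eq
    { toFun := fun φ => φ.comp (MulEquiv.toAdditive e).symm.toAddMonoidHom
      invFun := fun φ => φ.comp (MulEquiv.toAdditive e).toAddMonoidHom
      map_add' := fun φ ψ => rfl
      map_smul' := fun r φ => rfl
      left_inv := fun φ => by ext; simp
      right_inv := fun φ => by ext; simp }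

/-- The conjugation isomorphism between the centralizers of conjugate elements. -/
theorem exists_centralizer_equiv {x y : G} (h : IsConj x y) :
    Nonempty (Subgroup.centralizer {x} ≃* Subgroup.centralizer {y}) := by
  obtain ⟨g, rfl⟩ := isConj_iff.1 h
  have : (Subgroup.centralizer {x}).map (MulAut.conj g).toMonoidHom =
      Subgroup.centralizer {g * x * g⁻¹} := by
    ext u
    rw [Subgroup.mem_map]
    constructor
    · rintro ⟨v, hv, rfl⟩
      rw [Subgroup.mem_centralizer_singleton_iff] at hv ⊢
      change g * v * g⁻¹ * (g * x * g⁻¹) = g * x * g⁻¹ * (g * v * g⁻¹)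
      calc _ = g * (v * x) * g⁻¹ := by group
        _ = _ := by rw [hv]; group
    · intro hu
      refine ⟨g⁻¹ * u * g, ?_, ?_⟩
      · rw [Subgroup.mem_centralizer_singleton_iff] at hu ⊢
        calc g⁻¹ * u * g * x = g⁻¹ * (u * (g * x * g⁻¹)) * g := by group
          _ = _ := by rw [hu]; group
      · change g * (g⁻¹ * u * g) * g⁻¹ = u
        group
  exact ⟨((Subgroup.centralizer {x}).equivMapOfInjective _ (MulAut.conj g).injective).trans
    (MulEquiv.subgroupCongr this)⟩

/-- The contribution `|C_G(g)| dim Hom(C_G(g), F)` of an element to `|G| dim HH¹(FG)`. The sum over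
all elements, in place of conjugacy classes, spares the enumeration of the classes. -/
noncomputable def weight (F : Type u) [Field F] (g : G) : ℕ :=
  Nat.card (Subgroup.centralizer {g}) * homRank F (Subgroup.centralizer {g})

theorem weight_of_isConj {x y : G} (h : IsConj x y) : weight F x = weight F y := by
  obtain ⟨e⟩ := exists_centralizer_equiv h
  rw [weight, weight, homRank_congr e, Nat.card_congr e.toEquiv]

theorem ncard_conjClass_mul_card_centralizer (x : G) :
    (ConjClasses.mk x).carrier.ncard * Nat.card (Subgroup.centralizer {x}) = Nat.card G := by
  rw [Subgroup.nat_card_centralizer_nat_card_stabilizer, ← ConjAct.orbit_eq_carrier_conjClasses,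
    ← MulAction.index_stabilizer, Subgroup.index_mul_card]
  rfl

instance finite_addChar1 {K : Type v} [Group K] [Finite K] : Module.Finite F (AddChar1 F K) :=
  Module.Finite.of_injective
    ({ toFun := fun φ x => φ (Additive.ofMul x)
       map_add' := fun _ _ => rfl
       map_smul' := fun _ _ => rfl } : AddChar1 F K →ₗ[F] (K → F))
    fun φ ψ h => by ext x; exact congr_fun h x

theorem finrank_HH1_mul_card [Fintype G] :
    Module.finrank F (HH1 F (MonoidAlgebra F G)) * Nat.card G = ∑ g : G, weight F g := by
  classical
  have : Fintype (ConjClasses G) := Fintype.ofFinite _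
  rw [hh1Equiv.finrank_eq, Module.finrank_pi_fintype, Finset.sum_mul,
    ← Finset.sum_fiberwise Finset.univ (fun g : G => ConjClasses.mk g) (weight F)]
  refine Finset.sum_congr rfl fun C _ => ?_
  rw [Finset.sum_congr rfl (g := fun _ => weight F (classRep C))]
  · have hc : (Finset.univ.filter fun g : G => ConjClasses.mk g = C).card = C.carrier.ncard := by
      rw [← Set.ncard_coe_finset]
      congr 1
      ext g
      simp [ConjClasses.mem_carrier_iff_mk_eq]
    rw [Finset.sum_const, smul_eq_mul, weight, hc,
      ← ncard_conjClass_mul_card_centralizer (classRep C), mk_classRep, homRank]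
    ring
  · intro g hg
    refine weight_of_isConj ?_
    rw [Finset.mem_filter] at hg
    rw [← ConjClasses.mk_eq_mk_iff_isConj, hg.2, mk_classRep]

/-- The subgroup generated by the commutators and the cubes of elements of `K`; it is the
intersection of the kernels of all homomorphisms from `K` to a field of characteristic `3`. -/
def cubePhi (K : Type v) [Group K] : Subgroup K :=
  Subgroup.closure ({u | ∃ x y : K, u = comm x y} ∪ {u | ∃ x : K, u = x ^ 3})

theorem comm_mem_cubePhi {K : Type v} [Group K] (x y : K) : comm x y ∈ cubePhi K :=
  Subgroup.subset_closure (Or.inl ⟨x, y, rfl⟩)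

theorem cube_mem_cubePhi {K : Type v} [Group K] (x : K) : x ^ 3 ∈ cubePhi K :=
  Subgroup.subset_closure (Or.inr ⟨x, rfl⟩)

instance normal_cubePhi (K : Type v) [Group K] : (cubePhi K).Normal where
  conj_mem n hn g := by
    have h : g * n * g⁻¹ = n * comm n g⁻¹ := by simp only [comm]; group
    rw [h]
    exact mul_mem hn (comm_mem_cubePhi _ _)

variable [CharP F 3]

theorem addChar1_eq_zero_of_mem_cubePhi {K : Type v} [Group K] (φ : AddChar1 F K) {x : K}
    (hx : x ∈ cubePhi K) : φ (Additive.ofMul x) = 0 := by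
  induction hx using Subgroup.closure_induction with
  | mem x hx =>
    rcases hx with ⟨y, z, rfl⟩ | ⟨y, rfl⟩
    · simp only [comm, ofMul_mul, ofMul_inv, map_add, map_neg]
      abel
    · rw [ofMul_pow, map_nsmul, nsmul_eq_mul]
      have : ((3 : ℕ) : F) = 0 := CharP.cast_eq_zero F 3
      rw [this, zero_mul]
  | one => simp
  | mul x y _ _ hx hy => rw [ofMul_mul, map_add, hx, hy, add_zero]
  | inv x _ hx => rw [ofMul_inv, map_neg, hx, neg_zero]

theorem homRank_eq_of_card {K : Type v} [Group K] [Finite K] {k : ℕ}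
    (h : Nat.card K = 3 ^ k * Nat.card (cubePhi K)) : homRank F K = k := by
  have hcomm : ∀ x y : K ⧸ cubePhi K, x * y = y * x := by
    intro x y
    induction x using QuotientGroup.induction_on with | H x =>
    induction y using QuotientGroup.induction_on with | H y =>
    rw [← QuotientGroup.mk_mul, ← QuotientGroup.mk_mul, QuotientGroup.eq]
    have := comm_mem_cubePhi y x
    simpa [comm, mul_assoc] using this
  let _ : CommGroup (K ⧸ cubePhi K) := { mul_comm := hcomm }
  let V := Additive (K ⧸ cubePhi K)
  let _ : Module (ZMod 3) V := AddCommGroup.zmodModule (n := 3) (by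
    intro x
    change Additive.ofMul (x.toMul ^ 3) = 0
    generalize x.toMul = y
    induction y using QuotientGroup.induction_on with | H y =>
    rw [← QuotientGroup.mk_pow, (QuotientGroup.eq_one_iff (y ^ 3)).2 (cube_mem_cubePhi y)]
    rfl)
  let _ : Algebra (ZMod 3) F := ZMod.algebra F 3
  have hcard : Nat.card V = 3 ^ k := by
    have h1 := Subgroup.card_eq_card_quotient_mul_card_subgroup (cubePhi K)
    rw [h] at h1
    exact (Nat.eq_of_mul_eq_mul_right Nat.card_pos h1).symm
  have hfr : Module.finrank (ZMod 3) V = k := by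
    have h1 := Module.natCard_eq_pow_finrank (K := ZMod 3) (V := V)
    rw [hcard, Nat.card_zmod] at h1
    exact (Nat.pow_right_injective (by norm_num : 2 ≤ 3) h1).symm
  let e : (V →ₗ[ZMod 3] F) ≃ₗ[F] AddChar1 F K :=
    { toFun := fun φ => φ.toAddMonoidHom.comp (MonoidHom.toAdditive (QuotientGroup.mk' (cubePhi K)))
      map_add' := fun _ _ => rfl
      map_smul' := fun _ _ => rfl
      invFun := fun φ => AddMonoidHom.toZModLinearMap 3
        (MonoidHom.toAdditiveLeft (QuotientGroup.lift (cubePhi K) (AddMonoidHom.toMultiplicativeRight φ)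
          fun x hx => addChar1_eq_zero_of_mem_cubePhi φ hx))
      left_inv := fun φ => by
        ext x
        obtain ⟨y, hy⟩ := QuotientGroup.mk_surjective x.toMul
        obtain rfl : Additive.ofMul (QuotientGroup.mk y) = x := hy
        rfl
      right_inv := fun φ => by
        ext x
        rfl }
  rw [homRank, ← e.finrank_eq, ← ((Module.finBasis (ZMod 3) V).constr F).finrank_eq,
    Module.finrank_fintype_fun_eq_card, Fintype.card_fin, hfr]

/-- For an abelian group, the rank can be read off from the number of solutions of `x³ = 1`. -/
theorem homRank_eq_of_card_torsion {K : Type v} [Group K] [Finite K] {k : ℕ}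
    (hK : ∀ x y : K, x * y = y * x) (h : Nat.card {x : K // x ^ 3 = 1} = 3 ^ k) :
    homRank F K = k := by
  let _ : CommGroup K := { mul_comm := hK }
  refine homRank_eq_of_card ?_
  have h1 : cubePhi K = (powMonoidHom 3 : K →* K).range := by
    apply le_antisymm
    · rw [cubePhi, Subgroup.closure_le]
      rintro _ (⟨x, y, rfl⟩ | ⟨x, rfl⟩)
      · refine ⟨1, ?_⟩
        simp [comm, mul_comm]
      · exact ⟨x, rfl⟩
    · rintro _ ⟨x, rfl⟩
      exact cube_mem_cubePhi x
  have h2 : Nat.card (powMonoidHom 3 : K →* K).ker = 3 ^ k := by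
    rw [← h]
    exact Nat.card_congr (Equiv.refl _)
  rw [h1, ← h2, ← Subgroup.card_mul_index (powMonoidHom 3 : K →* K).ker, Subgroup.index_ker]

end HochschildGroupAlgebra

/-! ### Standard generators and normal forms -/

section Pairs

variable {G : Type v} [Group G] {x y : G}

/-- The product `x ^ k * y ^ l`, used for commuting elements `x` and `y`. -/
def pw (x y : G) (k l : ℤ) : G := x ^ k * y ^ l

theorem pw_mul (h : Commute x y) (k l k' l' : ℤ) :
    pw x y k l * pw x y k' l' = pw x y (k + k') (l + l') := by
  have h1 : y ^ l * x ^ k' = x ^ k' * y ^ l := (h.symm.zpow_zpow l k').eq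
  simp only [pw, zpow_add]
  rw [mul_assoc, ← mul_assoc (y ^ l), h1]
  simp only [mul_assoc]

theorem pw_inv (h : Commute x y) (k l : ℤ) : (pw x y k l)⁻¹ = pw x y (-k) (-l) := by
  rw [inv_eq_iff_mul_eq_one, pw_mul h]
  simp [pw]

theorem pw_zpow (h : Commute x y) (k l m : ℤ) : pw x y k l ^ m = pw x y (k * m) (l * m) := by
  rw [pw, (h.zpow_zpow k l).mul_zpow, ← zpow_mul, ← zpow_mul, pw]

theorem pw_pow (h : Commute x y) (k l : ℤ) (m : ℕ) :
    pw x y k l ^ m = pw x y (k * m) (l * m) := by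
  rw [← zpow_natCast, pw_zpow h]

theorem pw_comm (h : Commute x y) (k l k' l' : ℤ) :
    pw x y k l * pw x y k' l' = pw x y k' l' * pw x y k l := by
  rw [pw_mul h, pw_mul h, add_comm k, add_comm l]

@[simp] theorem pw_zero_zero : pw x y 0 0 = 1 := by simp [pw]

@[simp] theorem pw_zero_right (k : ℤ) : pw x y k 0 = x ^ k := by simp [pw]

@[simp] theorem pw_zero_left (l : ℤ) : pw x y 0 l = y ^ l := by simp [pw]

/-- The subgroup of all `x ^ k * y ^ l` for commuting `x` and `y`. -/
def pwSubgroup (h : Commute x y) : Subgroup G where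
  carrier := {u | ∃ k l : ℤ, u = pw x y k l}
  mul_mem' := by
    rintro _ _ ⟨k, l, rfl⟩ ⟨k', l', rfl⟩
    exact ⟨_, _, pw_mul h _ _ _ _⟩
  one_mem' := ⟨0, 0, by simp⟩
  inv_mem' := by
    rintro _ ⟨k, l, rfl⟩
    exact ⟨_, _, pw_inv h _ _⟩

theorem mem_pwSubgroup {h : Commute x y} {u : G} :
    u ∈ pwSubgroup h ↔ ∃ k l : ℤ, u = pw x y k l := Iff.rfl

theorem pw_mem_pwSubgroup (h : Commute x y) (k l : ℤ) : pw x y k l ∈ pwSubgroup h := ⟨k, l, rfl⟩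

theorem left_mem_pwSubgroup (h : Commute x y) : x ∈ pwSubgroup h := ⟨1, 0, by simp⟩

theorem right_mem_pwSubgroup (h : Commute x y) : y ∈ pwSubgroup h := ⟨0, 1, by simp⟩

theorem zpow_eq_one_of_dvd {N : ℕ} (hx : x ^ N = 1) {k : ℤ} (hk : (N : ℤ) ∣ k) : x ^ k = 1 := by
  obtain ⟨m, rfl⟩ := hk
  rw [zpow_mul, zpow_natCast, hx, one_zpow]

theorem zpow_eq_zpow_of_dvd {N : ℕ} (hx : x ^ N = 1) {k l : ℤ} (hk : (N : ℤ) ∣ k - l) :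
    x ^ k = x ^ l := by
  have := zpow_eq_one_of_dvd hx hk
  rwa [zpow_sub, mul_inv_eq_one] at this

theorem pw_congr {M N : ℕ} (hx : x ^ M = 1) (hy : y ^ N = 1) {k l k' l' : ℤ}
    (hk : (M : ℤ) ∣ k - k') (hl : (N : ℤ) ∣ l - l') : pw x y k l = pw x y k' l' := by
  rw [pw, pw, zpow_eq_zpow_of_dvd hx hk, zpow_eq_zpow_of_dvd hy hl]

/-- If `x ^ k * y ^ l = 1` only for the obvious exponents, then `x` and `y` generate a group of
order `M * N`. -/
theorem card_pwSubgroup (h : Commute x y) {M N : ℕ} (hM : 0 < M) (hN : 0 < N)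
    (hxy : ∀ k l : ℤ, pw x y k l = 1 ↔ (M : ℤ) ∣ k ∧ (N : ℤ) ∣ l) :
    Nat.card (pwSubgroup h) = M * N := by
  have hx : x ^ M = 1 := by
    have := (hxy M 0).2 ⟨dvd_rfl, dvd_zero _⟩
    rwa [pw_zero_right, zpow_natCast] at this
  have hy : y ^ N = 1 := by
    have := (hxy 0 N).2 ⟨dvd_zero _, dvd_rfl⟩
    rwa [pw_zero_left, zpow_natCast] at this
  let f : Fin M × Fin N → pwSubgroup h := fun p => ⟨_, pw_mem_pwSubgroup h p.1 p.2⟩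
  have hf : Function.Bijective f := by
    constructor
    · rintro ⟨i, j⟩ ⟨i', j'⟩ hij
      have h1 : pw x y i j = pw x y i' j' := congrArg Subtype.val hij
      rw [← mul_inv_eq_one, pw_inv h, pw_mul h, hxy] at h1
      have hi := Int.eq_zero_of_abs_lt_dvd h1.1 (by
        rw [abs_lt]; constructor <;> have := i.2 <;> have := i'.2 <;> omega)
      have hj := Int.eq_zero_of_abs_lt_dvd h1.2 (by
        rw [abs_lt]; constructor <;> have := j.2 <;> have := j'.2 <;> omega)
      ext <;> simp <;> omega
    · rintro ⟨_, k, l, rfl⟩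
      have hM' : (0 : ℤ) < M := by exact_mod_cast hM
      have hN' : (0 : ℤ) < N := by exact_mod_cast hN
      have e1 : ((k % M).toNat : ℤ) = k % M := Int.toNat_of_nonneg (Int.emod_nonneg _ hM'.ne')
      have e2 : ((l % N).toNat : ℤ) = l % N := Int.toNat_of_nonneg (Int.emod_nonneg _ hN'.ne')
      refine ⟨⟨⟨(k % M).toNat, ?_⟩, ⟨(l % N).toNat, ?_⟩⟩, ?_⟩
      · have := Int.emod_lt_of_pos k hM'; omega
      · have := Int.emod_lt_of_pos l hN'; omega
      · ext
        simp only [f, e1, e2]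
        exact pw_congr hx hy ((dvd_sub_comm).1 Int.dvd_self_sub_emod)
          ((dvd_sub_comm).1 Int.dvd_self_sub_emod)
  rw [← Nat.card_congr (Equiv.ofBijective f hf)]
  simp

theorem comm_eq_one_iff {u v : G} : comm u v = 1 ↔ Commute u v := by
  rw [comm, Commute, SemiconjBy]
  constructor
  · intro h
    have : v * u * (u⁻¹ * v⁻¹ * u * v) = v * u := by rw [h, mul_one]
    rw [← this]; group
  · intro h
    rw [mul_assoc, h]; group

theorem conj_eq_mul_comm (u v : G) : v⁻¹ * u * v = u * comm u v := by
  simp only [comm]; group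

theorem comm_eq_of_conj {u v w : G} (h : v⁻¹ * u * v = u * w) : comm u v = w := by
  rw [conj_eq_mul_comm] at h
  exact mul_left_cancel h

theorem mem_center_of_closure {S : Set G} (hS : Subgroup.closure S = ⊤) {u : G}
    (h : ∀ s ∈ S, Commute u s) : u ∈ Subgroup.center G := by
  have : Subgroup.closure S ≤ Subgroup.centralizer {u} := by
    rw [Subgroup.closure_le]
    intro s hs
    exact Subgroup.mem_centralizer_singleton_iff.2 (h s hs).symm.eq
  rw [hS] at this
  rw [Subgroup.mem_center_iff]
  intro g
  exact Subgroup.mem_centralizer_singleton_iff.1 (this (Subgroup.mem_top g))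

theorem normal_of_closure {S : Set G} (hS : Subgroup.closure S = ⊤) {N : Subgroup G}
    (h : ∀ s ∈ S, ∀ u ∈ N, s * u * s⁻¹ ∈ N ∧ s⁻¹ * u * s ∈ N) : N.Normal := by
  rw [← Subgroup.normalizer_eq_top_iff, eq_top_iff, ← hS, Subgroup.closure_le]
  intro s hs
  rw [SetLike.mem_coe, Subgroup.mem_normalizer_iff]
  intro u
  refine ⟨fun hu => (h s hs u hu).1, fun hu => ?_⟩
  have := (h s hs _ hu).2
  have e : s⁻¹ * (s * u * s⁻¹) * s = u := by group
  rwa [e] at this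

end Pairs

section Standard

variable {G : Type v} [Group G]

/-- The element `z` computed from `c` and `d` in any group. In the groups considered it is the
`(n-3)`-fold commutator `[c, a, …, a]`; for `n = 3` it is `c` itself. -/
def zElt (n : ℕ) (c d : G) : G :=
  if Even n then d ^ ((-3 : ℤ) ^ ((n - 4) / 2)) else c ^ ((-3 : ℤ) ^ ((n - 3) / 2))

/-- The elements `a, b, c, d` generate `G` and satisfy the relations of `MaxQuot n α β γ`. The
exponents `⌊(n-1)/2⌋` and `⌊(n-2)/2⌋` of the orders of `c` and `d` cover both parities of `n`, and
`n = 3` is allowed, where `G` has order dividing `27` and `d = 1`. -/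
structure Std (n : ℕ) (a b c d : G) (α β γ : ℤ) : Prop where
  gen : Subgroup.closure {a, b} = ⊤
  hc : c = comm b a
  hd : d = comm c a
  da : comm d a = c ^ (-3 : ℤ) * d ^ (-3 : ℤ)
  db : comm d b = 1
  dc : comm d c = 1
  c_pow : c ^ 3 ^ ((n - 1) / 2) = 1
  d_pow : d ^ 3 ^ ((n - 2) / 2) = 1
  a_pow : a ^ 3 = zElt n c d ^ α
  b_pow : b ^ 3 = c ^ (-3 : ℤ) * d⁻¹ * zElt n c d ^ β
  cb : comm c b = zElt n c d ^ γ

theorem zElt_even (m : ℕ) (c d : G) : zElt (2 * m + 4) c d = d ^ ((-3 : ℤ) ^ m) := by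
  rw [zElt, if_pos (by simp [parity_simps])]
  congr 2
  omega

theorem zElt_odd (m : ℕ) (c d : G) : zElt (2 * m + 3) c d = c ^ ((-3 : ℤ) ^ m) := by
  rw [zElt, if_neg (by simp [parity_simps])]
  congr 2
  omega

theorem neg_three_pow_dvd (m : ℕ) : ((3 ^ m : ℕ) : ℤ) ∣ (-3) ^ m := by
  push_cast
  exact pow_dvd_pow_of_dvd (by norm_num) m

theorem even_or_odd_form {n : ℕ} (hn : 4 ≤ n) : ∃ m, n = 2 * m + 4 ∨ n = 2 * (m + 1) + 3 := by
  rcases Nat.even_or_odd' n with ⟨k, rfl | rfl⟩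
  · exact ⟨k - 2, Or.inl (by omega)⟩
  · exact ⟨k - 2, Or.inr (by omega)⟩

namespace Std

variable {n : ℕ} {a b c d : G} {α β γ : ℤ}

theorem commute_cd (h : Std n a b c d α β γ) : Commute c d := (comm_eq_one_iff.1 h.dc).symm

theorem commute_bd (h : Std n a b c d α β γ) : Commute b d := (comm_eq_one_iff.1 h.db).symm

theorem conj_b_a (h : Std n a b c d α β γ) : a⁻¹ * b * a = b * c := by
  rw [conj_eq_mul_comm, ← h.hc]

theorem conj_c_a (h : Std n a b c d α β γ) : a⁻¹ * c * a = c * d := by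
  rw [conj_eq_mul_comm, ← h.hd]

/-- The action of `a` on the subgroup generated by `c` and `d`. -/
theorem conj_a (h : Std n a b c d α β γ) (k l : ℤ) :
    a⁻¹ * pw c d k l * a = pw c d (k - 3 * l) (k - 2 * l) := by
  have h1 : ∀ x, a⁻¹ * x * a = MulAut.conj a⁻¹ x := fun x => by simp
  have h2 : MulAut.conj a⁻¹ c = pw c d 1 1 := by rw [← h1, h.conj_c_a]; simp [pw]
  have h3 : MulAut.conj a⁻¹ d = pw c d (-3) (-2) := by
    rw [← h1, conj_eq_mul_comm, h.da]
    have := pw_mul h.commute_cd 0 1 (-3) (-3)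
    simpa [pw] using this
  rw [h1, pw, map_mul, map_zpow, map_zpow, h2, h3, pw_zpow h.commute_cd, pw_zpow h.commute_cd,
    pw_mul h.commute_cd]
  congr 1 <;> ring

theorem conj_a_inv (h : Std n a b c d α β γ) (k l : ℤ) :
    a * pw c d k l * a⁻¹ = pw c d (-2 * k + 3 * l) (-k + l) := by
  have h1 := h.conj_a (-2 * k + 3 * l) (-k + l)
  have h2 : pw c d (-2 * k + 3 * l - 3 * (-k + l)) (-2 * k + 3 * l - 2 * (-k + l)) =
      pw c d k l := by congr 1 <;> ring
  rw [← h2, ← h1]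
  group

theorem z_eq_pw (n : ℕ) (c d : G) : ∃ k l, zElt n c d = pw c d k l := by
  rw [zElt]
  split_ifs
  · exact ⟨0, _, (pw_zero_left _).symm⟩
  · exact ⟨_, 0, (pw_zero_right _).symm⟩

theorem pw_congr' (h : Std n a b c d α β γ) {k l k' l' : ℤ}
    (hk : ((3 ^ ((n - 1) / 2) : ℕ) : ℤ) ∣ k - k') (hl : ((3 ^ ((n - 2) / 2) : ℕ) : ℤ) ∣ l - l') :
    pw c d k l = pw c d k' l' :=
  pw_congr h.c_pow h.d_pow hk hl

theorem z_cube (h : Std n a b c d α β γ) (hn : 4 ≤ n) : zElt n c d ^ 3 = 1 := by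
  obtain ⟨m, rfl | rfl⟩ := even_or_odd_form hn
  · rw [zElt_even, ← zpow_natCast, ← zpow_mul]
    refine zpow_eq_one_of_dvd h.d_pow ?_
    rw [show (2 * m + 4 - 2) / 2 = m + 1 by omega]
    exact (neg_three_pow_dvd (m + 1)).trans ⟨-1, by push_cast; ring⟩
  · rw [zElt_odd, ← zpow_natCast, ← zpow_mul]
    refine zpow_eq_one_of_dvd h.c_pow ?_
    rw [show (2 * (m + 1) + 3 - 1) / 2 = m + 2 by omega]
    exact (neg_three_pow_dvd (m + 2)).trans ⟨-1, by push_cast; ring⟩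

theorem z_commute_c (h : Std n a b c d α β γ) : Commute (zElt n c d) c := by
  obtain ⟨k, l, hz⟩ := z_eq_pw n c d
  rw [hz]
  have := pw_comm h.commute_cd k l 1 0
  simpa [Commute, SemiconjBy] using this

theorem z_commute_a (h : Std n a b c d α β γ) (hn : 4 ≤ n) : Commute (zElt n c d) a := by
  suffices a⁻¹ * zElt n c d * a = zElt n c d by
    rw [mul_assoc, inv_mul_eq_iff_eq_mul] at this
    exact this
  obtain ⟨m, rfl | rfl⟩ := even_or_odd_form hn
  · rw [zElt_even, ← pw_zero_left (x := c), h.conj_a]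
    refine h.pw_congr' ?_ ?_
    · rw [show (2 * m + 4 - 1) / 2 = m + 1 by omega]
      exact (neg_three_pow_dvd (m + 1)).trans ⟨1, by ring⟩
    · rw [show (2 * m + 4 - 2) / 2 = m + 1 by omega]
      exact (neg_three_pow_dvd (m + 1)).trans ⟨1, by ring⟩
  · rw [zElt_odd, ← pw_zero_right (y := d), h.conj_a]
    refine h.pw_congr' ⟨0, by ring⟩ ?_
    rw [show (2 * (m + 1) + 3 - 2) / 2 = m + 1 by omega]
    exact (neg_three_pow_dvd (m + 1)).trans ⟨1, by ring⟩

theorem conj_c_b (h : Std n a b c d α β γ) : b⁻¹ * c * b = c * zElt n c d ^ γ := by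
  rw [conj_eq_mul_comm, h.cb]

/-- The action of `b` on the subgroup generated by `c` and `d`. -/
theorem conj_b (h : Std n a b c d α β γ) (k l : ℤ) :
    b⁻¹ * pw c d k l * b = pw c d k l * zElt n c d ^ (γ * k) := by
  have h1 : ∀ x, b⁻¹ * x * b = MulAut.conj b⁻¹ x := fun x => by simp
  have h3 : MulAut.conj b⁻¹ d = d := by
    rw [← h1, conj_eq_mul_comm, h.db, mul_one]
  have hz : Commute (d ^ l) (zElt n c d ^ (γ * k)) := by
    obtain ⟨i, j, hz⟩ := z_eq_pw n c d
    have := pw_comm h.commute_cd 0 1 i j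
    rw [pw_zero_left, zpow_one, ← hz] at this
    exact Commute.zpow_zpow this _ _
  rw [h1, pw, map_mul, map_zpow, map_zpow, h3, ← h1, h.conj_c_b,
    (h.z_commute_c.symm.zpow_right γ).mul_zpow, ← zpow_mul, mul_assoc, mul_assoc, hz.eq]

theorem z_commute_b (h : Std n a b c d α β γ) (hn : 4 ≤ n) : Commute (zElt n c d) b := by
  suffices b⁻¹ * zElt n c d * b = zElt n c d by
    rw [mul_assoc, inv_mul_eq_iff_eq_mul] at this
    exact this
  have hz3 := h.z_cube hn
  obtain ⟨m, rfl | rfl⟩ := even_or_odd_form hn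
  · rw [zElt_even, ← pw_zero_left (x := c), h.conj_b]
    simp
  · have h1 := h.conj_b ((-3) ^ (m + 1)) 0
    rw [pw_zero_right, ← zElt_odd (d := d), zpow_eq_one_of_dvd hz3 (k := γ * _), mul_one] at h1
    · exact h1
    · exact Dvd.dvd.mul_left ⟨-(-3) ^ m, by push_cast; ring⟩ _

theorem z_mem_center (h : Std n a b c d α β γ) (hn : 4 ≤ n) :
    zElt n c d ∈ Subgroup.center G := by
  refine mem_center_of_closure h.gen ?_
  rintro s (rfl | rfl)
  · exact h.z_commute_a hn
  · exact h.z_commute_b hn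

theorem z_mem (h : Std n a b c d α β γ) : zElt n c d ∈ pwSubgroup h.commute_cd := z_eq_pw n c d

theorem a_pow_mem (h : Std n a b c d α β γ) : a ^ 3 ∈ pwSubgroup h.commute_cd := by
  rw [h.a_pow]
  exact zpow_mem h.z_mem _

theorem b_pow_mem (h : Std n a b c d α β γ) : b ^ 3 ∈ pwSubgroup h.commute_cd := by
  rw [h.b_pow]
  exact mul_mem (mul_mem (zpow_mem (left_mem_pwSubgroup _) _)
    (inv_mem (right_mem_pwSubgroup _))) (zpow_mem h.z_mem _)

theorem normal_pwSubgroup (h : Std n a b c d α β γ) (hn : 4 ≤ n) :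
    (pwSubgroup h.commute_cd).Normal := by
  refine normal_of_closure h.gen ?_
  rintro s (rfl | rfl) u ⟨k, l, rfl⟩
  · rw [h.conj_a, h.conj_a_inv]
    exact ⟨pw_mem_pwSubgroup _ _ _, pw_mem_pwSubgroup _ _ _⟩
  · rw [h.conj_b]
    refine ⟨?_, mul_mem (pw_mem_pwSubgroup _ _ _) (zpow_mem h.z_mem _)⟩
    have h1 := h.conj_b k l
    have h2 : s * pw c d k l * s⁻¹ = pw c d k l * (zElt n c d ^ (γ * k))⁻¹ := by
      have h3 : Commute (zElt n c d ^ (γ * k)) s := (h.z_commute_b hn).zpow_left _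
      have h4 : pw c d k l = s * (pw c d k l * zElt n c d ^ (γ * k)) * s⁻¹ := by rw [← h1]; group
      rw [eq_mul_inv_iff_mul_eq]
      conv_rhs => rw [h4]
      have h5 : s⁻¹ * zElt n c d ^ (γ * k) = zElt n c d ^ (γ * k) * s⁻¹ := h3.symm.inv_left.eq
      simp only [mul_assoc]
      rw [h5]
    rw [h2]
    exact mul_mem (pw_mem_pwSubgroup _ _ _) (inv_mem (zpow_mem h.z_mem _))

theorem normal_sup (h : Std n a b c d α β γ) (hn : 4 ≤ n) :
    (Subgroup.zpowers b ⊔ pwSubgroup h.commute_cd).Normal := by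
  have hA := h.normal_pwSubgroup hn
  have hb : b ∈ Subgroup.zpowers b ⊔ pwSubgroup h.commute_cd :=
    le_sup_left (a := Subgroup.zpowers b) (Subgroup.mem_zpowers b)
  have hA' : pwSubgroup h.commute_cd ≤ Subgroup.zpowers b ⊔ pwSubgroup h.commute_cd := le_sup_right
  refine normal_of_closure h.gen ?_
  rintro s (rfl | rfl) u hu
  · obtain ⟨v, hv, y, hy, rfl⟩ := Subgroup.mem_sup_of_normal_right.1 hu
    obtain ⟨j, rfl⟩ := Subgroup.mem_zpowers_iff.1 hv
    constructor
    · have h1 : s * b * s⁻¹ = b * (s * c * s⁻¹)⁻¹ := by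
        have h2 : b = s * (b * c) * s⁻¹ := by rw [← h.conj_b_a]; group
        rw [eq_mul_inv_iff_mul_eq]
        conv_rhs => rw [h2]
        group
      have h3 : s * (b ^ j * y) * s⁻¹ = (s * b * s⁻¹) ^ j * (s * y * s⁻¹) := by
        rw [conj_zpow]; group
      rw [h3, h1]
      exact mul_mem (zpow_mem (mul_mem hb (inv_mem (hA' (hA.conj_mem _
        (left_mem_pwSubgroup _) _)))) _) (hA' (hA.conj_mem _ hy _))
    · have h3 : s⁻¹ * (b ^ j * y) * s = (s⁻¹ * b * s) ^ j * (s⁻¹ * y * s⁻¹⁻¹) := by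
        have := conj_zpow (i := j) (a := s⁻¹) (b := b)
        rw [inv_inv] at this
        rw [this]; group
      rw [h3, h.conj_b_a]
      exact mul_mem (zpow_mem (mul_mem hb (hA' (left_mem_pwSubgroup _))) _)
        (hA' (hA.conj_mem _ hy _))
  · exact ⟨mul_mem (mul_mem hb hu) (inv_mem hb), mul_mem (mul_mem (inv_mem hb) hu) hb⟩

theorem exists_eq (h : Std n a b c d α β γ) (hn : 4 ≤ n) (g : G) :
    ∃ i j k l : ℤ, g = a ^ i * (b ^ j * pw c d k l) := by
  have hA := h.normal_pwSubgroup hn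
  have hB := h.normal_sup hn
  have htop : g ∈ Subgroup.zpowers a ⊔ (Subgroup.zpowers b ⊔ pwSubgroup h.commute_cd) := by
    have : Subgroup.closure {a, b} ≤
        Subgroup.zpowers a ⊔ (Subgroup.zpowers b ⊔ pwSubgroup h.commute_cd) := by
      rw [Subgroup.closure_le]
      rintro s (rfl | rfl)
      · exact le_sup_left (a := Subgroup.zpowers s) (Subgroup.mem_zpowers s)
      · exact le_sup_right (a := Subgroup.zpowers a)
          (le_sup_left (a := Subgroup.zpowers s) (Subgroup.mem_zpowers s))
    rw [h.gen] at this
    exact this (Subgroup.mem_top g)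
  obtain ⟨u, hu, v, hv, rfl⟩ := Subgroup.mem_sup_of_normal_right.1 htop
  obtain ⟨i, rfl⟩ := Subgroup.mem_zpowers_iff.1 hu
  obtain ⟨w, hw, y, ⟨k, l, rfl⟩, rfl⟩ := Subgroup.mem_sup_of_normal_right.1 hv
  obtain ⟨j, rfl⟩ := Subgroup.mem_zpowers_iff.1 hw
  exact ⟨i, j, k, l, rfl⟩

/-- The normal form `a ^ i * b ^ j * c ^ k * d ^ l`. -/
def coord (n : ℕ) (a b c d : G)
    (p : Fin 3 × Fin 3 × Fin (3 ^ ((n - 1) / 2)) × Fin (3 ^ ((n - 2) / 2))) : G :=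
  a ^ (p.1 : ℤ) * (b ^ (p.2.1 : ℤ) * pw c d (p.2.2.1 : ℤ) (p.2.2.2 : ℤ))

theorem coord_surjective (h : Std n a b c d α β γ) (hn : 4 ≤ n) :
    Function.Surjective (coord n a b c d) := by
  have hfin : ∀ (N : ℕ), 0 < N → ∀ k : ℤ, ∃ i : Fin N, (N : ℤ) ∣ k - (i : ℤ) := by
    intro N hN k
    have hN' : (0 : ℤ) < N := by exact_mod_cast hN
    refine ⟨⟨(k % N).toNat, ?_⟩, ?_⟩
    · have := Int.emod_lt_of_pos k hN'; omega
    · have e1 : ((k % N).toNat : ℤ) = k % N := Int.toNat_of_nonneg (Int.emod_nonneg _ hN'.ne')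
      simp only [e1]
      exact Int.dvd_self_sub_emod
  have hA := h.normal_pwSubgroup hn
  intro g
  obtain ⟨i, j, k, l, rfl⟩ := h.exists_eq hn g
  obtain ⟨i', q, hq⟩ := hfin 3 (by norm_num) i
  -- move the excess powers of `a` and `b` into the subgroup generated by `c` and `d`
  obtain ⟨j1, k1, l1, hj1⟩ : ∃ j1 k1 l1 : ℤ,
      (a ^ 3) ^ q * (b ^ j * pw c d k l) = b ^ j1 * pw c d k1 l1 := by
    have h1 : b ^ (-j) * (a ^ 3) ^ q * (b ^ (-j))⁻¹ ∈ pwSubgroup h.commute_cd :=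
      hA.conj_mem _ (zpow_mem h.a_pow_mem q) _
    obtain ⟨k1, l1, h2⟩ := mul_mem h1 (pw_mem_pwSubgroup h.commute_cd k l)
    refine ⟨j, k1, l1, ?_⟩
    rw [← h2]
    group
  have hai : a ^ i = a ^ ((i' : ℕ) : ℤ) * (a ^ 3) ^ q := by
    rw [← zpow_natCast a 3, ← zpow_mul, ← zpow_add]
    congr 1
    linarith
  obtain ⟨j', q', hq'⟩ := hfin 3 (by norm_num) j1
  obtain ⟨k2, l2, h2⟩ := mul_mem (zpow_mem h.b_pow_mem q') (pw_mem_pwSubgroup h.commute_cd k1 l1)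
  have hbj : b ^ j1 = b ^ ((j' : ℕ) : ℤ) * (b ^ 3) ^ q' := by
    rw [← zpow_natCast b 3, ← zpow_mul, ← zpow_add]
    congr 1
    linarith
  obtain ⟨k', hk'⟩ := hfin (3 ^ ((n - 1) / 2)) (by positivity) k2
  obtain ⟨l', hl'⟩ := hfin (3 ^ ((n - 2) / 2)) (by positivity) l2
  refine ⟨⟨i', j', k', l'⟩, ?_⟩
  rw [coord, ← h.pw_congr' hk' hl', ← h2, ← mul_assoc (b ^ ((j' : ℕ) : ℤ)), ← hbj, ← hj1,
    ← mul_assoc, ← hai]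

theorem card_coord (hn : 4 ≤ n) : Nat.card (Fin 3 × Fin 3 × Fin (3 ^ ((n - 1) / 2)) ×
    Fin (3 ^ ((n - 2) / 2))) = 3 ^ n := by
  simp only [Nat.card_prod, Nat.card_fin]
  have : n = 1 + (1 + ((n - 1) / 2 + (n - 2) / 2)) := by omega
  conv_rhs => rw [this]
  rw [pow_add, pow_add, pow_add, pow_one]

theorem finite (h : Std n a b c d α β γ) (hn : 4 ≤ n) : Finite G :=
  Finite.of_surjective _ (h.coord_surjective hn)

theorem card_le (h : Std n a b c d α β γ) (hn : 4 ≤ n) : Nat.card G ≤ 3 ^ n := by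
  rw [← card_coord hn]
  exact Nat.card_le_card_of_surjective _ (h.coord_surjective hn)

theorem coord_bijective (h : Std n a b c d α β γ) (hn : 4 ≤ n) (hG : Nat.card G = 3 ^ n) :
    Function.Bijective (coord n a b c d) := by
  rw [Nat.bijective_iff_surjective_and_card]
  exact ⟨h.coord_surjective hn, by rw [card_coord hn, hG]⟩

theorem map_zElt {H : Type*} [Group H] (f : G →* H) (n : ℕ) (c d : G) :
    f (zElt n c d) = zElt n (f c) (f d) := by
  rw [zElt, zElt]
  split_ifs <;> rw [map_zpow]

theorem map_comm {H : Type*} [Group H] (f : G →* H) (u v : G) :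
    f (comm u v) = comm (f u) (f v) := by
  simp [comm]

theorem map {H : Type*} [Group H] (h : Std n a b c d α β γ) (f : G →* H)
    (hf : Function.Surjective f) : Std n (f a) (f b) (f c) (f d) α β γ where
  gen := by
    have := congrArg (Subgroup.map f) h.gen
    rwa [MonoidHom.map_closure, Set.image_pair, Subgroup.map_top_of_surjective f hf] at this
  hc := by rw [← map_comm, ← h.hc]
  hd := by rw [← map_comm, ← h.hd]
  da := by rw [← map_comm, h.da, map_mul, map_zpow, map_zpow]
  db := by rw [← map_comm, h.db, map_one]
  dc := by rw [← map_comm, h.dc, map_one]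
  c_pow := by rw [← map_pow, h.c_pow, map_one]
  d_pow := by rw [← map_pow, h.d_pow, map_one]
  a_pow := by rw [← map_pow, h.a_pow, map_zpow, map_zElt]
  b_pow := by rw [← map_pow, h.b_pow, map_mul, map_mul, map_zpow, map_zpow, map_inv, map_zElt]
  cb := by rw [← map_comm, h.cb, map_zpow, map_zElt]

end Std

theorem z_eq_zElt (n : ℕ) : z n = zElt n (MaxClassThree.c) (MaxClassThree.d) := rfl

theorem mk_eq_mk_of_rel_mem {R : Set (FreeGroup Gen)} {x y : FreeGroup Gen} (h : rel x y ∈ R) :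
    PresentedGroup.mk R x = PresentedGroup.mk R y :=
  PresentedGroup.mk_eq_mk_of_mul_inv_mem h

/-- The defining generators of `MaxQuot n α β γ` satisfy the relations. -/
theorem std_maxQuot (n : ℕ) (α β γ : ℤ) :
    ∃ x y u v : MaxQuot n α β γ, Std n x y u v α β γ := by
  set R : Set (FreeGroup Gen) := baseRels n ∪
    {rel (a ^ 3) (z n ^ α), rel (b ^ 3) (c ^ (-3 : ℤ) * d⁻¹ * z n ^ β), rel (comm c b) (z n ^ γ)}
    with hR
  have hz : PresentedGroup.mk R (z n) =
      zElt n (PresentedGroup.mk R c) (PresentedGroup.mk R d) := by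
    rw [z_eq_zElt, Std.map_zElt]
  have hgen : Subgroup.closure {PresentedGroup.mk R a, PresentedGroup.mk R b,
      PresentedGroup.mk R c, PresentedGroup.mk R d} = ⊤ := by
    rw [eq_top_iff, ← PresentedGroup.closure_range_of R, Subgroup.closure_le]
    rintro _ ⟨x | x | x | x, rfl⟩ <;> refine Subgroup.subset_closure ?_
    · exact Or.inl rfl
    · exact Or.inr (Or.inl rfl)
    · exact Or.inr (Or.inr (Or.inl rfl))
    · exact Or.inr (Or.inr (Or.inr rfl))
  have hc : PresentedGroup.mk R c = comm (PresentedGroup.mk R b) (PresentedGroup.mk R a) := by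
    rw [← Std.map_comm]
    exact mk_eq_mk_of_rel_mem (Or.inl (Or.inl (by simp)))
  have hd : PresentedGroup.mk R d = comm (PresentedGroup.mk R c) (PresentedGroup.mk R a) := by
    rw [← Std.map_comm]
    exact mk_eq_mk_of_rel_mem (Or.inl (Or.inl (by simp)))
  refine ⟨PresentedGroup.mk R a, PresentedGroup.mk R b, PresentedGroup.mk R c,
    PresentedGroup.mk R d, ⟨?_, hc, hd, ?_, ?_, ?_, ?_, ?_, ?_, ?_, ?_⟩⟩
  · rw [eq_top_iff, ← hgen, Subgroup.closure_le]
    have ha : PresentedGroup.mk R a ∈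
        Subgroup.closure {PresentedGroup.mk R a, PresentedGroup.mk R b} :=
      Subgroup.subset_closure (Or.inl rfl)
    have hb : PresentedGroup.mk R b ∈
        Subgroup.closure {PresentedGroup.mk R a, PresentedGroup.mk R b} :=
      Subgroup.subset_closure (Or.inr rfl)
    have hcomm : ∀ x y, x ∈ Subgroup.closure {PresentedGroup.mk R a, PresentedGroup.mk R b} →
        y ∈ Subgroup.closure {PresentedGroup.mk R a, PresentedGroup.mk R b} →
        comm x y ∈ Subgroup.closure {PresentedGroup.mk R a, PresentedGroup.mk R b} :=
      fun x y hx hy => mul_mem (mul_mem (mul_mem (inv_mem hx) (inv_mem hy)) hx) hy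
    have hc' := hcomm _ _ hb ha
    rw [← hc] at hc'
    have hd' := hcomm _ _ hc' ha
    rw [← hd] at hd'
    rintro s (rfl | rfl | rfl | rfl) <;> assumption
  · rw [← Std.map_comm, ← map_zpow, ← map_zpow, ← map_mul]
    exact mk_eq_mk_of_rel_mem (Or.inl (Or.inl (by simp)))
  · rw [← Std.map_comm, ← map_one (PresentedGroup.mk R)]
    exact mk_eq_mk_of_rel_mem (Or.inl (Or.inl (by simp)))
  · rw [← Std.map_comm, ← map_one (PresentedGroup.mk R)]
    exact mk_eq_mk_of_rel_mem (Or.inl (Or.inl (by simp)))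
  · rw [← map_pow, ← map_one (PresentedGroup.mk R)]
    refine mk_eq_mk_of_rel_mem (Or.inl (Or.inr ?_))
    split_ifs with hn
    · obtain ⟨k, rfl⟩ := hn
      rw [show (k + k - 1) / 2 = (k + k - 2) / 2 by omega]
      simp
    · simp
  · rw [← map_pow, ← map_one (PresentedGroup.mk R)]
    refine mk_eq_mk_of_rel_mem (Or.inl (Or.inr ?_))
    split_ifs with hn
    · simp
    · obtain ⟨k, rfl⟩ := Nat.not_even_iff_odd.1 hn
      rw [show (2 * k + 1 - 2) / 2 = (2 * k + 1 - 3) / 2 by omega]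
      simp
  · rw [← hz, ← map_pow, ← map_zpow]
    exact mk_eq_mk_of_rel_mem (Or.inr (by simp))
  · rw [← hz, ← map_pow, ← map_zpow, ← map_zpow, ← map_inv, ← map_mul, ← map_mul]
    exact mk_eq_mk_of_rel_mem (Or.inr (by simp))
  · rw [← hz, ← Std.map_comm, ← map_zpow]
    exact mk_eq_mk_of_rel_mem (Or.inr (by simp))

theorem exists_std_of_mulEquiv {n : ℕ} {α β γ : ℤ} (e : G ≃* MaxQuot n α β γ) :
    ∃ x y u v : G, Std n x y u v α β γ := by
  obtain ⟨x, y, u, v, h⟩ := std_maxQuot n α β γ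
  exact ⟨_, _, _, _, h.map e.symm.toMonoidHom e.symm.surjective⟩

/-- Elements satisfying the relations define a surjection from `MaxQuot n α β γ`; it is bijective
since that group has at most `3 ^ n` elements. -/
theorem Std.nonempty_mulEquiv {n : ℕ} {x y u v : G} {α β γ : ℤ} (h : Std n x y u v α β γ)
    (hn : 4 ≤ n) (hG : Nat.card G = 3 ^ n) : Nonempty (G ≃* MaxQuot n α β γ) := by
  let f : Gen → G := fun s => match s with
    | Gen.a => x
    | Gen.b => y
    | Gen.c => u
    | Gen.d => v
  have fa : FreeGroup.lift f a = x := FreeGroup.lift_apply_of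
  have fb : FreeGroup.lift f b = y := FreeGroup.lift_apply_of
  have fc : FreeGroup.lift f c = u := FreeGroup.lift_apply_of
  have fd : FreeGroup.lift f d = v := FreeGroup.lift_apply_of
  have fz : FreeGroup.lift f (z n) = zElt n u v := by
    rw [z_eq_zElt, Std.map_zElt, fc, fd]
  have hrel : ∀ p q : FreeGroup Gen, FreeGroup.lift f p = FreeGroup.lift f q →
      FreeGroup.lift f (rel p q) = 1 := by
    intro p q hpq
    rw [rel, map_mul, map_inv, hpq, mul_inv_cancel]
  have hR : ∀ r ∈ baseRels n ∪ {rel (a ^ 3) (z n ^ α),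
      rel (b ^ 3) (c ^ (-3 : ℤ) * d⁻¹ * z n ^ β), rel (comm c b) (z n ^ γ)},
      FreeGroup.lift f r = 1 := by
    rintro r ((hr | hr) | hr)
    · rcases hr with rfl | rfl | rfl | rfl | rfl <;> apply hrel
      · rw [Std.map_comm, fa, fb, fc, ← h.hc]
      · rw [Std.map_comm, fa, fc, fd, ← h.hd]
      · rw [Std.map_comm, fa, fd, map_mul, map_zpow, map_zpow, fc, fd, h.da]
      · rw [Std.map_comm, fb, fd, map_one, h.db]
      · rw [Std.map_comm, fc, fd, map_one, h.dc]
    · split_ifs at hr with hn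
      · obtain ⟨k, rfl⟩ := hn
        have h1 := h.c_pow
        rw [show (k + k - 1) / 2 = (k + k - 2) / 2 by omega] at h1
        rcases hr with rfl | rfl <;> apply hrel
        · rw [map_pow, fc, h1, map_one]
        · rw [map_pow, fd, h.d_pow, map_one]
      · obtain ⟨k, rfl⟩ := Nat.not_even_iff_odd.1 hn
        have h1 := h.d_pow
        rw [show (2 * k + 1 - 2) / 2 = (2 * k + 1 - 3) / 2 by omega] at h1
        rcases hr with rfl | rfl <;> apply hrel
        · rw [map_pow, fc, h.c_pow, map_one]
        · rw [map_pow, fd, h1, map_one]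
    · rcases hr with rfl | rfl | rfl <;> apply hrel
      · rw [map_pow, map_zpow, fa, fz, h.a_pow]
      · rw [map_pow, map_mul, map_mul, map_zpow, map_zpow, map_inv, fb, fz, fc, fd, h.b_pow]
      · rw [Std.map_comm, map_zpow, fb, fc, fz, h.cb]
  let φ : MaxQuot n α β γ →* G := PresentedGroup.toGroup hR
  have hφ : Function.Surjective φ := by
    rw [← MonoidHom.range_eq_top, eq_top_iff, ← h.gen, Subgroup.closure_le]
    rintro s (rfl | rfl)
    · exact ⟨PresentedGroup.of Gen.a, PresentedGroup.toGroup.of hR⟩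
    · exact ⟨PresentedGroup.of Gen.b, PresentedGroup.toGroup.of hR⟩
  obtain ⟨x', y', u', v', h'⟩ := std_maxQuot n α β γ
  have := h'.finite hn
  have hcard : Nat.card (MaxQuot n α β γ) = Nat.card G :=
    le_antisymm ((h'.card_le hn).trans hG.ge) (Nat.card_le_card_of_surjective φ hφ)
  exact ⟨(MulEquiv.ofBijective φ ((Nat.bijective_iff_surjective_and_card φ).2
    ⟨hφ, hcard⟩)).symm⟩

end Standard

/-! ### Changes of generators -/

section ChangeOfGenerators

variable {G : Type v} [Group G]

namespace Std

variable {n : ℕ} {a b c d : G} {α β γ : ℤ}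

theorem z_zpow_eq (h : Std n a b c d α β γ) (hn : 4 ≤ n) {k l : ℤ} (hk : (3 : ℤ) ∣ k - l) :
    zElt n c d ^ k = zElt n c d ^ l :=
  zpow_eq_zpow_of_dvd (h.z_cube hn) hk

theorem z_comm (h : Std n a b c d α β γ) (hn : 4 ≤ n) (k : ℤ) (g : G) :
    g * zElt n c d ^ k = zElt n c d ^ k * g :=
  Subgroup.mem_center_iff.1 (zpow_mem (h.z_mem_center hn) k) g

/-- The exponents `α, β, γ` matter modulo `3` only. -/
theorem congr (h : Std n a b c d α β γ) (hn : 4 ≤ n) {α' β' γ' : ℤ} (hα : (3 : ℤ) ∣ α - α')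
    (hβ : (3 : ℤ) ∣ β - β') (hγ : (3 : ℤ) ∣ γ - γ') : Std n a b c d α' β' γ' :=
  { h with
    a_pow := by rw [h.a_pow, h.z_zpow_eq hn hα]
    b_pow := by rw [h.b_pow, h.z_zpow_eq hn hβ]
    cb := by rw [h.cb, h.z_zpow_eq hn hγ] }

theorem pw_mul_b (h : Std n a b c d α β γ) (k l : ℤ) :
    pw c d k l * b = b * pw c d k l * zElt n c d ^ (γ * k) := by
  rw [mul_assoc, ← h.conj_b]; group

theorem pw_mul_a (h : Std n a b c d α β γ) (k l : ℤ) :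
    pw c d k l * a = a * pw c d (k - 3 * l) (k - 2 * l) := by
  rw [← h.conj_a]; group

/-- The cubes of the elements of the maximal subgroup generated by `b`, `c`, `d` outside the
derived subgroup. -/
theorem b_mul_pw_pow (h : Std n a b c d α β γ) (hn : 4 ≤ n) (k l : ℤ) :
    (b * pw c d k l) ^ 3 = pw c d (3 * k - 3) (3 * l - 1) * zElt n c d ^ β := by
  have h1 : b * pw c d k l * (b * pw c d k l) =
      b * (b * (pw c d k l * pw c d k l)) * zElt n c d ^ (γ * k) := by
    rw [mul_assoc b (pw c d k l), ← mul_assoc (pw c d k l), h.pw_mul_b, mul_assoc _ _ (pw c d k l),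
      ← h.z_comm hn]
    simp only [mul_assoc]
  have h2 : pw c d (k + k) (l + l) * (b * pw c d k l) =
      b * pw c d (3 * k) (3 * l) * zElt n c d ^ (γ * (k + k)) := by
    rw [← mul_assoc, h.pw_mul_b, mul_assoc _ _ (pw c d k l), ← h.z_comm hn, ← mul_assoc,
      mul_assoc b, pw_mul h.commute_cd]
    congr 3 <;> ring
  rw [pow_succ, pow_two, h1, pw_mul h.commute_cd, mul_assoc, ← h.z_comm hn, mul_assoc, mul_assoc,
    ← mul_assoc (pw c d (k + k) (l + l)), h2]
  have h3 : b * (b * (b * pw c d (3 * k) (3 * l) * zElt n c d ^ (γ * (k + k)) *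
      zElt n c d ^ (γ * k))) = b ^ 3 * pw c d (3 * k) (3 * l) *
      (zElt n c d ^ (γ * (k + k)) * zElt n c d ^ (γ * k)) := by
    simp only [pow_succ, pow_zero, one_mul, mul_assoc]
  rw [h3, ← zpow_add, h.z_zpow_eq hn (l := 0) ⟨γ * k, by ring⟩, zpow_zero, mul_one, h.b_pow,
    mul_assoc, ← h.z_comm hn, ← mul_assoc]
  congr 1
  have h4 : c ^ (-3 : ℤ) * d⁻¹ = pw c d (-3) (-1) := by rw [pw, zpow_neg_one]
  rw [h4, pw_mul h.commute_cd]
  congr 1 <;> ring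

theorem ab_pow (h : Std n a b c d α β γ) (hn : 4 ≤ n) :
    (a * b) ^ 3 = zElt n c d ^ (α + β - γ) := by
  have hc : c = pw c d 1 0 := by simp [pw]
  have h1 : b * a = a * b * pw c d 1 0 := by
    rw [← hc, mul_assoc, ← h.conj_b_a]; group
  have h2 : pw c d 1 0 * a = a * pw c d 1 1 := by
    rw [h.pw_mul_a]; simp
  have e1 : a * b * (a * b) = a * a * (b * pw c d 1 0 * b) := by
    rw [mul_assoc a b, ← mul_assoc b a, h1]; simp only [mul_assoc]
  have e2 : b * pw c d 1 0 * b * a = a * (b * pw c d 2 1 * (b * pw c d 1 0)) := by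
    rw [mul_assoc _ b a, h1, ← mul_assoc, ← mul_assoc, mul_assoc b, h2, ← mul_assoc b, h1]
    simp only [mul_assoc]
    rw [← mul_assoc (pw c d 1 0) (pw c d 1 1), pw_mul h.commute_cd]
    norm_num
  have e3 : b * pw c d 2 1 * (b * pw c d 1 0) * b =
      b ^ 3 * pw c d 3 1 * zElt n c d ^ (5 * γ) := by
    rw [mul_assoc _ (b * pw c d 1 0), mul_assoc b _ b, h.pw_mul_b, mul_assoc b (pw c d 2 1),
      ← mul_assoc (pw c d 2 1) b, h.pw_mul_b]
    calc b * (b * pw c d 2 1 * zElt n c d ^ (γ * 2) * (b * pw c d 1 0 * zElt n c d ^ (γ * 1)))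
        = b * (b * (pw c d 2 1 * (zElt n c d ^ (γ * 2) * b) * pw c d 1 0 *
            zElt n c d ^ (γ * 1))) := by simp only [mul_assoc]
      _ = b * (b * ((pw c d 2 1 * b) * (zElt n c d ^ (γ * 2) * pw c d 1 0) *
            zElt n c d ^ (γ * 1))) := by rw [← h.z_comm hn]; simp only [mul_assoc]
      _ = b * (b * (b * pw c d 2 1 * (zElt n c d ^ (γ * 2) * pw c d 1 0) *
            zElt n c d ^ (γ * 2) * zElt n c d ^ (γ * 1))) := by
          rw [h.pw_mul_b, ← h.z_comm hn (γ * 2) (pw c d 1 0)]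
          rw [mul_assoc (b * pw c d 2 1) (zElt n c d ^ (γ * 2)), ← h.z_comm hn (γ * 2)]
          simp only [mul_assoc]
      _ = b ^ 3 * (pw c d 2 1 * pw c d 1 0) *
            (zElt n c d ^ (γ * 2) * zElt n c d ^ (γ * 2) * zElt n c d ^ (γ * 1)) := by
          rw [← h.z_comm hn (γ * 2) (pw c d 1 0)]
          simp only [pow_succ, pow_zero, one_mul, mul_assoc]
      _ = _ := by
          rw [pw_mul h.commute_cd, ← zpow_add, ← zpow_add]
          congr 2; ring
  have e4 : (a * b) ^ 3 = a ^ 3 * (b ^ 3 * pw c d 3 1 * zElt n c d ^ (5 * γ)) := by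
    rw [pow_succ, pow_two, e1, ← e3, mul_assoc (a * a), ← mul_assoc _ a b, e2]
    simp only [pow_succ, pow_zero, one_mul, mul_assoc]
  have h4 : c ^ (-3 : ℤ) * d⁻¹ = pw c d (-3) (-1) := by rw [pw, zpow_neg_one]
  have e5 : pw c d (-3) (-1) * zElt n c d ^ β * pw c d 3 1 = zElt n c d ^ β := by
    rw [mul_assoc, ← h.z_comm hn β (pw c d 3 1), ← mul_assoc, pw_mul h.commute_cd]
    norm_num
  rw [e4, h.a_pow, h.b_pow, h4, e5, ← zpow_add, ← zpow_add]
  exact h.z_zpow_eq hn ⟨2 * γ, by ring⟩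

theorem zElt_eq_of_cube {n : ℕ} (hn : 5 ≤ n) {c d c' d' : G} (hc : c' ^ (-3 : ℤ) = c ^ (-3 : ℤ))
    (hd : d' ^ (-3 : ℤ) = d ^ (-3 : ℤ)) : zElt n c' d' = zElt n c d := by
  obtain ⟨m, rfl | rfl⟩ := even_or_odd_form (n := n) (by omega)
  · obtain ⟨k, rfl⟩ : ∃ k, m = k + 1 := ⟨m - 1, by omega⟩
    rw [zElt_even, zElt_even, pow_succ', zpow_mul, zpow_mul, hd]
  · rw [zElt_odd, zElt_odd, pow_succ', zpow_mul, zpow_mul, hc]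

theorem inv_zElt {n : ℕ} (c d : G) : zElt n c⁻¹ d⁻¹ = (zElt n c d)⁻¹ := by
  rw [zElt, zElt]
  split_ifs <;> rw [inv_zpow]

/-- The change of generators `a ↦ a * b`. -/
theorem mul_b (h : Std n a b c d α β γ) (hn : 4 ≤ n) (hγ : 5 ≤ n ∨ γ = 0) :
    Std n (a * b) b (c * zElt n c d ^ γ) (d * zElt n c d ^ γ) (α + β - γ) (β + γ) γ := by
  have hzz := h.z_comm hn
  have hz3 : ∀ k : ℤ, (zElt n c d ^ γ) ^ (3 * k) = 1 := fun k => by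
    rw [← zpow_mul, h.z_zpow_eq hn (l := 0) ⟨γ * k, by ring⟩, zpow_zero]
  have hcz : ∀ k : ℤ, (c * zElt n c d ^ γ) ^ k = c ^ k * (zElt n c d ^ γ) ^ k := fun k =>
    Commute.mul_zpow (hzz γ c) k
  have hdz : ∀ k : ℤ, (d * zElt n c d ^ γ) ^ k = d ^ k * (zElt n c d ^ γ) ^ k := fun k =>
    Commute.mul_zpow (hzz γ d) k
  have hc3 : (c * zElt n c d ^ γ) ^ (-3 : ℤ) = c ^ (-3 : ℤ) := by
    rw [hcz, show (-3 : ℤ) = 3 * (-1) by norm_num, hz3, mul_one]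
  have hd3 : (d * zElt n c d ^ γ) ^ (-3 : ℤ) = d ^ (-3 : ℤ) := by
    rw [hdz, show (-3 : ℤ) = 3 * (-1) by norm_num, hz3, mul_one]
  have hz : zElt n (c * zElt n c d ^ γ) (d * zElt n c d ^ γ) = zElt n c d := by
    rcases hγ with hn5 | rfl
    · exact zElt_eq_of_cube hn5 hc3 hd3
    · simp
  have hconjz : ∀ g u : G, g⁻¹ * (u * zElt n c d ^ γ) * g = g⁻¹ * u * g * zElt n c d ^ γ := by
    intro g u
    rw [← mul_assoc, mul_assoc, ← hzz, ← mul_assoc]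
  have hconj : ∀ u, (a * b)⁻¹ * u * (a * b) = b⁻¹ * (a⁻¹ * u * a) * b := by
    intro u; group
  have hcd : pw c d 1 0 = c := by simp [pw]
  have hcd' : pw c d 0 1 = d := by simp [pw]
  refine ⟨?_, ?_, ?_, ?_, ?_, ?_, ?_, ?_, ?_, ?_, ?_⟩
  · rw [eq_top_iff, ← h.gen, Subgroup.closure_le]
    have hb : b ∈ Subgroup.closure {a * b, b} := Subgroup.subset_closure (Or.inr rfl)
    have hab : a * b ∈ Subgroup.closure {a * b, b} := Subgroup.subset_closure (Or.inl rfl)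
    rintro s (rfl | rfl)
    · simpa using mul_mem hab (inv_mem hb)
    · exact hb
  · symm
    apply comm_eq_of_conj
    rw [hconj, h.conj_b_a, ← h.conj_c_b]
    group
  · symm
    apply comm_eq_of_conj
    rw [hconjz, hconj, h.conj_c_a]
    have := h.conj_b 1 1
    rw [mul_one] at this
    rw [show c * d = pw c d 1 1 by simp [pw], this, mul_assoc c, ← mul_assoc _ d, ← hzz]
    simp [pw, mul_assoc]
  · apply comm_eq_of_conj
    rw [hconjz, hconj, ← hcd', h.conj_a, h.conj_b, h.z_zpow_eq hn (l := 0) ⟨-γ, by ring⟩,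
      zpow_zero, mul_one, hcd', hc3, hd3, mul_assoc, ← hzz, ← mul_assoc]
    congr 1
    have := pw_mul h.commute_cd 0 1 (-3) (-3)
    rw [hcd', pw] at this
    rw [this]
    norm_num
  · apply comm_eq_of_conj
    rw [hconjz, conj_eq_mul_comm, h.db, mul_one, mul_one]
  · rw [comm_eq_one_iff]
    exact ((h.commute_cd.symm).mul_left (hzz γ c).symm).mul_right
      (Commute.mul_left (hzz γ d) (Commute.refl _))
  · obtain ⟨k, hk⟩ : ∃ k, (n - 1) / 2 = k + 1 := ⟨(n - 1) / 2 - 1, by omega⟩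
    rw [← zpow_natCast, hcz, zpow_natCast, h.c_pow, hk, pow_succ', Nat.cast_mul, Nat.cast_ofNat,
      hz3, one_mul]
  · obtain ⟨k, hk⟩ : ∃ k, (n - 2) / 2 = k + 1 := ⟨(n - 2) / 2 - 1, by omega⟩
    rw [← zpow_natCast, hdz, zpow_natCast, h.d_pow, hk, pow_succ', Nat.cast_mul, Nat.cast_ofNat,
      hz3, one_mul]
  · rw [hz, h.ab_pow hn]
  · rw [hz, hc3, h.b_pow, mul_inv_rev, ← zpow_neg, ← hzz]
    simp only [mul_assoc]
    rw [← zpow_add]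
    congr 3
    ring
  · rw [hz]
    apply comm_eq_of_conj
    rw [hconjz, h.conj_c_b]

/-- The change of generators `b ↦ b⁻¹`. -/
theorem inv_b (h : Std n a b c d α β γ) (hn : 4 ≤ n) (hγ : 5 ≤ n ∨ γ = 0) :
    Std n a b⁻¹ (c⁻¹ * zElt n c d ^ γ) d⁻¹ (-α) β (-γ) := by
  have hzz := h.z_comm hn
  have hz3 : ∀ k : ℤ, (zElt n c d ^ γ) ^ (3 * k) = 1 := fun k => by
    rw [← zpow_mul, h.z_zpow_eq hn (l := 0) ⟨γ * k, by ring⟩, zpow_zero]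
  have hcz : ∀ k : ℤ, (c⁻¹ * zElt n c d ^ γ) ^ k = c⁻¹ ^ k * (zElt n c d ^ γ) ^ k := fun k =>
    Commute.mul_zpow (hzz γ c⁻¹) k
  have hc3 : (c⁻¹ * zElt n c d ^ γ) ^ (-3 : ℤ) = c⁻¹ ^ (-3 : ℤ) := by
    rw [hcz, show (-3 : ℤ) = 3 * (-1) by norm_num, hz3, mul_one]
  have hz : zElt n (c⁻¹ * zElt n c d ^ γ) d⁻¹ = (zElt n c d)⁻¹ := by
    rcases hγ with hn5 | rfl
    · rw [← inv_zElt]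
      exact zElt_eq_of_cube hn5 hc3 rfl
    · simp [inv_zElt]
  have hconjz : ∀ g u : G, g⁻¹ * (u * zElt n c d ^ γ) * g = g⁻¹ * u * g * zElt n c d ^ γ := by
    intro g u
    rw [← mul_assoc, mul_assoc, ← hzz, ← mul_assoc]
  -- the inverse of `b` acts on `c` by the inverse power of `z`
  have hcb : b * c * b⁻¹ = c * (zElt n c d ^ γ)⁻¹ := by
    have h1 := h.conj_c_b
    rw [eq_mul_inv_iff_mul_eq]
    calc b * c * b⁻¹ * zElt n c d ^ γ = b * (c * zElt n c d ^ γ) * b⁻¹ := by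
          rw [mul_assoc, ← mul_assoc b, mul_assoc (b * c), hzz]
      _ = c := by rw [← h1]; group
  have hcb' : b * c⁻¹ * b⁻¹ = c⁻¹ * zElt n c d ^ γ := by
    have h1 : b * c⁻¹ * b⁻¹ = (b * c * b⁻¹)⁻¹ := by group
    rw [h1, hcb, mul_inv_rev, inv_inv, ← hzz]
  refine ⟨?_, ?_, ?_, ?_, ?_, ?_, ?_, ?_, ?_, ?_, ?_⟩
  · rw [eq_top_iff, ← h.gen, Subgroup.closure_le]
    have hb : b⁻¹ ∈ Subgroup.closure {a, b⁻¹} := Subgroup.subset_closure (Or.inr rfl)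
    rintro s (rfl | rfl)
    · exact Subgroup.subset_closure (Or.inl rfl)
    · simpa using inv_mem hb
  · symm
    apply comm_eq_of_conj
    have h1 : a⁻¹ * b⁻¹ * a = (a⁻¹ * b * a)⁻¹ := by group
    rw [h1, h.conj_b_a, ← hcb']
    group
  · symm
    apply comm_eq_of_conj
    have h1 : a⁻¹ * c⁻¹ * a = (a⁻¹ * c * a)⁻¹ := by group
    rw [hconjz, h1, h.conj_c_a, h.commute_cd.eq, mul_inv_rev, mul_assoc, mul_assoc, hzz]
  · apply comm_eq_of_conj
    have h1 : a⁻¹ * d⁻¹ * a = (a⁻¹ * d * a)⁻¹ := by group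
    have h2 := h.commute_cd
    rw [h1, conj_eq_mul_comm, h.da, hc3]
    have h3 : d * (c ^ (-3 : ℤ) * d ^ (-3 : ℤ)) = pw c d (-3) (-2) := by
      have := pw_mul h2 0 1 (-3) (-3)
      simpa [pw] using this
    have h4 : d⁻¹ * (c⁻¹ ^ (-3 : ℤ) * d⁻¹ ^ (-3 : ℤ)) = pw c d 3 2 := by
      have := pw_mul h2 0 (-1) 3 3
      rw [inv_zpow', inv_zpow']
      simpa [pw] using this
    rw [h3, h4, pw_inv h2]
    norm_num
  · rw [comm_eq_one_iff]
    exact h.commute_bd.symm.inv_inv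
  · rw [comm_eq_one_iff]
    exact (h.commute_cd.symm.inv_inv).mul_right (hzz γ d⁻¹)
  · obtain ⟨k, hk⟩ : ∃ k, (n - 1) / 2 = k + 1 := ⟨(n - 1) / 2 - 1, by omega⟩
    rw [← zpow_natCast, hcz, zpow_natCast, inv_pow, h.c_pow, hk, pow_succ', Nat.cast_mul,
      Nat.cast_ofNat, hz3, inv_one, mul_one]
  · rw [inv_pow, h.d_pow, inv_one]
  · rw [hz, h.a_pow, inv_zpow', neg_neg]
  · have h2 := h.commute_cd
    rw [hz, hc3, inv_pow, h.b_pow, inv_zpow', inv_zpow', inv_inv, mul_inv_rev, mul_inv_rev,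
      ← zpow_neg, ← zpow_neg, neg_neg, inv_inv, ← hzz, (h2.zpow_left 3).eq]
  · rw [hz]
    apply comm_eq_of_conj
    rw [hconjz, inv_inv, hcb', inv_zpow', neg_neg]

end Std

/-- The reduction of the exponents `α, β, γ` to the seven normal forms. Changing `a` to `a * b`
replaces `(α, β, γ)` by `(α + β - γ, β + γ, γ)`, and changing `b` to `b⁻¹` replaces it by
`(-α, β, -γ)`; the exponents matter modulo `3` only. -/
theorem Std.exists_normalForm {n : ℕ} {a b c d : G} {α β γ : ℤ} (h : Std n a b c d α β γ)
    (hn : 4 ≤ n) (hγ : 5 ≤ n ∨ γ = 0) :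
    ∃ a b c d : G, Std n a b c d 0 0 0 ∨ Std n a b c d 0 1 0 ∨ Std n a b c d 0 (-1) 0 ∨
      Std n a b c d 1 0 0 ∨ 5 ≤ n ∧
        (Std n a b c d 0 0 (-1) ∨ Std n a b c d 1 0 (-1) ∨ Std n a b c d (-1) 0 (-1)) := by
  have hmod : ∀ k : ℤ, (3 : ℤ) ∣ k - 0 ∨ (3 : ℤ) ∣ k - 1 ∨ (3 : ℤ) ∣ k - (-1) := by
    intro k; omega
  have hself : ∀ k : ℤ, (3 : ℤ) ∣ k - k := fun k => by simp
  by_cases h0 : (3 : ℤ) ∣ γ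
  · replace h := h.congr hn (α' := α) (β' := β) (γ' := 0) (by simp) (by simp) (by simpa using h0)
    rcases hmod β with hβ | hβ | hβ
    · rcases hmod α with hα | hα | hα
      · exact ⟨a, b, c, d, Or.inl (h.congr hn hα hβ (by simp))⟩
      · exact ⟨a, b, c, d, Or.inr (Or.inr (Or.inr (Or.inl (h.congr hn hα hβ (by simp)))))⟩
      · exact ⟨_, _, _, _, Or.inr (Or.inr (Or.inr (Or.inl
          ((h.inv_b hn (Or.inr rfl)).congr hn (by omega) hβ (by simp)))))⟩
    · refine (hmod α).elim (fun hα => ?_) fun h' => h'.elim (fun hα => ?_) fun hα => ?_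
      · exact ⟨a, b, c, d, Or.inr (Or.inl (h.congr hn hα hβ (by simp)))⟩
      · exact ⟨_, _, _, _, Or.inr (Or.inl (((h.mul_b hn (Or.inr rfl)).mul_b hn
          (Or.inr rfl)).congr hn (by omega) (by omega) (by simp)))⟩
      · exact ⟨_, _, _, _, Or.inr (Or.inl ((h.mul_b hn (Or.inr rfl)).congr hn (by omega)
          (by omega) (by simp)))⟩
    · refine (hmod α).elim (fun hα => ?_) fun h' => h'.elim (fun hα => ?_) fun hα => ?_
      · exact ⟨a, b, c, d, Or.inr (Or.inr (Or.inl (h.congr hn hα hβ (by simp))))⟩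
      · exact ⟨_, _, _, _, Or.inr (Or.inr (Or.inl ((h.mul_b hn (Or.inr rfl)).congr hn (by omega)
          (by omega) (by simp))))⟩
      · exact ⟨_, _, _, _, Or.inr (Or.inr (Or.inl (((h.mul_b hn (Or.inr rfl)).mul_b hn
          (Or.inr rfl)).congr hn (by omega) (by omega) (by simp))))⟩
  · have hn5 : 5 ≤ n := by
      rcases hγ with hγ | rfl
      · exact hγ
      · simp at h0
    have key : ∀ {a b c d : G} {α β γ : ℤ}, Std n a b c d α β γ → (3 : ℤ) ∣ γ - (-1) →
        ∃ a b c d : G, ∃ α : ℤ, Std n a b c d α 0 (-1) := by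
      intro a b c d α β γ h hγ
      rcases hmod β with hβ | hβ | hβ
      · exact ⟨_, _, _, _, α, h.congr hn (by simp) hβ hγ⟩
      · exact ⟨_, _, _, _, _, (h.mul_b hn (Or.inl hn5)).congr hn (hself _) (by omega) hγ⟩
      · exact ⟨_, _, _, _, _, ((h.mul_b hn (Or.inl hn5)).mul_b hn (Or.inl hn5)).congr hn (hself _)
          (by omega) hγ⟩
    obtain ⟨a', b', c', d', α', h'⟩ : ∃ a b c d : G, ∃ α : ℤ, Std n a b c d α 0 (-1) := by
      rcases hmod γ with h1 | h1 | h1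
      · exact absurd (by simpa using h1) h0
      · exact key (h.inv_b hn (Or.inl hn5)) (by omega)
      · exact key h h1
    refine ⟨a', b', c', d', Or.inr (Or.inr (Or.inr (Or.inr ⟨hn5, ?_⟩)))⟩
    rcases hmod α' with hα | hα | hα
    · exact Or.inl (h'.congr hn hα (by simp) (by simp))
    · exact Or.inr (Or.inl (h'.congr hn hα (by simp) (by simp)))
    · exact Or.inr (Or.inr (h'.congr hn hα (by simp) (by simp)))

end ChangeOfGenerators

/-! ### Lifting the relations along the central quotient -/

section Lifting

variable {G : Type v} [Group G]

theorem commute_of_mem_center {ζ : G} (h : ζ ∈ Subgroup.center G) (g : G) : Commute g ζ :=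
  Subgroup.mem_center_iff.1 h g

theorem mul_comm_of_mem_center {ζ : G} (h : ζ ∈ Subgroup.center G) (g : G) : ζ * g = g * ζ :=
  (Subgroup.mem_center_iff.1 h g).symm

/-- An element of the second center commutes with all commutators. -/
theorem commute_comm_of_secondCenter {u : G} (hu : ∀ g, comm u g ∈ Subgroup.center G) (x y : G) :
    Commute u (comm x y) := by
  have hmul : ∀ g h, comm u (g * h) = comm u g * comm u h := by
    intro g h
    have h1 : comm u (g * h) = comm u h * (h⁻¹ * comm u g * h) := by simp only [comm]; group
    rw [h1, mul_assoc h⁻¹, mul_comm_of_mem_center (hu g), inv_mul_cancel_left,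
      mul_comm_of_mem_center (hu h)]
  have hinv : ∀ g, comm u g⁻¹ = (comm u g)⁻¹ := by
    intro g
    rw [eq_inv_iff_mul_eq_one, ← hmul, inv_mul_cancel]
    simp [comm]
  rw [← comm_eq_one_iff]
  change comm u (x⁻¹ * y⁻¹ * x * y) = 1
  rw [hmul, hmul, hmul, hinv, hinv, mul_assoc ((comm u x)⁻¹), mul_comm_of_mem_center (inv_mem (hu y))]
  group

/-- The relation on `[c, b]` coming from `b * a = a * b * c`, by letting both sides act on `c`. -/
theorem comm_y_a {a b c d y e f : G} (hc : c = comm b a) (hd : d = comm c a)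
    (hy : comm c b = y) (he : comm d b = e) (hf : comm d c = f)
    (heZ : e ∈ Subgroup.center G)
    (hyc : Commute y c) (hyd : Commute y d) : comm y a = f * e := by
  have h1 : b * a = a * b * c := by rw [hc]; simp only [comm]; group
  have h2 : (b * a)⁻¹ * c * (b * a) = c * d * (y * comm y a) := by
    have : (b * a)⁻¹ * c * (b * a) = a⁻¹ * (b⁻¹ * c * b) * a := by group
    rw [this, conj_eq_mul_comm c b, hy]
    have : a⁻¹ * (c * y) * a = (a⁻¹ * c * a) * (a⁻¹ * y * a) := by group
    rw [this, conj_eq_mul_comm c a, conj_eq_mul_comm y a, ← hd]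
  have h3 : (a * b * c)⁻¹ * c * (a * b * c) = y * (d * c) * e := by
    have : (a * b * c)⁻¹ * c * (a * b * c) =
        c⁻¹ * (b⁻¹ * (a⁻¹ * c * a) * b) * c := by group
    rw [this, conj_eq_mul_comm c a, ← hd]
    have : b⁻¹ * (c * d) * b = (b⁻¹ * c * b) * (b⁻¹ * d * b) := by group
    rw [this, conj_eq_mul_comm c b, conj_eq_mul_comm d b, hy, he]
    simp only [mul_assoc]
    rw [inv_mul_cancel_left, mul_comm_of_mem_center heZ]
  have h4 : d * c = c * d * f := by rw [← hf]; simp only [comm]; group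
  rw [h1, h3, h4] at h2
  have h5 : y * (c * d * f) * e = c * d * (y * (f * e)) := by
    have : y * (c * d) = c * d * y := (hyc.mul_right hyd).eq
    rw [← mul_assoc y, this]
    simp only [mul_assoc]
  rw [h5] at h2
  exact (mul_left_cancel (mul_left_cancel h2)).symm

/-- The heart of the classification: a lift to `G` of standard generators of `G ⧸ Z(G)` consists
of standard generators of `G`, up to the values of `α, β, γ`. Here `u` is the lift of the generator
`z` of the center of the quotient, and it has to commute with `b`. -/
theorem relations_of_lift {a b c d u : G} (hgen : Subgroup.closure {a, b} = ⊤)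
    (hc : c = comm b a) (hd : d = comm c a) (hu : ∀ g, comm u g ∈ Subgroup.center G)
    (hub : Commute u b) {α β γ : ℤ}
    (hZ : ∀ ζ ∈ Subgroup.center G, ζ ^ 3 = 1)
    (hdb : comm d b ∈ Subgroup.center G) (hdc : comm d c ∈ Subgroup.center G)
    (ha3 : ∃ ζ ∈ Subgroup.center G, a ^ 3 = u ^ α * ζ)
    (hb3 : ∃ ζ ∈ Subgroup.center G, b ^ 3 = c ^ (-3 : ℤ) * d⁻¹ * u ^ β * ζ)
    (hcb : ∃ ζ ∈ Subgroup.center G, comm c b = u ^ γ * ζ) :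
    comm d a = c ^ (-3 : ℤ) * d ^ (-3 : ℤ) ∧ comm d b = 1 ∧ comm d c = 1 ∧
      a ^ 3 ∈ Subgroup.center G ∧ (c ^ (-3 : ℤ) * d⁻¹)⁻¹ * b ^ 3 ∈ Subgroup.center G ∧
      comm c b ∈ Subgroup.center G := by
  obtain ⟨ζ4, h4Z, ha3⟩ := ha3
  obtain ⟨ζ5, h5Z, hb3⟩ := hb3
  obtain ⟨ζ6, h6Z, hcb⟩ := hcb
  have huc : Commute u c := by rw [hc]; exact commute_comm_of_secondCenter hu _ _
  have hud : Commute u d := by rw [hd]; exact commute_comm_of_secondCenter hu _ _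
  have hcenter : ∀ x, Commute x a → Commute x b → x ∈ Subgroup.center G := by
    intro x hxa hxb
    refine mem_center_of_closure hgen ?_
    rintro s (rfl | rfl) <;> assumption
  -- `y = [c, b]`
  obtain ⟨y, hy⟩ : ∃ y, comm c b = y := ⟨_, rfl⟩
  have hyu : y = u ^ γ * ζ6 := by rw [← hy, hcb]
  have hyb : Commute y b := by
    rw [hyu]; exact (hub.zpow_left γ).mul_left (commute_of_mem_center h6Z b).symm
  have hyc : Commute y c := by
    rw [hyu]; exact (huc.zpow_left γ).mul_left (commute_of_mem_center h6Z c).symm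
  have hyd : Commute y d := by
    rw [hyu]; exact (hud.zpow_left γ).mul_left (commute_of_mem_center h6Z d).symm
  obtain ⟨e, he⟩ : ∃ e, comm d b = e := ⟨_, rfl⟩
  obtain ⟨f, hf⟩ : ∃ f, comm d c = f := ⟨_, rfl⟩
  rw [he] at hdb
  rw [hf] at hdc
  have hya := comm_y_a hc hd hy he hf hdb hyc hyd
  have hcb' : b⁻¹ * c * b = c * y := by rw [conj_eq_mul_comm, hy]
  have hdb' : b⁻¹ * d * b = d * e := by rw [conj_eq_mul_comm, he]
  have hyb' : b⁻¹ * y * b = y := by rw [mul_assoc, hyb.eq, inv_mul_cancel_left]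
  have hww : ∀ x : G, Commute u x → Commute (u ^ β * ζ5) x := fun x hx =>
    (hx.zpow_left β).mul_left (commute_of_mem_center h5Z x).symm
  -- the action of `b ^ 3` on `c`
  have e2 : f = y ^ 3 := by
    have h1 : (b ^ 3)⁻¹ * c * b ^ 3 = c * y ^ 3 := by
      have : (b ^ 3)⁻¹ * c * b ^ 3 = b⁻¹ * (b⁻¹ * (b⁻¹ * c * b) * b) * b := by
        simp only [pow_succ, pow_zero, one_mul, mul_inv_rev, mul_assoc]
      rw [this, hcb']
      have h2 : ∀ x : G, b⁻¹ * (x * y) * b = b⁻¹ * x * b * y := by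
        intro x
        calc b⁻¹ * (x * y) * b = (b⁻¹ * x * b) * (b⁻¹ * y * b) := by group
          _ = _ := by rw [hyb']
      rw [h2, hcb', h2, h2, hcb']
      simp only [pow_succ, pow_zero, one_mul, mul_assoc]
    have h3 : (b ^ 3)⁻¹ * c * b ^ 3 = d * c * d⁻¹ := by
      have h4 := (hww c huc).eq
      have h5 : b ^ 3 = c ^ (-3 : ℤ) * d⁻¹ * (u ^ β * ζ5) := by rw [hb3, mul_assoc _ _ ζ5]
      have h6 : (b ^ 3)⁻¹ * c * b ^ 3 = (u ^ β * ζ5)⁻¹ * (d * (c ^ (3 : ℤ) * c * c ^ (-3 : ℤ)) *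
          d⁻¹) * (u ^ β * ζ5) := by rw [h5]; group
      have h7 : c ^ (3 : ℤ) * c * c ^ (-3 : ℤ) = c := by group
      have h8 : Commute (u ^ β * ζ5) (d * c * d⁻¹) :=
        ((hww d hud).mul_right (hww c huc)).mul_right (hww d hud).inv_right
      rw [h6, h7, mul_assoc, ← h8.eq, inv_mul_cancel_left]
    have h9 : d * c = c * d * f := by rw [← hf]; simp only [comm]; group
    rw [h1, h9, mul_assoc c d, ← mul_comm_of_mem_center hdc, ← mul_assoc, mul_inv_cancel_right] at h3
    exact (mul_left_cancel h3).symm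
  -- `b` commutes with `b ^ 3`
  have e3 : y ^ 3 * e = 1 := by
    have h1 : b⁻¹ * (c ^ (-3 : ℤ) * d⁻¹) * b = c ^ (-3 : ℤ) * d⁻¹ := by
      have h2 : c ^ (-3 : ℤ) * d⁻¹ = b ^ 3 * (u ^ β * ζ5)⁻¹ := by rw [hb3]; group
      have h3 : Commute (b ^ 3 * (u ^ β * ζ5)⁻¹) b :=
        ((Commute.refl b).pow_left 3).mul_left (hww b hub).inv_left
      rw [h2, mul_assoc, h3.eq, inv_mul_cancel_left]
    have h2 : b⁻¹ * (c ^ (-3 : ℤ) * d⁻¹) * b = (b⁻¹ * c * b) ^ (-3 : ℤ) * (b⁻¹ * d * b)⁻¹ := by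
      have := conj_zpow (i := -3) (a := b⁻¹) (b := c)
      rw [inv_inv] at this
      rw [this]; group
    rw [hcb', hdb', hyc.symm.mul_zpow, mul_inv_rev, mul_comm_of_mem_center (inv_mem hdb)] at h2
    rw [h2, mul_assoc] at h1
    have h3 := mul_left_cancel h1
    rw [← mul_assoc, (hyd.zpow_left _).inv_right.eq, mul_assoc] at h3
    have h4 : y ^ (-3 : ℤ) * e⁻¹ = 1 := by simpa using h3
    have h5 : (y ^ (-3 : ℤ) * e⁻¹)⁻¹ = 1 := by rw [h4, inv_one]
    rw [← mul_comm_of_mem_center hdb]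
    rw [mul_inv_rev, inv_inv, zpow_neg, inv_inv] at h5
    exact_mod_cast h5
  have hyZ : y ∈ Subgroup.center G := by
    refine hcenter y ?_ hyb
    rw [← comm_eq_one_iff, hya, e2, e3]
  have hy3 := hZ y hyZ
  rw [hy3] at e2
  rw [hy3, one_mul] at e3
  have hcd : Commute c d := (comm_eq_one_iff.1 (hf.trans e2)).symm
  have hca : a⁻¹ * c * a = c * d := by rw [conj_eq_mul_comm, ← hd]
  have hba : a⁻¹ * b * a = b * c := by rw [conj_eq_mul_comm, ← hc]
  have ha3b : Commute (a ^ 3) b := by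
    rw [ha3]
    exact (hub.zpow_left _).mul_left (commute_of_mem_center h4Z b).symm
  -- the action of `a ^ 3` on `b`
  have hda : a⁻¹ * d * a = pw c d (-3) (-2) := by
    have h1 : (a ^ 3)⁻¹ * b * a ^ 3 = b := by
      rw [mul_assoc, ← ha3b.eq, inv_mul_cancel_left]
    have h2 : (a ^ 3)⁻¹ * b * a ^ 3 =
        b * c * (c * d) * (c * d) * (a⁻¹ * d * a) := by
      have h3 : (a ^ 3)⁻¹ * b * a ^ 3 = a⁻¹ * (a⁻¹ * (a⁻¹ * b * a) * a) * a := by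
        simp only [pow_succ, pow_zero, one_mul, mul_inv_rev, mul_assoc]
      have h4 : a⁻¹ * (b * c) * a = b * c * (c * d) := by
        calc a⁻¹ * (b * c) * a = (a⁻¹ * b * a) * (a⁻¹ * c * a) := by group
          _ = _ := by rw [hba, hca]
      have h5 : a⁻¹ * (b * c * (c * d)) * a =
          (a⁻¹ * (b * c) * a) * ((a⁻¹ * c * a) * (a⁻¹ * d * a)) := by group
      rw [h3, hba, h4, h5, h4, hca]
      simp only [mul_assoc]
    have h5 : b * c * (c * d) * (c * d) = b * pw c d 3 2 := by
      have h6 := pw_mul hcd 2 1 1 1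
      norm_num at h6
      rw [← h6]
      simp only [pw, zpow_two, zpow_one, mul_assoc]
    rw [h1, h5, mul_assoc] at h2
    have h7 : pw c d 3 2 * (a⁻¹ * d * a) = 1 := mul_left_cancel (a := b) (by rw [← h2, mul_one])
    rw [← inv_inj, pw_inv hcd, eq_comm, eq_inv_iff_mul_eq_one]
    simpa using h7
  have hda' : comm d a = c ^ (-3 : ℤ) * d ^ (-3 : ℤ) := by
    apply comm_eq_of_conj
    have := pw_mul hcd 0 1 (-3) (-3)
    rw [hda]
    norm_num at this
    rw [← this, pw]
  refine ⟨hda', he.trans e3, hf.trans e2, ?_, ?_, hy ▸ hyZ⟩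
  · exact hcenter _ ((Commute.refl a).pow_left 3) ha3b
  · have hw : (c ^ (-3 : ℤ) * d⁻¹)⁻¹ * b ^ 3 = u ^ β * ζ5 := by rw [hb3]; group
    rw [hw]
    refine hcenter _ ?_ (hww b hub)
    have hwc := hww c huc
    generalize u ^ β * ζ5 = w at *
    have hb3' : b ^ 3 = pw c d (-3) (-1) * w := by rw [← hw, pw, zpow_neg_one]; group
    have h1 : a⁻¹ * b ^ 3 * a = (b * c) ^ 3 := by
      rw [← hba]
      have := conj_pow (i := 3) (a := a⁻¹) (b := b)
      rw [inv_inv] at this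
      rw [this]
    have h2 : (b * c) ^ 3 = b ^ 3 * c ^ 3 := by
      have h3 : (b * c) ^ 3 = b ^ 3 * ((b⁻¹ * (b⁻¹ * c * b) * b) * (b⁻¹ * c * b) * c) := by
        simp only [pow_succ, pow_zero, one_mul, mul_assoc, mul_inv_cancel_left]
      have h4 : b⁻¹ * (c * y) * b = c * y * y := by
        calc b⁻¹ * (c * y) * b = (b⁻¹ * c * b) * (b⁻¹ * y * b) := by group
          _ = _ := by rw [hcb', hyb']
      have h5 : c * y * y * (c * y) * c = c ^ 3 * y ^ 3 := by
        have r1 : y * c = c * y := hyc.eq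
        have r2 : ∀ x, y * (c * x) = c * (y * x) := fun x => by
          rw [← mul_assoc, r1, mul_assoc]
        simp only [pow_succ, pow_zero, one_mul, mul_assoc, r1, r2]
      rw [h3, hcb', h4, h5, hy3, mul_one]
    have h3 : a⁻¹ * pw c d (-3) (-1) * a = pw c d 0 (-1) := by
      have h4 : a⁻¹ * pw c d (-3) (-1) * a = (a⁻¹ * c * a) ^ (-3 : ℤ) * (a⁻¹ * d * a)⁻¹ := by
        have := conj_zpow (i := -3) (a := a⁻¹) (b := c)
        rw [inv_inv] at this
        rw [this, pw]; group
      have h5 : c * d = pw c d 1 1 := by simp [pw]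
      rw [h4, hca, hda, h5, pw_zpow hcd, pw_inv hcd, pw_mul hcd]
      norm_num
    have h4 : a⁻¹ * b ^ 3 * a = pw c d 0 (-1) * (a⁻¹ * w * a) := by
      rw [← h3, hb3']; group
    have h5 : b ^ 3 * c ^ 3 = pw c d 0 (-1) * w := by
      have h6 : c ^ 3 = pw c d 3 0 := by
        rw [pw_zero_right]; norm_cast
      rw [hb3', mul_assoc, (hwc.pow_right 3).eq, ← mul_assoc, h6, pw_mul hcd]
      norm_num
    rw [h4, h2, h5] at h1
    have h6 := mul_left_cancel h1
    rw [mul_assoc, inv_mul_eq_iff_eq_mul] at h6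
    exact h6

end Lifting

/-! ### The classification of the groups of maximal class -/

section Induction

variable {G : Type v} [Group G]

theorem mk_eq_iff_exists {x y : G} : (QuotientGroup.mk' (Subgroup.center G) x =
    QuotientGroup.mk' (Subgroup.center G) y) ↔ ∃ ζ ∈ Subgroup.center G, x = y * ζ := by
  rw [QuotientGroup.mk'_eq_mk']
  constructor
  · rintro ⟨ζ, hζ, h⟩
    exact ⟨ζ⁻¹, inv_mem hζ, by rw [← h]; group⟩
  · rintro ⟨ζ, hζ, h⟩
    exact ⟨ζ⁻¹, inv_mem hζ, by rw [h]; group⟩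

theorem mk_eq_one_iff_mem {x : G} :
    QuotientGroup.mk' (Subgroup.center G) x = 1 ↔ x ∈ Subgroup.center G :=
  QuotientGroup.eq_one_iff x

theorem center_eq_zpowers (hZ : Nat.card (Subgroup.center G) = 3) {ζ : G}
    (hζ : ζ ∈ Subgroup.center G) (h1 : ζ ≠ 1) : Subgroup.center G = Subgroup.zpowers ζ := by
  have hfin : Finite (Subgroup.center G) := Nat.finite_of_card_ne_zero (by rw [hZ]; norm_num)
  have hle : Subgroup.zpowers ζ ≤ Subgroup.center G := by
    rw [Subgroup.zpowers_le]; exact hζ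
  have hdvd := Subgroup.card_dvd_of_le hle
  rw [hZ, Nat.dvd_prime Nat.prime_three] at hdvd
  rcases hdvd with h | h
  · rw [Subgroup.card_eq_one] at h
    exact absurd (Subgroup.zpowers_eq_bot.1 h) h1
  · exact (Subgroup.eq_of_le_of_card_ge hle (by rw [hZ, h])).symm

theorem cube_eq_one_of_mem_center (hZ : Nat.card (Subgroup.center G) = 3) {ζ : G}
    (hζ : ζ ∈ Subgroup.center G) : ζ ^ 3 = 1 := by
  have h := pow_card_eq_one' (x := (⟨ζ, hζ⟩ : Subgroup.center G))
  rw [hZ] at h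
  exact congrArg Subtype.val h

theorem pow_pow_eq_one_of_neg_three {x : G} {k m : ℕ} (h : x ^ ((-3 : ℤ) ^ k) = 1) (hk : k = m) :
    x ^ 3 ^ m = 1 := by
  subst hk
  rw [← zpow_natCast]
  have : ((3 ^ k : ℕ) : ℤ) = (-3) ^ k * (-1) ^ k := by
    rw [← mul_pow]; norm_num
  rw [this, zpow_mul, h, one_zpow]

/-- The inductive step: standard generators of the central quotient lift to standard generators,
provided that the lift of the generator `z` of the center commutes with `b`. -/
theorem std_succ_of_lift {n : ℕ} (hn : 3 ≤ n) (hZ : Nat.card (Subgroup.center G) = 3)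
    {a b c d : G} {α β γ : ℤ} (hgen : Subgroup.closure {a, b} = ⊤) (hc : c = comm b a)
    (hd : d = comm c a)
    (hq : Std n (QuotientGroup.mk' (Subgroup.center G) a) (QuotientGroup.mk' (Subgroup.center G) b)
      (QuotientGroup.mk' (Subgroup.center G) c) (QuotientGroup.mk' (Subgroup.center G) d) α β γ)
    (hzc : zElt n (QuotientGroup.mk' (Subgroup.center G) c)
      (QuotientGroup.mk' (Subgroup.center G) d) ∈ Subgroup.center (G ⧸ Subgroup.center G))
    (hz1 : zElt n c d ∉ Subgroup.center G) (hzb : Commute (zElt n c d) b) :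
    ∃ α' β' γ' : ℤ, Std (n + 1) a b c d α' β' γ' ∧
      Subgroup.center G = Subgroup.zpowers (zElt (n + 1) c d) := by
  have hZ3 : ∀ ζ ∈ Subgroup.center G, ζ ^ 3 = 1 := fun ζ hζ => cube_eq_one_of_mem_center hZ hζ
  have hu : ∀ g, comm (zElt n c d) g ∈ Subgroup.center G := by
    intro g
    rw [← mk_eq_one_iff_mem, Std.map_comm, Std.map_zElt, comm_eq_one_iff]
    exact (commute_of_mem_center hzc _).symm
  obtain ⟨hda, hdb, hdc, haZ, hbZ, hcZ⟩ := relations_of_lift hgen hc hd hu hzb hZ3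
    (by rw [← mk_eq_one_iff_mem, Std.map_comm, hq.db])
    (by rw [← mk_eq_one_iff_mem, Std.map_comm, hq.dc])
    (by rw [← mk_eq_iff_exists, map_pow, hq.a_pow, map_zpow, Std.map_zElt])
    (by rw [← mk_eq_iff_exists, map_pow, hq.b_pow, map_mul, map_mul, map_zpow, map_zpow, map_inv,
          Std.map_zElt])
    (by rw [← mk_eq_iff_exists, Std.map_comm, hq.cb, map_zpow, Std.map_zElt])
  have hcd : Commute c d := (comm_eq_one_iff.1 hdc).symm
  have hcenter : ∀ x, Commute x a → Commute x b → x ∈ Subgroup.center G := by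
    intro x hxa hxb
    refine mem_center_of_closure hgen ?_
    rintro s (rfl | rfl) <;> assumption
  have hca : ∀ k l, a⁻¹ * pw c d k l * a = pw c d (k - 3 * l) (k - 2 * l) := by
    intro k l
    have h1 : ∀ x, a⁻¹ * x * a = MulAut.conj a⁻¹ x := fun x => by simp
    have h2 : MulAut.conj a⁻¹ c = pw c d 1 1 := by
      rw [← h1, conj_eq_mul_comm, ← hd]; simp [pw]
    have h3 : MulAut.conj a⁻¹ d = pw c d (-3) (-2) := by
      rw [← h1, conj_eq_mul_comm, hda]
      have := pw_mul hcd 0 1 (-3) (-3)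
      simpa [pw] using this
    rw [h1, pw, map_mul, map_zpow, map_zpow, h2, h3, pw_zpow hcd, pw_zpow hcd, pw_mul hcd]
    congr 1 <;> ring
  have hcomm : ∀ k l, comm (pw c d k l) a = pw c d (-3 * l) (k - 3 * l) := by
    intro k l
    apply comm_eq_of_conj
    rw [hca, pw_mul hcd]
    congr 1 <;> ring
  have hua : comm (zElt n c d) a ≠ 1 := fun h => hz1 (hcenter _ (comm_eq_one_iff.1 h) hzb)
  -- the commutator of the old `z` with `a` is the new `z`; as the new one is central of order `3`,
  -- this bounds the orders of `c` and `d`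
  have key : zElt (n + 1) c d = comm (zElt n c d) a ∧ c ^ 3 ^ ((n + 1 - 1) / 2) = 1 ∧
      d ^ 3 ^ ((n + 1 - 2) / 2) = 1 := by
    have hux := hu a
    rcases Nat.even_or_odd' n with ⟨m, rfl | rfl⟩
    · obtain ⟨k, rfl⟩ : ∃ k, m = k + 2 := ⟨m - 2, by omega⟩
      rw [show 2 * (k + 2) = 2 * k + 4 by ring] at *
      rw [show 2 * k + 4 + 1 = 2 * (k + 1) + 3 by ring]
      rw [zElt_even] at *
      rw [zElt_odd]
      have hN' : (-3 : ℤ) ^ (k + 1) = -3 * (-3) ^ k := pow_succ' _ _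
      generalize (-3 : ℤ) ^ k = N at *
      rw [hN']
      have hcu : comm (d ^ N) a = pw c d (-3 * N) (-3 * N) := by
        rw [← pw_zero_left (x := c), hcomm]; congr 1; ring
      -- the cube of `d ^ N` is the commutator of `c ^ (3 * N)` with `a`
      have h3 : d ^ (-3 * N) ∈ Subgroup.center G := by
        refine hcenter _ ?_ ?_
        · rw [← comm_eq_one_iff, ← pw_zero_left (x := c), hcomm]
          have := hZ3 _ hux
          rw [hcu, pw_pow hcd] at this
          rw [← inv_inj, pw_inv hcd, inv_one, ← this]
          congr 1 <;> (push_cast; ring)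
        · rw [mul_comm, zpow_mul]
          exact hzb.zpow_left _
      have h4 : c ^ (-3 * N) ∈ Subgroup.center G := by
        have := mul_mem hux (inv_mem h3)
        rw [hcu, pw, mul_inv_cancel_right] at this
        exact this
      have h5 : d ^ (-3 * N) = 1 := by
        have h6 : comm (pw c d (-3 * N) 0) a = 1 := by
          rw [pw_zero_right, comm_eq_one_iff]
          exact (commute_of_mem_center h4 a).symm
        rw [hcomm] at h6
        simpa using h6
      refine ⟨?_, ?_, ?_⟩
      · rw [hcu, pw, h5, mul_one]
      · have h6 := hZ3 _ h4
        rw [← hN', ← zpow_natCast, ← zpow_mul] at h6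
        refine pow_pow_eq_one_of_neg_three (k := k + 2) ?_ (by omega)
        rw [pow_succ, show (-3 : ℤ) ^ (k + 1) * -3 = (-3) ^ (k + 1) * (3 : ℕ) * (-1) by
          push_cast; ring, zpow_mul, h6, one_zpow]
      · refine pow_pow_eq_one_of_neg_three (k := k + 1) ?_ (by omega)
        rw [hN', h5]
    · obtain ⟨k, rfl⟩ : ∃ k, m = k + 1 := ⟨m - 1, by omega⟩
      rw [show 2 * (k + 1) + 1 = 2 * k + 3 by ring] at *
      rw [show 2 * k + 3 + 1 = 2 * k + 4 by ring]
      rw [zElt_odd] at *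
      rw [zElt_even]
      have hcu : comm (c ^ ((-3 : ℤ) ^ k)) a = d ^ ((-3 : ℤ) ^ k) := by
        rw [← pw_zero_right (y := d), hcomm, ← pw_zero_left (x := c)]; congr 1; ring
      rw [hcu] at hux
      have h6 := hZ3 _ hux
      rw [← zpow_natCast, ← zpow_mul] at h6
      have h7 : d ^ ((-3 : ℤ) ^ (k + 1)) = 1 := by
        rw [pow_succ, show (-3 : ℤ) ^ k * -3 = (-3) ^ k * (3 : ℕ) * (-1) by
          push_cast; ring, zpow_mul, h6, one_zpow]
      refine ⟨hcu.symm, ?_, ?_⟩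
      · refine pow_pow_eq_one_of_neg_three (k := k + 1) ?_ (by omega)
        have h8 : comm (pw c d 0 ((-3) ^ k)) a = 1 := by
          rw [pw_zero_left, comm_eq_one_iff]
          exact (commute_of_mem_center hux a).symm
        rw [hcomm, pw, show (0 : ℤ) - 3 * (-3) ^ k = (-3) ^ (k + 1) by ring, h7, mul_one,
          show -3 * (-3 : ℤ) ^ k = (-3) ^ (k + 1) by ring] at h8
        exact h8
      · exact pow_pow_eq_one_of_neg_three (k := k + 1) h7 (by omega)
  obtain ⟨hz, hcp, hdp⟩ := key
  have hZz : Subgroup.center G = Subgroup.zpowers (zElt (n + 1) c d) := by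
    rw [hz]
    exact center_eq_zpowers hZ (hu a) hua
  rw [hZz, Subgroup.mem_zpowers_iff] at haZ hbZ hcZ
  obtain ⟨α', hα⟩ := haZ
  obtain ⟨β', hβ⟩ := hbZ
  obtain ⟨γ', hγ⟩ := hcZ
  exact ⟨α', β', γ', ⟨hgen, hc, hd, hda, hdb, hdc, hcp, hdp, hα.symm, by rw [hβ]; group, hγ.symm⟩,
    hZz⟩

/-- Lifts of generators of the central quotient are generators, if the center has order `3` and is
contained in the derived subgroup. -/
theorem closure_eq_top_of_lift (hZ : Nat.card (Subgroup.center G) = 3) {a b : G}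
    (hgen : Subgroup.closure {QuotientGroup.mk' (Subgroup.center G) a,
      QuotientGroup.mk' (Subgroup.center G) b} = ⊤)
    {x y : G} (hxy : comm x y ∈ Subgroup.center G) (h1 : comm x y ≠ 1) :
    Subgroup.closure {a, b} = ⊤ := by
  have hmap : (Subgroup.closure {a, b}).map (QuotientGroup.mk' (Subgroup.center G)) = ⊤ := by
    rw [MonoidHom.map_closure, Set.image_pair, hgen]
  have hdec : ∀ g : G, ∃ h ∈ Subgroup.closure {a, b}, ∃ ζ ∈ Subgroup.center G, g = h * ζ := by
    intro g
    have : QuotientGroup.mk' (Subgroup.center G) g ∈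
        (Subgroup.closure {a, b}).map (QuotientGroup.mk' (Subgroup.center G)) := by
      rw [hmap]; exact Subgroup.mem_top _
    obtain ⟨h, hh, he⟩ := this
    exact ⟨h, hh, mk_eq_iff_exists.1 he.symm⟩
  have hcz : ∀ (ζ g h : G), ζ ∈ Subgroup.center G → comm (g * ζ) h = comm g h := by
    intro ζ g h hζ
    have : comm (g * ζ) h = ζ⁻¹ * (g⁻¹ * h⁻¹ * g * ζ) * h := by simp only [comm]; group
    rw [this, ← mul_comm_of_mem_center hζ, inv_mul_cancel_left, comm]
  have hsymm : ∀ g h : G, comm g h = (comm h g)⁻¹ := by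
    intro g h
    simp only [comm]; group
  obtain ⟨g, hg, ζ, hζ, rfl⟩ := hdec x
  obtain ⟨h, hh, η, hη, rfl⟩ := hdec y
  rw [hcz ζ g _ hζ, hsymm, hcz η h _ hη, ← hsymm] at hxy h1
  have hle : Subgroup.center G ≤ Subgroup.closure {a, b} := by
    rw [center_eq_zpowers hZ hxy h1, Subgroup.zpowers_le]
    exact mul_mem (mul_mem (mul_mem (inv_mem hg) (inv_mem hh)) hg) hh
  rw [eq_top_iff]
  intro u _
  obtain ⟨v, hv, ξ, hξ, rfl⟩ := hdec u
  exact mul_mem hv (hle hξ)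

theorem nilpotencyClass_le_one_of_comm (h : ∀ x y : G, x * y = y * x) :
    Group.nilpotencyClass G ≤ 1 := by
  let _ : CommGroup G := { mul_comm := h }
  exact CommGroup.nilpotencyClass_le_one

theorem card_ne_of_not_comm [Finite G] {m : ℕ} (hG : Nat.card G = 3 ^ m)
    (h : ¬ ∀ x y : G, x * y = y * x) : 3 ≤ m := by
  by_contra hm
  have : Fact (Nat.Prime 3) := ⟨Nat.prime_three⟩
  interval_cases m
  · have := (Nat.card_eq_one_iff_unique.1 hG).1
    exact h fun x y => Subsingleton.elim _ _
  · have hcyc := isCyclic_of_prime_card (α := G) (p := 3) (by rw [hG, pow_one])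
    exact h fun x y => by
      have := IsCyclic.isMulCommutative (α := G)
      exact mul_comm' x y
  · have := IsPGroup.isMulCommutative_of_card_eq_prime_sq hG
    exact h fun x y => mul_comm' x y

/-- A `3`-group of class `k ≥ 2` has order at least `3 ^ (k + 1)`. -/
theorem class_add_one_le (k : ℕ) : ∀ (G : Type v) [Group G] [Finite G] (m : ℕ),
    Nat.card G = 3 ^ m → Group.nilpotencyClass G = k + 2 → k + 3 ≤ m := by
  have : Fact (Nat.Prime 3) := ⟨Nat.prime_three⟩
  induction k with
  | zero =>
    intro G _ _ m hG hcl
    refine card_ne_of_not_comm hG fun h => ?_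
    have := nilpotencyClass_le_one_of_comm h
    omega
  | succ k ih =>
    intro G _ _ m hG hcl
    have hm : 0 < m := by
      rcases Nat.eq_zero_or_pos m with rfl | h
      · have h1 := (Nat.card_eq_one_iff_unique.1 hG).1
        have := nilpotencyClass_le_one_of_comm fun x y : G => Subsingleton.elim _ _
        omega
      · exact h
    obtain ⟨j, hj, hZ⟩ := IsPGroup.card_center_eq_prime_pow hG hm
    have h1 := Subgroup.card_eq_card_quotient_mul_card_subgroup (Subgroup.center G)
    rw [hG, hZ] at h1
    obtain ⟨i, hi, hq⟩ := (Nat.dvd_prime_pow Nat.prime_three).1 (Dvd.intro _ h1.symm)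
    rw [hq, ← pow_add] at h1
    have h2 := Nat.pow_right_injective (by norm_num : 2 ≤ 3) h1
    have h3 := ih (G ⧸ Subgroup.center G) i hq (by rw [Group.nilpotencyClass_quotient_center, hcl]; rfl)
    replace h2 : m = i + j := h2
    omega

/-- The central quotient of a `3`-group of maximal class has again maximal class. -/
theorem maximalClass_quotient_center [Finite G] {m : ℕ} (hG : Nat.card G = 3 ^ (m + 4))
    (hcl : Group.nilpotencyClass G = m + 3) : Nat.card (Subgroup.center G) = 3 ∧
      Nat.card (G ⧸ Subgroup.center G) = 3 ^ (m + 3) ∧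
      Group.nilpotencyClass (G ⧸ Subgroup.center G) = m + 2 := by
  have : Fact (Nat.Prime 3) := ⟨Nat.prime_three⟩
  have hcl' : Group.nilpotencyClass (G ⧸ Subgroup.center G) = m + 2 := by
    rw [Group.nilpotencyClass_quotient_center, hcl]; rfl
  obtain ⟨j, hj, hZ⟩ := IsPGroup.card_center_eq_prime_pow hG (by omega)
  have h1 := Subgroup.card_eq_card_quotient_mul_card_subgroup (Subgroup.center G)
  rw [hG, hZ] at h1
  obtain ⟨i, hi, hq⟩ := (Nat.dvd_prime_pow Nat.prime_three).1 (Dvd.intro _ h1.symm)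
  rw [hq, ← pow_add] at h1
  have h2 : m + 4 = i + j := Nat.pow_right_injective (by norm_num : 2 ≤ 3) h1
  have h3 := class_add_one_le m (G ⧸ Subgroup.center G) i hq hcl'
  obtain rfl : j = 1 := by omega
  obtain rfl : i = m + 3 := by omega
  exact ⟨by rw [hZ, pow_one], hq, hcl'⟩

theorem mul_pow_three {x y f : G} (hf : f ∈ Subgroup.center G) (hf3 : f ^ 3 = 1)
    (h : y * x = x * y * f) : (x * y) ^ 3 = x ^ 3 * y ^ 3 := by
  have r : ∀ w, f * w = w * f := mul_comm_of_mem_center hf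
  have r' : ∀ v w, f * (v * w) = v * (f * w) := fun v w => by rw [← mul_assoc, r, mul_assoc]
  have h' : ∀ w, y * (x * w) = x * (y * (f * w)) := fun w => by
    rw [← mul_assoc, h]; simp only [mul_assoc]
  rw [← mul_one (x ^ 3 * y ^ 3), ← hf3]
  simp only [pow_succ, pow_zero, one_mul, mul_assoc, h', r' x, r' y, r y]

/-- The lift of the generator `z` of the center of the quotient commutes with `b`. -/
theorem commute_lift_b {n : ℕ} (hn : 4 ≤ n) (hZ : Nat.card (Subgroup.center G) = 3)
    {a b c d : G} {α β γ : ℤ} (hc : c = comm b a) (hd : d = comm c a)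
    (hq : Std n (QuotientGroup.mk' (Subgroup.center G) a) (QuotientGroup.mk' (Subgroup.center G) b)
      (QuotientGroup.mk' (Subgroup.center G) c) (QuotientGroup.mk' (Subgroup.center G) d) α β γ)
    (hγ : n = 4 → γ = 0) : Commute (zElt n c d) b := by
  have hZ3 : ∀ ζ ∈ Subgroup.center G, ζ ^ 3 = 1 := fun ζ hζ => cube_eq_one_of_mem_center hZ hζ
  have hu : ∀ g, comm (zElt n c d) g ∈ Subgroup.center G := by
    intro g
    rw [← mk_eq_one_iff_mem, Std.map_comm, Std.map_zElt, comm_eq_one_iff]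
    exact (commute_of_mem_center (hq.z_mem_center hn) _).symm
  have hdb : comm d b ∈ Subgroup.center G := by rw [← mk_eq_one_iff_mem, Std.map_comm, hq.db]
  have hdc : comm d c ∈ Subgroup.center G := by rw [← mk_eq_one_iff_mem, Std.map_comm, hq.dc]
  have hcb : ∃ ζ ∈ Subgroup.center G, comm c b = zElt n c d ^ γ * ζ := by
    rw [← mk_eq_iff_exists, Std.map_comm, hq.cb, map_zpow, Std.map_zElt]
  obtain ⟨ζ6, h6Z, hcb⟩ := hcb
  have hu3 : zElt n c d ^ 3 ∈ Subgroup.center G := by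
    rw [← mk_eq_one_iff_mem, map_pow, Std.map_zElt, hq.z_cube hn]
  have huc : Commute (zElt n c d) c := by
    conv_rhs => rw [hc]
    exact commute_comm_of_secondCenter hu _ _
  have hud : Commute (zElt n c d) d := by
    conv_rhs => rw [hd]
    exact commute_comm_of_secondCenter hu _ _
  obtain ⟨m, rfl | rfl⟩ := even_or_odd_form hn
  · rcases Nat.eq_zero_or_pos m with rfl | hm
    · -- here `z` is `d`
      rw [zElt_even, pow_zero, zpow_one] at *
      obtain rfl := hγ rfl
      rw [zpow_zero, one_mul] at hcb
      have hf : comm d c = 1 := comm_eq_one_iff.2 huc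
      have h1 := comm_y_a hc hd hcb rfl hf hdb (commute_of_mem_center h6Z c).symm
        (commute_of_mem_center h6Z d).symm
      rw [comm_eq_one_iff.2 (commute_of_mem_center h6Z a).symm, one_mul] at h1
      exact comm_eq_one_iff.1 h1.symm
    · -- here `z` is a power of the cube of `d`
      obtain ⟨k, rfl⟩ : ∃ k, m = k + 1 := ⟨m - 1, by omega⟩
      rw [zElt_even, pow_succ', zpow_mul]
      refine Commute.zpow_left ?_ _
      have h1 : b⁻¹ * d ^ (-3 : ℤ) * b = d ^ (-3 : ℤ) := by
        have := conj_zpow (i := -3) (a := b⁻¹) (b := d)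
        rw [inv_inv] at this
        rw [← this, conj_eq_mul_comm, (commute_of_mem_center hdb d).mul_zpow, zpow_neg (comm d b)]
        have h2 := hZ3 _ hdb
        rw [← zpow_natCast] at h2
        rw [show (3 : ℤ) = ((3 : ℕ) : ℤ) by norm_num, h2, inv_one, mul_one]
      rw [mul_assoc, inv_mul_eq_iff_eq_mul] at h1
      exact h1
  · rw [zElt_odd] at *
    obtain ⟨y, hy⟩ : ∃ y, comm c b = y := ⟨_, rfl⟩
    have hyc : Commute y c := by
      rw [← hy, hcb]
      exact (huc.zpow_left γ).mul_left (commute_of_mem_center h6Z c).symm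
    have hy3 : y ^ 3 = ((c ^ ((-3 : ℤ) ^ (m + 1))) ^ 3) ^ γ := by
      rw [← hy, hcb, (commute_of_mem_center h6Z _).mul_pow, hZ3 _ h6Z, mul_one]
      generalize c ^ ((-3 : ℤ) ^ (m + 1)) = u
      rw [← zpow_natCast, ← zpow_natCast, ← zpow_mul, ← zpow_mul, mul_comm]
    have hy3Z : y ^ 3 ∈ Subgroup.center G := by rw [hy3]; exact zpow_mem hu3 _
    have h1 : b⁻¹ * c * b = c * y := by rw [conj_eq_mul_comm, hy]
    have h2 : b⁻¹ * c ^ ((-3 : ℤ) ^ (m + 1)) * b =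
        c ^ ((-3 : ℤ) ^ (m + 1)) * (y ^ 3) ^ (-(-3 : ℤ) ^ m) := by
      have := conj_zpow (i := (-3 : ℤ) ^ (m + 1)) (a := b⁻¹) (b := c)
      rw [inv_inv] at this
      rw [← this, h1, hyc.symm.mul_zpow]
      congr 1
      rw [← zpow_natCast, ← zpow_mul]
      congr 1
      push_cast; ring
    have h3 : (y ^ 3) ^ (-(-3 : ℤ) ^ m) = 1 := by
      rcases Nat.eq_zero_or_pos m with rfl | hm
      · -- here `z` is the inverse of the cube of `c`, and its order has to be computed
        suffices (c ^ ((-3 : ℤ) ^ (0 + 1))) ^ 3 = 1 by rw [hy3, this, one_zpow, one_zpow]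
        rw [zero_add, pow_one] at *
        obtain ⟨f, hf⟩ : ∃ f, comm d c = f := ⟨_, rfl⟩
        rw [hf] at hdc
        have hf3 := hZ3 f hdc
        have hdc' : d * c = c * d * f := by rw [← hf]; simp only [comm]; group
        have h4 : a⁻¹ * c ^ (-3 : ℤ) * a = c ^ (-3 : ℤ) * (d ^ 3)⁻¹ := by
          have h9 : (c * d) ^ 3 = c ^ 3 * d ^ 3 := mul_pow_three hdc hf3 hdc'
          have h10 := conj_zpow (i := -3) (a := a⁻¹) (b := c)
          have h11 : ∀ x : G, x ^ (-3 : ℤ) = (x ^ 3)⁻¹ := fun x => by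
            rw [zpow_neg]; norm_cast
          rw [inv_inv] at h10
          rw [← h10, conj_eq_mul_comm c a, ← hd, h11, h9, mul_inv_rev, ← h11 c]
          exact ((hud.pow_right 3).inv_right).symm.eq
        have hd3 : d ^ 3 ∈ Subgroup.center G := by
          have := hu a
          rw [comm_eq_of_conj h4] at this
          simpa using this
        obtain ⟨ζ1, h1Z, hda⟩ : ∃ ζ ∈ Subgroup.center G,
            comm d a = c ^ (-3 : ℤ) * d ^ (-3 : ℤ) * ζ := by
          rw [← mk_eq_iff_exists, Std.map_comm, hq.da, map_mul, map_zpow, map_zpow]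
        have h5 : a⁻¹ * d * a = d * c ^ (-3 : ℤ) * (d ^ (-3 : ℤ) * ζ1) := by
          rw [conj_eq_mul_comm, hda]; simp only [mul_assoc]
        have h6 : d ^ (-3 : ℤ) * ζ1 ∈ Subgroup.center G := by
          refine mul_mem ?_ h1Z
          rw [zpow_neg]
          exact inv_mem (by exact_mod_cast hd3)
        have h7 : a⁻¹ * d ^ 3 * a = d ^ 3 * (c ^ (-3 : ℤ)) ^ 3 := by
          have := conj_pow (i := 3) (a := a⁻¹) (b := d)
          rw [inv_inv] at this
          rw [← this, h5, (commute_of_mem_center h6 _).mul_pow, hZ3 _ h6, mul_one,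
            hud.symm.mul_pow]
        have h8 : a⁻¹ * d ^ 3 * a = d ^ 3 := by
          rw [mul_assoc, mul_comm_of_mem_center hd3, inv_mul_cancel_left]
        rw [h8] at h7
        exact (mul_eq_left.1 h7.symm)
      · obtain ⟨k, rfl⟩ : ∃ k, m = k + 1 := ⟨m - 1, by omega⟩
        rw [show -(-3 : ℤ) ^ (k + 1) = (3 : ℕ) * (-3) ^ k by push_cast; ring, zpow_mul,
          zpow_natCast, hZ3 _ hy3Z, one_zpow]
    rw [h3, mul_one, mul_assoc, inv_mul_eq_iff_eq_mul] at h2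
    exact h2

/-- Any two generators of a nonabelian group of order `27` are standard. -/
theorem std_three [Finite G] (hG : Nat.card G = 3 ^ 3) {a b : G}
    (hgen : Subgroup.closure {a, b} = ⊤) (hab : comm b a ≠ 1) :
    Nat.card (Subgroup.center G) = 3 ∧ (∃ α β : ℤ, Std 3 a b (comm b a) 1 α β 0) ∧
      Subgroup.center G = Subgroup.zpowers (zElt 3 (comm b a) 1) := by
  have : Fact (Nat.Prime 3) := ⟨Nat.prime_three⟩
  have hnc : ¬ ∀ x y : G, x * y = y * x := fun h => hab (comm_eq_one_iff.2 (h b a))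
  have hncyc : ¬ IsCyclic (G ⧸ Subgroup.center G) := fun h =>
    hnc fun x y => by
      have := MonoidHom.isMulCommutative_of_isCyclic_of_ker_le_center
        (QuotientGroup.mk' (Subgroup.center G)) (by simp)
      exact mul_comm' x y
  obtain ⟨j, hj, hZ⟩ := IsPGroup.card_center_eq_prime_pow hG (by omega)
  have h1 := Subgroup.card_eq_card_quotient_mul_card_subgroup (Subgroup.center G)
  rw [hG, hZ] at h1
  obtain ⟨i, hi, hq⟩ := (Nat.dvd_prime_pow Nat.prime_three).1 (Dvd.intro _ h1.symm)
  rw [hq, ← pow_add] at h1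
  have h2 : 3 = i + j := Nat.pow_right_injective (by norm_num : 2 ≤ 3) h1
  have hi2 : i = 2 := by
    have hi' : i ≠ 0 := by
      rintro rfl
      have := (Nat.card_eq_one_iff_unique.1 hq).1
      exact hncyc inferInstance
    have hi'' : i ≠ 1 := by
      rintro rfl
      exact hncyc (isCyclic_of_prime_card (p := 3) (by rw [hq, pow_one]))
    omega
  subst hi2
  obtain rfl : j = 1 := by omega
  rw [pow_one] at hZ
  have hcomm : ∀ x y : G, comm x y ∈ Subgroup.center G := by
    intro x y
    have := IsPGroup.isMulCommutative_of_card_eq_prime_sq hq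
    rw [← mk_eq_one_iff_mem, Std.map_comm, comm_eq_one_iff]
    exact mul_comm' _ _
  have hcube : ∀ x : G, x ^ 3 ∈ Subgroup.center G := by
    intro x
    rw [← mk_eq_one_iff_mem, map_pow]
    have h3 := orderOf_dvd_natCard (QuotientGroup.mk' (Subgroup.center G) x)
    rw [hq] at h3
    obtain ⟨k, hk, hk'⟩ := (Nat.dvd_prime_pow Nat.prime_three).1 h3
    rw [← orderOf_dvd_iff_pow_eq_one, hk']
    refine (pow_dvd_pow 3 (?_ : k ≤ 1)).trans (by norm_num)
    by_contra hk1
    obtain rfl : k = 2 := by omega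
    exact hncyc (isCyclic_of_orderOf_eq_card _ (by rw [hk', hq]))
  have hz : zElt 3 (comm b a) 1 = comm b a := by
    have := zElt_odd 0 (comm b a) (1 : G)
    simpa using this
  have hZz := center_eq_zpowers hZ (hcomm b a) hab
  have hc3 := cube_eq_one_of_mem_center hZ (hcomm b a)
  obtain ⟨α, hα⟩ := Subgroup.mem_zpowers_iff.1 (hZz ▸ hcube a)
  obtain ⟨β, hβ⟩ := Subgroup.mem_zpowers_iff.1 (hZz ▸ hcube b)
  have hcen := fun x => (commute_of_mem_center (hcomm b a) x).symm
  have hc3' : comm b a ^ (-3 : ℤ) = 1 := by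
    rw [zpow_neg, inv_eq_one]; exact_mod_cast hc3
  refine ⟨hZ, ⟨α, β, ⟨hgen, rfl, ?_, ?_, ?_, ?_, ?_, ?_, ?_, ?_, ?_⟩⟩, by rw [hz, hZz]⟩
  · exact (comm_eq_one_iff.2 (hcen a)).symm
  · rw [hc3']; simp [comm]
  · simp [comm]
  · rw [comm_eq_one_iff]; exact Commute.one_left _
  · simpa using hc3
  · simp
  · rw [hz, hα]
  · rw [hz, hc3', hβ]; simp
  · rw [zpow_zero, comm_eq_one_iff]; exact hcen b

theorem exists_comm_ne_one (hcl : 2 ≤ Group.nilpotencyClass G) : ∃ a b : G, comm b a ≠ 1 := by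
  by_contra! h
  have := nilpotencyClass_le_one_of_comm fun x y : G => comm_eq_one_iff.1 (h y x)
  omega

/-- Two noncommuting elements generate a group of order `27`. -/
theorem closure_eq_top_of_card_three [Finite G] (hG : Nat.card G = 3 ^ 3) {a b : G}
    (hab : comm b a ≠ 1) : Subgroup.closure {a, b} = ⊤ := by
  have : Fact (Nat.Prime 3) := ⟨Nat.prime_three⟩
  have h1 := Subgroup.card_subgroup_dvd_card (Subgroup.closure {a, b})
  rw [hG] at h1
  obtain ⟨k, hk, hk'⟩ := (Nat.dvd_prime_pow Nat.prime_three).1 h1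
  have h2 : 3 ≤ k := by
    refine card_ne_of_not_comm hk' fun h => hab ?_
    have ha : a ∈ Subgroup.closure {a, b} := Subgroup.subset_closure (Or.inl rfl)
    have hb : b ∈ Subgroup.closure {a, b} := Subgroup.subset_closure (Or.inr rfl)
    rw [comm_eq_one_iff]
    exact congrArg Subtype.val (h ⟨b, hb⟩ ⟨a, ha⟩)
  refine Subgroup.eq_top_of_card_eq _ ?_
  rw [hG, hk', le_antisymm hk h2]

/-- In a group of order `81` and class `3` the generators can be chosen such that `b` centralizes
the derived subgroup. -/
theorem exists_generators_four [Finite G] (hG : Nat.card G = 3 ^ 4)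
    (hcl : Group.nilpotencyClass G = 3) : ∃ a b : G, Subgroup.closure {a, b} = ⊤ ∧
      comm (comm b a) b = 1 ∧ comm b a ∉ Subgroup.center G := by
  obtain ⟨hZ, hq, hclq⟩ := maximalClass_quotient_center (m := 0) hG hcl
  obtain ⟨a', b', hab⟩ := exists_comm_ne_one hclq.ge
  obtain ⟨a, rfl⟩ := QuotientGroup.mk'_surjective _ a'
  obtain ⟨b, rfl⟩ := QuotientGroup.mk'_surjective _ b'
  have hgenq := closure_eq_top_of_card_three hq hab
  obtain ⟨-, ⟨α, β, hstd⟩, hZq⟩ := std_three hq hgenq hab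
  have hc : comm b a ∉ Subgroup.center G := by
    rwa [← mk_eq_one_iff_mem, Std.map_comm]
  have hcx : ∀ g, comm (comm b a) g ∈ Subgroup.center G := by
    intro g
    have h1 : comm (QuotientGroup.mk' (Subgroup.center G) b)
        (QuotientGroup.mk' (Subgroup.center G) a) ∈ Subgroup.center (G ⧸ Subgroup.center G) := by
      rw [hZq]
      have := zElt_odd 0 (comm (QuotientGroup.mk' (Subgroup.center G) b)
        (QuotientGroup.mk' (Subgroup.center G) a)) 1
      rw [pow_zero, zpow_one, mul_zero, zero_add] at this
      rw [this]
      exact Subgroup.mem_zpowers _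
    rw [← mk_eq_one_iff_mem, Std.map_comm, Std.map_comm, comm_eq_one_iff]
    exact (commute_of_mem_center h1 _).symm
  obtain ⟨g, hg⟩ : ∃ g, comm (comm b a) g ≠ 1 := by
    by_contra! h
    exact hc (Subgroup.mem_center_iff.2 fun g => (comm_eq_one_iff.1 (h g)).symm.eq)
  have hgen := closure_eq_top_of_lift hZ hgenq (hcx g) hg
  by_cases hca : comm (comm b a) a = 1
  · have h1 : comm a b = (comm b a)⁻¹ := by simp only [comm]; group
    refine ⟨b, a, by rw [Set.pair_comm]; exact hgen, ?_, ?_⟩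
    · rw [h1, comm_eq_one_iff]
      exact (comm_eq_one_iff.1 hca).inv_left
    · rw [h1]
      exact fun h => hc (by simpa using inv_mem h)
  · have h1 := hcx b
    rw [center_eq_zpowers hZ (hcx a) hca, Subgroup.mem_zpowers_iff] at h1
    obtain ⟨j, hj⟩ := h1
    -- multiply `b` by a power of `a` so that it commutes with `[b, a]`
    have hb' : comm (b * a ^ (-j)) a = comm b a * comm (comm b a) (a ^ (-j)) := by
      simp only [comm]; group
    have hca' : a⁻¹ * comm b a * a = comm b a * comm (comm b a) a := conj_eq_mul_comm _ _
    have hcb' : b⁻¹ * comm b a * b = comm b a * comm (comm b a) b := conj_eq_mul_comm _ _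
    have hmul : ∀ x y, comm (comm b a) (x * y) = comm (comm b a) x * comm (comm b a) y := by
      intro x y
      have h2 : comm (comm b a) (x * y) =
          comm (comm b a) y * (y⁻¹ * comm (comm b a) x * y) := by simp only [comm]; group
      rw [h2, mul_assoc y⁻¹, mul_comm_of_mem_center (hcx x), inv_mul_cancel_left,
        mul_comm_of_mem_center (hcx y)]
    let φ : G →* G :=
      { toFun := comm (comm b a)
        map_one' := comm_eq_one_iff.2 (Commute.one_right _)
        map_mul' := hmul }
    have h3 : comm (comm b a) (b * a ^ (-j)) = 1 := by
      change φ (b * a ^ (-j)) = 1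
      rw [map_mul, map_zpow, zpow_neg]
      change comm (comm b a) b * (comm (comm b a) a ^ j)⁻¹ = 1
      rw [hj, mul_inv_cancel]
    refine ⟨a, b * a ^ (-j), ?_, ?_, ?_⟩
    · rw [eq_top_iff, ← hgen, Subgroup.closure_le]
      have hA : a ∈ Subgroup.closure {a, b * a ^ (-j)} := Subgroup.subset_closure (Or.inl rfl)
      have hB : b * a ^ (-j) ∈ Subgroup.closure {a, b * a ^ (-j)} :=
        Subgroup.subset_closure (Or.inr rfl)
      rintro s (rfl | rfl)
      · exact hA
      · simpa using mul_mem hB (zpow_mem hA j)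
    · rw [hb', comm_eq_one_iff]
      exact (comm_eq_one_iff.1 h3).mul_left (commute_of_mem_center (hcx _) _).symm
    · rw [hb']
      intro h
      exact hc (by simpa using mul_mem h (inv_mem (hcx (a ^ (-j)))))

/-- Every `3`-group of maximal class has standard generators, by induction on the order. For `n ≤ 4`
the generator `b` has to be chosen so that `γ = 0`. -/
theorem exists_std (m : ℕ) : ∀ (G : Type v) [Group G] [Finite G], Nat.card G = 3 ^ (m + 3) →
    Group.nilpotencyClass G = m + 2 → ∃ a b c d : G, ∃ α β γ : ℤ, Std (m + 3) a b c d α β γ ∧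
      Subgroup.center G = Subgroup.zpowers (zElt (m + 3) c d) ∧ (m ≤ 1 → γ = 0) := by
  induction m with
  | zero =>
    intro G _ _ hG hcl
    obtain ⟨a, b, hab⟩ := exists_comm_ne_one (G := G) hcl.ge
    obtain ⟨-, ⟨α, β, hstd⟩, hZ⟩ := std_three hG (closure_eq_top_of_card_three hG hab) hab
    exact ⟨a, b, _, _, α, β, 0, hstd, hZ, fun _ => rfl⟩
  | succ m ih =>
    intro G _ _ hG hcl
    obtain ⟨hZ, hq, hclq⟩ := maximalClass_quotient_center (m := m) hG hcl
    rcases Nat.eq_zero_or_pos m with rfl | hm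
    · obtain ⟨a, b, hgen, hcb, hc⟩ := exists_generators_four hG hcl
      have hcq : comm (QuotientGroup.mk' (Subgroup.center G) b)
          (QuotientGroup.mk' (Subgroup.center G) a) ≠ 1 := by
        rwa [← Std.map_comm, Ne, mk_eq_one_iff_mem]
      obtain ⟨-, ⟨α, β, hstd⟩, hZq⟩ :=
        std_three hq (closure_eq_top_of_card_three hq hcq) hcq
      have hd : QuotientGroup.mk' (Subgroup.center G) (comm (comm b a) a) = 1 := by
        rw [Std.map_comm, Std.map_comm, ← hstd.hd]
      rw [← hd, ← Std.map_comm] at hstd hZq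
      have hz3 : ∀ d : G, zElt 3 (comm b a) d = comm b a := fun d => by
        have := zElt_odd 0 (comm b a) d
        simpa using this
      obtain ⟨α', β', γ', hstd', hZ'⟩ := std_succ_of_lift le_rfl hZ hgen rfl rfl hstd
        (by rw [hZq]; exact Subgroup.mem_zpowers _) (by rw [hz3]; exact hc)
        (by rw [hz3]; exact comm_eq_one_iff.1 hcb)
      exact ⟨a, b, _, _, α', β', 0, { hstd' with cb := by rw [hcb, zpow_zero] }, hZ', fun _ => rfl⟩
    · obtain ⟨a', b', c', d', α, β, γ, hstd, hZq, hγ⟩ := ih (G ⧸ Subgroup.center G) hq hclq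
      obtain ⟨a, rfl⟩ := QuotientGroup.mk'_surjective _ a'
      obtain ⟨b, rfl⟩ := QuotientGroup.mk'_surjective _ b'
      have hc' : c' = QuotientGroup.mk' (Subgroup.center G) (comm b a) := by
        rw [Std.map_comm, ← hstd.hc]
      have hd' : d' = QuotientGroup.mk' (Subgroup.center G) (comm (comm b a) a) := by
        rw [Std.map_comm, ← hc', ← hstd.hd]
      subst hc' hd'
      have hzc : zElt (m + 3) (QuotientGroup.mk' (Subgroup.center G) (comm b a))
          (QuotientGroup.mk' (Subgroup.center G) (comm (comm b a) a)) ∈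
          Subgroup.center (G ⧸ Subgroup.center G) := by
        rw [hZq]; exact Subgroup.mem_zpowers _
      have hz1 : zElt (m + 3) (comm b a) (comm (comm b a) a) ∉ Subgroup.center G := by
        rw [← mk_eq_one_iff_mem, Std.map_zElt]
        intro h
        rw [h, Subgroup.zpowers_one_eq_bot] at hZq
        have : Fact (Nat.Prime 3) := ⟨Nat.prime_three⟩
        obtain ⟨j, hj, hZ2⟩ := IsPGroup.card_center_eq_prime_pow hq (by omega)
        rw [hZq, Subgroup.card_bot] at hZ2
        have := Nat.one_lt_pow hj.ne' (by norm_num : 1 < 3)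
        omega
      obtain ⟨g, hg⟩ : ∃ g, comm (zElt (m + 3) (comm b a) (comm (comm b a) a)) g ≠ 1 := by
        by_contra! h
        exact hz1 (Subgroup.mem_center_iff.2 fun g => (comm_eq_one_iff.1 (h g)).symm.eq)
      have hgZ : comm (zElt (m + 3) (comm b a) (comm (comm b a) a)) g ∈ Subgroup.center G := by
        rw [← mk_eq_one_iff_mem, Std.map_comm, Std.map_zElt, comm_eq_one_iff]
        exact (commute_of_mem_center hzc _).symm
      have hgen := closure_eq_top_of_lift hZ hstd.gen hgZ hg
      obtain ⟨α', β', γ', hstd', hZ'⟩ := std_succ_of_lift (by omega) hZ hgen rfl rfl hstd hzc hz1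
        (commute_lift_b (by omega) hZ rfl rfl hstd fun h => hγ (by omega))
      exact ⟨a, b, _, _, α', β', γ', hstd', hZ', fun h => absurd h (by omega)⟩

/-- The list of groups of maximal class is complete. -/
theorem exists_mulEquiv {n : ℕ} (hG : IsMaximalClass n G) :
    Nonempty (G ≃* T1 n) ∨ Nonempty (G ≃* T2 n) ∨ Nonempty (G ≃* T3 n) ∨ Nonempty (G ≃* T4 n) ∨
      5 ≤ n ∧ (Nonempty (G ≃* T5 n) ∨ Nonempty (G ≃* T6 n) ∨ Nonempty (G ≃* T7 n)) := by
  have hn := hG.four_le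
  have hcard := hG.card_eq
  have : Finite G := Nat.finite_of_card_ne_zero (by rw [hcard]; positivity)
  obtain ⟨m, rfl⟩ : ∃ m, n = m + 3 := ⟨n - 3, by omega⟩
  obtain ⟨a, b, c, d, α, β, γ, h, -, hγ⟩ := exists_std m G hcard hG.class_eq
  have hγ' : 5 ≤ m + 3 ∨ γ = 0 := by
    by_cases hm : m ≤ 1
    · exact Or.inr (hγ hm)
    · exact Or.inl (by omega)
  obtain ⟨a, b, c, d, h | h | h | h | ⟨h5, h | h | h⟩⟩ := h.exists_normalForm hn hγ'
  · exact Or.inl (h.nonempty_mulEquiv hn hcard)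
  · exact Or.inr (Or.inl (h.nonempty_mulEquiv hn hcard))
  · exact Or.inr (Or.inr (Or.inl (h.nonempty_mulEquiv hn hcard)))
  · exact Or.inr (Or.inr (Or.inr (Or.inl (h.nonempty_mulEquiv hn hcard))))
  · exact Or.inr (Or.inr (Or.inr (Or.inr ⟨h5, Or.inl (h.nonempty_mulEquiv hn hcard)⟩)))
  · exact Or.inr (Or.inr (Or.inr (Or.inr ⟨h5, Or.inr (Or.inl (h.nonempty_mulEquiv hn hcard))⟩)))
  · exact Or.inr (Or.inr (Or.inr (Or.inr ⟨h5, Or.inr (Or.inr (h.nonempty_mulEquiv hn hcard))⟩)))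

end Induction

/-! ### The maximal subgroup generated by `b` and the derived subgroup -/

section Counting

variable {G : Type v} [Group G]

theorem dvd_of_zpow_mem {N : Subgroup G} {s : G} (hs : s ∉ N) (hs3 : s ^ 3 ∈ N) {i : ℤ}
    (hi : s ^ i ∈ N) : (3 : ℤ) ∣ i := by
  by_contra h
  have hs3' : ∀ q : ℤ, s ^ (3 * q) ∈ N := fun q => by
    rw [zpow_mul]; exact zpow_mem (by exact_mod_cast hs3) q
  have h' : (∃ q, i = 3 * q + 1) ∨ ∃ q, i = 3 * q - 1 := by
    rcases (by omega : i % 3 = 1 ∨ i % 3 = 2) with h1 | h1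
    · exact Or.inl ⟨i / 3, by omega⟩
    · exact Or.inr ⟨i / 3 + 1, by omega⟩
  rcases h' with ⟨q, rfl⟩ | ⟨q, rfl⟩
  · rw [zpow_add, zpow_one, Subgroup.mul_mem_cancel_left _ (hs3' q)] at hi
    exact hs hi
  · rw [zpow_sub, zpow_one, Subgroup.mul_mem_cancel_left _ (hs3' q), inv_mem_iff] at hi
    exact hs hi

theorem exists_fin_three {N : Subgroup G} {s : G} (hs3 : s ^ 3 ∈ N) (i : ℤ) {y : G} (hy : y ∈ N) :
    ∃ i' : Fin 3, ∃ y' ∈ N, s ^ i * y = s ^ (i' : ℕ) * y' := by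
  refine ⟨⟨(i % 3).toNat, by omega⟩, (s ^ 3) ^ (i / 3) * y, mul_mem (zpow_mem hs3 _) hy, ?_⟩
  rw [← mul_assoc, ← zpow_natCast, ← zpow_natCast, ← zpow_mul, ← zpow_add]
  congr 2
  have : (((i % 3).toNat : ℕ) : ℤ) = i % 3 := Int.toNat_of_nonneg (by omega)
  push_cast
  omega

theorem card_le_three_mul [Finite G] {N K : Subgroup G} {s : G} (hs3 : s ^ 3 ∈ N)
    (h : ∀ x ∈ K, ∃ i : ℤ, ∃ y ∈ N, x = s ^ i * y) : Nat.card K ≤ 3 * Nat.card N := by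
  have hsub : (K : Set G) ⊆ Set.range fun p : Fin 3 × N => s ^ (p.1 : ℕ) * p.2 := by
    intro x hx
    obtain ⟨i, y, hy, rfl⟩ := h x hx
    obtain ⟨i', y', hy', e⟩ := exists_fin_three hs3 i hy
    exact ⟨(i', ⟨y', hy'⟩), e.symm⟩
  calc Nat.card K ≤ Nat.card (Set.range fun p : Fin 3 × N => s ^ (p.1 : ℕ) * p.2) :=
        Nat.card_mono (Set.toFinite _) hsub
    _ ≤ Nat.card (Fin 3 × N) := Finite.card_range_le _
    _ = 3 * Nat.card N := by rw [Nat.card_prod, Nat.card_fin]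

/-- The order of `K = N ∪ s N ∪ s² N`. -/
theorem card_eq_three_mul [Finite G] {N K : Subgroup G} {s : G} (hN : N ≤ K) (hsK : s ∈ K)
    (hs : s ∉ N) (hs3 : s ^ 3 ∈ N) (h : ∀ x ∈ K, ∃ i : ℤ, ∃ y ∈ N, x = s ^ i * y) :
    Nat.card K = 3 * Nat.card N := by
  refine le_antisymm (card_le_three_mul hs3 h) ?_
  rw [← Nat.card_fin 3, ← Nat.card_prod]
  refine Nat.card_le_card_of_injective
    (fun p : Fin 3 × N => (⟨s ^ (p.1 : ℕ) * p.2, mul_mem (pow_mem hsK _) (hN p.2.2)⟩ : K)) ?_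
  rintro ⟨i, y⟩ ⟨j, y'⟩ hij
  have h1 : s ^ (i : ℕ) * (y : G) = s ^ (j : ℕ) * (y' : G) := congrArg Subtype.val hij
  have h2 : s ^ ((i : ℤ) - (j : ℤ)) ∈ N := by
    have : s ^ ((i : ℤ) - (j : ℤ)) =
        (s ^ (j : ℕ))⁻¹ * (s ^ (i : ℕ) * (y : G)) * (y : G)⁻¹ := by
      rw [sub_eq_neg_add, zpow_add, zpow_neg, zpow_natCast, zpow_natCast]; group
    rw [this, h1, inv_mul_cancel_left]
    exact mul_mem y'.2 (inv_mem y.2)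
  have h3 := dvd_of_zpow_mem hs hs3 h2
  obtain rfl : i = j := by
    have := i.2
    have := j.2
    ext
    omega
  exact Prod.ext rfl (Subtype.ext (mul_left_cancel h1))

/-- For an abelian subgroup `K`, the rank is read off from its elements of order dividing `3`. -/
theorem homRank_of_torsion {F : Type u} [Field F] [CharP F 3] [Finite G] {K T : Subgroup G} {k : ℕ}
    (hK : ∀ x ∈ K, ∀ y ∈ K, x * y = y * x) (hT : ∀ x, x ∈ T ↔ x ∈ K ∧ x ^ 3 = 1)
    (hcard : Nat.card T = 3 ^ k) : homRank F K = k := by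
  refine homRank_eq_of_card_torsion (fun x y => Subtype.ext (hK x x.2 y y.2)) ?_
  rw [← hcard]
  exact Nat.card_congr
    { toFun := fun x => ⟨x.1, (hT _).2 ⟨x.1.2, congrArg Subtype.val x.2⟩⟩
      invFun := fun x => ⟨⟨x.1, ((hT _).1 x.2).1⟩, Subtype.ext ((hT _).1 x.2).2⟩
      left_inv := fun _ => rfl
      right_inv := fun _ => rfl }

theorem weight_inv {F : Type u} [Field F] (g : G) : weight F g⁻¹ = weight F g := by
  have : Subgroup.centralizer {g⁻¹} = Subgroup.centralizer {g} := by
    ext x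
    rw [Subgroup.mem_centralizer_singleton_iff, Subgroup.mem_centralizer_singleton_iff]
    exact Commute.inv_right_iff (a := x) (b := g)
  rw [weight, weight, this]

end Counting

namespace Std

variable {G : Type v} [Group G] {n : ℕ} {a b c d : G} {α β γ : ℤ}

theorem pwSubgroup_eq_commutator (h : Std n a b c d α β γ) (hn : 4 ≤ n) :
    pwSubgroup h.commute_cd = commutator G := by
  have hcomm : ∀ x y : G, comm x y ∈ commutator G := by
    intro x y
    have := Subgroup.commutator_mem_commutator (Subgroup.mem_top x⁻¹) (Subgroup.mem_top y⁻¹)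
    rw [commutatorElement_def, inv_inv, inv_inv] at this
    exact this
  apply le_antisymm
  · rintro _ ⟨k, l, rfl⟩
    refine mul_mem (zpow_mem ?_ _) (zpow_mem ?_ _)
    · rw [h.hc]; exact hcomm _ _
    · rw [h.hd]; exact hcomm _ _
  · have hA := h.normal_pwSubgroup hn
    let q := QuotientGroup.mk' (pwSubgroup h.commute_cd)
    have hgen : Subgroup.closure {q a, q b} = ⊤ := by
      have := congrArg (Subgroup.map q) h.gen
      rwa [MonoidHom.map_closure, Set.image_pair,
        Subgroup.map_top_of_surjective q (QuotientGroup.mk'_surjective _)] at this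
    have hab : Commute (q b) (q a) := by
      rw [← comm_eq_one_iff, ← map_comm, ← h.hc]
      exact (QuotientGroup.eq_one_iff c).2 (left_mem_pwSubgroup _)
    have hcen : Subgroup.center (G ⧸ pwSubgroup h.commute_cd) = ⊤ := by
      rw [eq_top_iff, ← hgen, Subgroup.closure_le]
      rintro s (rfl | rfl) <;> refine mem_center_of_closure hgen ?_
      · rintro s (rfl | rfl)
        · exact Commute.refl _
        · exact hab.symm
      · rintro s (rfl | rfl)
        · exact hab
        · exact Commute.refl _
    rw [commutator_def, Subgroup.commutator_le]
    intro x _ y _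
    rw [← QuotientGroup.eq_one_iff, commutatorElement_def]
    change q (x * y * x⁻¹ * y⁻¹) = 1
    have h1 : q x ∈ Subgroup.center (G ⧸ pwSubgroup h.commute_cd) := by
      rw [hcen]; exact Subgroup.mem_top _
    rw [_root_.map_mul, _root_.map_mul, _root_.map_mul, mul_comm_of_mem_center h1, map_inv, map_inv]
    group

theorem mem_commutator_iff (h : Std n a b c d α β γ) (hn : 4 ≤ n) {x : G} :
    x ∈ commutator G ↔ ∃ k l : ℤ, x = pw c d k l := by
  rw [← h.pwSubgroup_eq_commutator hn]; rfl

theorem pw_mem_commutator (h : Std n a b c d α β γ) (hn : 4 ≤ n) (k l : ℤ) :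
    pw c d k l ∈ commutator G := (h.mem_commutator_iff hn).2 ⟨k, l, rfl⟩

end Std

/-- The maximal subgroup generated by `b` and the derived subgroup. -/
def maxSub {G : Type v} [Group G] (b : G) : Subgroup G := Subgroup.zpowers b ⊔ commutator G

section

variable {G : Type v} [Group G]

theorem mem_maxSub {b x : G} : x ∈ maxSub b ↔ ∃ j : ℤ, ∃ y ∈ commutator G, x = b ^ j * y := by
  rw [maxSub, Subgroup.mem_sup_of_normal_right]
  constructor
  · rintro ⟨_, ⟨j, rfl⟩, y, hy, rfl⟩
    exact ⟨j, y, hy, rfl⟩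
  · rintro ⟨j, y, hy, rfl⟩
    exact ⟨_, ⟨j, rfl⟩, y, hy, rfl⟩

theorem commutator_le_maxSub (b : G) : commutator G ≤ maxSub b := le_sup_right

theorem self_mem_maxSub (b : G) : b ∈ maxSub b :=
  le_sup_left (a := Subgroup.zpowers b) (Subgroup.mem_zpowers b)

instance normal_maxSub (b : G) : (maxSub b).Normal :=
  Subgroup.Normal.of_commutator_le _ (commutator_le_maxSub b)

end

namespace Std

variable {G : Type v} [Group G] {n : ℕ} {a b c d : G} {α β γ : ℤ}

theorem mem_maxSub_iff (h : Std n a b c d α β γ) (hn : 4 ≤ n) {x : G} :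
    x ∈ maxSub b ↔ ∃ j k l : ℤ, x = b ^ j * pw c d k l := by
  rw [mem_maxSub]
  constructor
  · rintro ⟨j, y, hy, rfl⟩
    obtain ⟨k, l, rfl⟩ := (h.mem_commutator_iff hn).1 hy
    exact ⟨j, k, l, rfl⟩
  · rintro ⟨j, k, l, rfl⟩
    exact ⟨j, _, h.pw_mem_commutator hn k l, rfl⟩

theorem exists_a_zpow_mul (h : Std n a b c d α β γ) (hn : 4 ≤ n) (x : G) :
    ∃ i : ℤ, ∃ y ∈ maxSub b, x = a ^ i * y := by
  obtain ⟨i, j, k, l, rfl⟩ := h.exists_eq hn x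
  exact ⟨i, _, (h.mem_maxSub_iff hn).2 ⟨j, k, l, rfl⟩, rfl⟩

theorem a_pow_mem_commutator (h : Std n a b c d α β γ) (hn : 4 ≤ n) : a ^ 3 ∈ commutator G := by
  rw [← h.pwSubgroup_eq_commutator hn]; exact h.a_pow_mem

theorem b_pow_mem_commutator (h : Std n a b c d α β γ) (hn : 4 ≤ n) : b ^ 3 ∈ commutator G := by
  rw [← h.pwSubgroup_eq_commutator hn]; exact h.b_pow_mem

theorem pw_eq_one_iff (h : Std n a b c d α β γ) (hn : 4 ≤ n) (hG : Nat.card G = 3 ^ n) (k l : ℤ) :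
    pw c d k l = 1 ↔
      ((3 ^ ((n - 1) / 2) : ℕ) : ℤ) ∣ k ∧ ((3 ^ ((n - 2) / 2) : ℕ) : ℤ) ∣ l := by
  constructor
  · intro hkl
    have hfin : ∀ N : ℕ, 0 < N → ∀ k : ℤ, ∃ i : Fin N, (N : ℤ) ∣ k - (i : ℤ) := by
      intro N hN k
      have hN' : (0 : ℤ) < N := by exact_mod_cast hN
      refine ⟨⟨(k % N).toNat, ?_⟩, ?_⟩
      · have := Int.emod_lt_of_pos k hN'; omega
      · have e1 : ((k % N).toNat : ℤ) = k % N := Int.toNat_of_nonneg (Int.emod_nonneg _ hN'.ne')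
        simp only [e1]
        exact Int.dvd_self_sub_emod
    obtain ⟨k', hk'⟩ := hfin (3 ^ ((n - 1) / 2)) (by positivity) k
    obtain ⟨l', hl'⟩ := hfin (3 ^ ((n - 2) / 2)) (by positivity) l
    have h1 : coord n a b c d (0, 0, k', l') =
        coord n a b c d (0, 0, ⟨0, by positivity⟩, ⟨0, by positivity⟩) := by
      simp only [coord, ← h.pw_congr' hk' hl', hkl]
      simp
    have h2 := (h.coord_bijective hn hG).1 h1
    simp only [Prod.mk.injEq, true_and] at h2
    obtain ⟨rfl, rfl⟩ := h2
    exact ⟨by simpa using hk', by simpa using hl'⟩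
  · rintro ⟨hk, hl⟩
    rw [h.pw_congr' (k' := 0) (l' := 0) (by simpa using hk) (by simpa using hl), pw_zero_zero]

theorem card_commutator (h : Std n a b c d α β γ) (hn : 4 ≤ n) (hG : Nat.card G = 3 ^ n) :
    Nat.card (commutator G) = 3 ^ (n - 2) := by
  rw [← h.pwSubgroup_eq_commutator hn, card_pwSubgroup h.commute_cd (by positivity) (by positivity)
    (h.pw_eq_one_iff hn hG), ← pow_add]
  congr 1
  omega

theorem card_maxSub (h : Std n a b c d α β γ) (hn : 4 ≤ n) (hG : Nat.card G = 3 ^ n) :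
    Nat.card (maxSub b) = 3 ^ (n - 1) := by
  have := h.finite hn
  have h1 : Nat.card (maxSub b) ≤ 3 * Nat.card (commutator G) :=
    card_le_three_mul (h.b_pow_mem_commutator hn) fun x hx => mem_maxSub.1 hx
  have h2 : Nat.card (⊤ : Subgroup G) ≤ 3 * Nat.card (maxSub b) :=
    card_le_three_mul (commutator_le_maxSub b (h.a_pow_mem_commutator hn))
      fun x _ => h.exists_a_zpow_mul hn x
  rw [h.card_commutator hn hG, ← pow_succ'] at h1
  have h3 : 3 ^ n = 3 * 3 ^ (n - 1) := by rw [← pow_succ']; congr 1; omega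
  rw [Subgroup.card_top, hG, h3] at h2
  rw [show n - 2 + 1 = n - 1 by omega] at h1
  omega

theorem a_notMem (h : Std n a b c d α β γ) (hn : 4 ≤ n) (hG : Nat.card G = 3 ^ n) :
    a ∉ maxSub b := by
  intro ha
  have htop : maxSub b = ⊤ := by
    rw [eq_top_iff]
    intro x _
    obtain ⟨i, y, hy, rfl⟩ := h.exists_a_zpow_mul hn x
    exact mul_mem (zpow_mem ha i) hy
  have h1 := h.card_maxSub hn hG
  rw [htop, Subgroup.card_top, hG] at h1
  have := Nat.pow_right_injective (by norm_num : 2 ≤ 3) h1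
  omega

theorem b_notMem (h : Std n a b c d α β γ) (hn : 4 ≤ n) (hG : Nat.card G = 3 ^ n) :
    b ∉ commutator G := by
  intro hb
  have htop : maxSub b ≤ commutator G := by
    intro x hx
    obtain ⟨i, y, hy, rfl⟩ := mem_maxSub.1 hx
    exact mul_mem (zpow_mem hb i) hy
  have h1 := h.card_maxSub hn hG
  rw [le_antisymm htop (commutator_le_maxSub b), h.card_commutator hn hG] at h1
  have := Nat.pow_right_injective (by norm_num : 2 ≤ 3) h1
  omega

theorem three_dvd_of_pow_dvd {e : ℕ} (he : 0 < e) {k : ℤ} (h : ((3 ^ e : ℕ) : ℤ) ∣ k) :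
    (3 : ℤ) ∣ k := by
  refine Dvd.dvd.trans ?_ h
  exact_mod_cast dvd_pow_self 3 he.ne'

theorem z_ne_one (h : Std n a b c d α β γ) (hn : 4 ≤ n) (hG : Nat.card G = 3 ^ n) :
    zElt n c d ≠ 1 := by
  have h0 : ∀ m : ℕ, ¬ ((3 ^ (m + 1) : ℕ) : ℤ) ∣ (-3) ^ m := by
    intro m hm
    have h1 := Int.natAbs_dvd_natAbs.2 hm
    rw [Int.natAbs_natCast, Int.natAbs_pow] at h1
    have h2 := Nat.le_of_dvd (by positivity) h1
    have h3 : (3 : ℕ) ^ m < 3 ^ (m + 1) := Nat.pow_lt_pow_right (by norm_num) (by omega)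
    have h4 : (-3 : ℤ).natAbs = 3 := rfl
    rw [h4] at h2
    omega
  intro hz
  obtain ⟨m, rfl | rfl⟩ := even_or_odd_form hn
  · rw [zElt_even, ← pw_zero_left (x := c), h.pw_eq_one_iff hn hG] at hz
    rw [show (2 * m + 4 - 2) / 2 = m + 1 by omega] at hz
    exact h0 m hz.2
  · rw [zElt_odd, ← pw_zero_right (y := d), h.pw_eq_one_iff hn hG] at hz
    rw [show (2 * (m + 1) + 3 - 1) / 2 = m + 1 + 1 by omega] at hz
    exact h0 (m + 1) hz.1

theorem card_zpowers_z (h : Std n a b c d α β γ) (hn : 4 ≤ n) (hG : Nat.card G = 3 ^ n) :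
    Nat.card (Subgroup.zpowers (zElt n c d)) = 3 := by
  have : Fact (Nat.Prime 3) := ⟨Nat.prime_three⟩
  rw [Nat.card_zpowers]
  exact orderOf_eq_prime (h.z_cube hn) (h.z_ne_one hn hG)

theorem z_zpow_eq_one_iff (h : Std n a b c d α β γ) (hn : 4 ≤ n) (hG : Nat.card G = 3 ^ n)
    (k : ℤ) : zElt n c d ^ k = 1 ↔ (3 : ℤ) ∣ k := by
  have : Fact (Nat.Prime 3) := ⟨Nat.prime_three⟩
  rw [← orderOf_dvd_iff_zpow_eq_one, orderOf_eq_prime (h.z_cube hn) (h.z_ne_one hn hG)]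
  rfl

/-- The elements of the derived subgroup that commute with `a` are the powers of `z`: by the action
of `a` on the exponents, `c ^ k * d ^ l` is fixed if and only if `c ^ (-3 * l) * d ^ (k - 3 * l) =
1`. -/
theorem mem_zpowers_z_of_commute_a (h : Std n a b c d α β γ) (hn : 4 ≤ n)
    (hG : Nat.card G = 3 ^ n) {k l : ℤ}
    (hkl : Commute (pw c d k l) a) : pw c d k l ∈ Subgroup.zpowers (zElt n c d) := by
  have h1 : pw c d (-3 * l) (k - 3 * l) = 1 := by
    have h2 := h.conj_a k l
    rw [mul_assoc, hkl.eq, inv_mul_cancel_left, eq_comm, ← mul_inv_eq_one, pw_inv h.commute_cd,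
      pw_mul h.commute_cd] at h2
    rw [← h2]
    congr 1 <;> ring
  rw [h.pw_eq_one_iff hn hG] at h1
  have hneg : ∀ (m : ℕ) (k : ℤ), ((3 ^ m : ℕ) : ℤ) ∣ k → ∃ q, k = (-3) ^ m * q := by
    rintro m k ⟨q, rfl⟩
    refine ⟨(-1) ^ m * q, ?_⟩
    push_cast
    rw [← mul_assoc, ← mul_pow]
    norm_num
  obtain ⟨m, rfl | rfl⟩ := even_or_odd_form hn
  · rw [show (2 * m + 4 - 1) / 2 = m + 1 by omega, show (2 * m + 4 - 2) / 2 = m + 1 by omega] at h1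
    obtain ⟨⟨q, hq⟩, ⟨r, hr⟩⟩ := h1
    push_cast at hq hr
    rw [pow_succ] at hq hr
    have hl : l = 3 ^ m * (-q) := by linarith
    obtain ⟨p, hp⟩ := hneg m l ⟨-q, by push_cast; exact hl⟩
    have hk : ((3 ^ (m + 1) : ℕ) : ℤ) ∣ k - 0 :=
      ⟨r - q, by push_cast; rw [pow_succ]; linear_combination hr + -1 * hq⟩
    rw [h.pw_congr' (k' := 0) (l' := l)
      (by rw [show (2 * m + 4 - 1) / 2 = m + 1 by omega]; exact hk) (by simp), pw_zero_left,
      zElt_even, hp, zpow_mul]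
    exact Subgroup.mem_zpowers_iff.2 ⟨p, rfl⟩
  · rw [show (2 * (m + 1) + 3 - 1) / 2 = m + 2 by omega,
      show (2 * (m + 1) + 3 - 2) / 2 = m + 1 by omega] at h1
    obtain ⟨⟨q, hq⟩, ⟨r, hr⟩⟩ := h1
    push_cast at hq hr
    have hl : l = 3 ^ (m + 1) * (-q) := by
      rw [show m + 2 = m + 1 + 1 by ring, pow_succ _ (m + 1)] at hq
      linarith
    have hk : k = 3 ^ (m + 1) * (r - 3 * q) := by
      rw [hl] at hr; linear_combination hr
    obtain ⟨p, hp⟩ := hneg (m + 1) k ⟨r - 3 * q, by push_cast; exact hk⟩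
    rw [h.pw_congr' (k' := k) (l' := 0) (by simp)
      (by rw [show (2 * (m + 1) + 3 - 2) / 2 = m + 1 by omega]
          exact ⟨-q, by push_cast; rw [sub_zero]; exact hl⟩), pw_zero_right, zElt_odd, hp, zpow_mul]
    exact Subgroup.mem_zpowers_iff.2 ⟨p, rfl⟩

/-- An element of `⟨s⟩ N`, where `s³ ∈ N`, lies in `N`, in `s N`, or has its inverse in `s N`. -/
theorem trichotomy {N : Subgroup G} [N.Normal] {s : G} (hs3 : s ^ 3 ∈ N) {i : ℤ} {y : G}
    (hy : y ∈ N) : s ^ i * y ∈ N ∨ ∃ y' ∈ N, s ^ i * y = s * y' ∨ (s ^ i * y)⁻¹ = s * y' := by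
  have hs3' : ∀ q : ℤ, s ^ (3 * q) ∈ N := fun q => by
    rw [zpow_mul]; exact zpow_mem (by exact_mod_cast hs3) q
  have h' : (∃ q, i = 3 * q) ∨ (∃ q, i = 3 * q + 1) ∨ ∃ q, i = 3 * q - 1 := by
    rcases (by omega : i % 3 = 0 ∨ i % 3 = 1 ∨ i % 3 = 2) with h1 | h1 | h1
    · exact Or.inl ⟨i / 3, by omega⟩
    · exact Or.inr (Or.inl ⟨i / 3, by omega⟩)
    · exact Or.inr (Or.inr ⟨i / 3 + 1, by omega⟩)
  rcases h' with ⟨q, rfl⟩ | ⟨q, rfl⟩ | ⟨q, rfl⟩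
  · exact Or.inl (mul_mem (hs3' q) hy)
  · refine Or.inr ⟨_, mul_mem (hs3' q) hy, Or.inl ?_⟩
    rw [add_comm, zpow_add, zpow_one, mul_assoc]
  · refine Or.inr ⟨s⁻¹ * y⁻¹ * s⁻¹⁻¹ * s ^ (3 * -q), mul_mem
      (Subgroup.Normal.conj_mem inferInstance _ (inv_mem hy) _) (hs3' _), Or.inr ?_⟩
    group

/-- As `a` acts on `b` modulo the subgroup generated by `c³` and `d` by `b ↦ b * c`, it commutes
with no element of the maximal subgroup outside the derived subgroup. -/
theorem commute_a_mem (h : Std n a b c d α β γ) (hn : 4 ≤ n) (hG : Nat.card G = 3 ^ n) {x : G}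
    (hx : x ∈ maxSub b) (hxa : Commute x a) : x ∈ Subgroup.zpowers (zElt n c d) := by
  have key : ∀ y ∈ commutator G, ¬ Commute (b * y) a := by
    intro y hy hya
    obtain ⟨k, l, rfl⟩ := (h.mem_commutator_iff hn).1 hy
    have h1 : a⁻¹ * (b * pw c d k l) * a = b * pw c d (1 + (k - 3 * l)) (0 + (k - 2 * l)) := by
      have h2 : a⁻¹ * (b * pw c d k l) * a = a⁻¹ * b * a * (a⁻¹ * pw c d k l * a) := by group
      rw [h2, h.conj_b_a, h.conj_a, ← pw_mul h.commute_cd, pw_zero_right, zpow_one, mul_assoc]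
    rw [mul_assoc, hya.eq, inv_mul_cancel_left] at h1
    have h2 := mul_left_cancel h1
    rw [eq_comm, ← mul_inv_eq_one, pw_inv h.commute_cd, pw_mul h.commute_cd,
      h.pw_eq_one_iff hn hG] at h2
    have h3 := three_dvd_of_pow_dvd (by omega) h2.1
    omega
  obtain ⟨j, y, hy, rfl⟩ := mem_maxSub.1 hx
  rcases trichotomy (h.b_pow_mem_commutator hn) (i := j) hy with h1 | ⟨y', hy', h1 | h1⟩
  · obtain ⟨k, l, h2⟩ := (h.mem_commutator_iff hn).1 h1
    rw [h2] at hxa ⊢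
    exact h.mem_zpowers_z_of_commute_a hn hG hxa
  · rw [h1] at hxa
    exact absurd hxa (key y' hy')
  · have := hxa.inv_left
    rw [h1] at this
    exact absurd this (key y' hy')

theorem zpowers_z_le_center (h : Std n a b c d α β γ) (hn : 4 ≤ n) :
    Subgroup.zpowers (zElt n c d) ≤ Subgroup.center G := by
  rw [Subgroup.zpowers_le]; exact h.z_mem_center hn

theorem z_mem_commutator (h : Std n a b c d α β γ) (hn : 4 ≤ n) : zElt n c d ∈ commutator G := by
  rw [← h.pwSubgroup_eq_commutator hn]; exact h.z_mem

theorem mem_centralizer_a_iff (h : Std n a b c d α β γ) (hn : 4 ≤ n) (hG : Nat.card G = 3 ^ n)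
    {x : G} : x ∈ Subgroup.centralizer {a} ↔
      ∃ i : ℤ, ∃ y ∈ Subgroup.zpowers (zElt n c d), x = a ^ i * y := by
  rw [Subgroup.mem_centralizer_singleton_iff]
  constructor
  · intro hx
    obtain ⟨i, y, hy, rfl⟩ := h.exists_a_zpow_mul hn x
    refine ⟨i, y, h.commute_a_mem hn hG hy ?_, rfl⟩
    have h1 : y = a ^ (-i) * (a ^ i * y) := by rw [zpow_neg, inv_mul_cancel_left]
    rw [h1]
    exact ((Commute.refl a).zpow_left _).mul_left hx
  · rintro ⟨i, y, hy, rfl⟩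
    exact ((Commute.refl a).zpow_left _).mul_left
      (commute_of_mem_center (h.zpowers_z_le_center hn hy) a).symm

theorem center_eq (h : Std n a b c d α β γ) (hn : 4 ≤ n) (hG : Nat.card G = 3 ^ n) :
    Subgroup.center G = Subgroup.zpowers (zElt n c d) := by
  refine le_antisymm (fun x hx => ?_) (h.zpowers_z_le_center hn)
  obtain ⟨i, y, hy, rfl⟩ := h.exists_a_zpow_mul hn x
  have hxB : a ^ i * y ∈ maxSub b := by
    rcases trichotomy (commutator_le_maxSub b (h.a_pow_mem_commutator hn)) (i := i) hy with
      h1 | ⟨y', hy', h1⟩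
    · exact h1
    · -- otherwise `a` would be central
      exfalso
      have h2 : a * y' ∈ Subgroup.center G := by
        rcases h1 with h1 | h1
        · rw [← h1]; exact hx
        · rw [← h1]; exact inv_mem hx
      have h3 : Commute y' a := by
        have h4 := commute_of_mem_center h2 a
        have h5 : y' = a⁻¹ * (a * y') := by group
        rw [h5]
        exact (Commute.refl a).inv_left.mul_left h4.symm
      have h6 := h.zpowers_z_le_center hn (h.commute_a_mem hn hG hy' h3)
      have h7 : a ∈ Subgroup.center G := by
        have := mul_mem h2 (inv_mem h6)
        rwa [mul_inv_cancel_right] at this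
      have h8 : c = 1 := by rw [h.hc, comm_eq_one_iff]; exact commute_of_mem_center h7 b
      rw [← zpow_one c, ← pw_zero_right (y := d), h.pw_eq_one_iff hn hG] at h8
      have := three_dvd_of_pow_dvd (by omega) h8.1
      omega
  exact h.commute_a_mem hn hG hxB (commute_of_mem_center hx a).symm

end Std

/-! ### Elements outside the maximal subgroup, and central elements -/

section Counting

variable {G : Type v} [Group G]

/-- A version of `homRank_eq_of_card` inside an ambient group: `N` is the subgroup generated by the
commutators and the cubes of `K`. -/
theorem homRank_of_frattini {F : Type u} [Field F] [CharP F 3] [Finite G] {K N : Subgroup G}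
    {k : ℕ} (hc : ∀ x ∈ K, ∀ y ∈ K, comm x y ∈ N) (h3 : ∀ x ∈ K, x ^ 3 ∈ N)
    (hN : N ≤ (cubePhi K).map K.subtype) (hcard : Nat.card K = 3 ^ k * Nat.card N) :
    homRank F K = k := by
  refine homRank_eq_of_card ?_
  have h1 : (cubePhi K).map K.subtype = N := by
    refine le_antisymm ?_ hN
    rw [cubePhi, MonoidHom.map_closure, Subgroup.closure_le]
    rintro _ ⟨_, ⟨x, y, rfl⟩ | ⟨x, rfl⟩, rfl⟩
    · exact hc x x.2 y y.2
    · exact h3 x x.2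
  rw [hcard, ← h1, Subgroup.card_map_of_injective K.subtype_injective]

theorem comm_mem_map_cubePhi {K : Subgroup G} {x y : G} (hx : x ∈ K) (hy : y ∈ K) :
    comm x y ∈ (cubePhi K).map K.subtype :=
  ⟨_, comm_mem_cubePhi (⟨x, hx⟩ : K) ⟨y, hy⟩, rfl⟩

theorem cube_mem_map_cubePhi {K : Subgroup G} {x : G} (hx : x ∈ K) :
    x ^ 3 ∈ (cubePhi K).map K.subtype :=
  ⟨_, cube_mem_cubePhi (⟨x, hx⟩ : K), rfl⟩

theorem mem_commutator_iff_abelianization {x : G} :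
    x ∈ commutator G ↔ Abelianization.of x = 1 := by
  rw [← Abelianization.ker_of, MonoidHom.mem_ker]

theorem comm_mem_commutator (x y : G) : comm x y ∈ commutator G := by
  rw [mem_commutator_iff_abelianization]
  simp [comm, mul_comm]

/-- Summation over `K = N ∪ s N ∪ s² N`. -/
theorem sum_eq_sum_cosets [Fintype G] {N K : Subgroup G} [Fintype N] [Fintype K] {s : G}
    (hN : N ≤ K) (hsK : s ∈ K) (hs : s ∉ N) (hs3 : s ^ 3 ∈ N)
    (h : ∀ x ∈ K, ∃ i : ℤ, ∃ y ∈ N, x = s ^ i * y) (f : G → ℕ) :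
    ∑ x : K, f x = ∑ y : N, f y + ∑ y : N, f (s * y) + ∑ y : N, f (s ^ 2 * y) := by
  have hcard := card_eq_three_mul hN hsK hs hs3 h
  let φ : Fin 3 × N → K := fun p => ⟨s ^ (p.1 : ℕ) * p.2, mul_mem (pow_mem hsK _) (hN p.2.2)⟩
  have hφ : Function.Surjective φ := by
    rintro ⟨x, hx⟩
    obtain ⟨i, y, hy, rfl⟩ := h x hx
    obtain ⟨i', y', hy', e⟩ := exists_fin_three hs3 i hy
    exact ⟨(i', ⟨y', hy'⟩), Subtype.ext e.symm⟩
  have hbij : Function.Bijective φ := by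
    rw [Nat.bijective_iff_surjective_and_card]
    exact ⟨hφ, by rw [Nat.card_prod, Nat.card_fin, hcard]⟩
  rw [← (Equiv.ofBijective φ hbij).sum_comp, Fintype.sum_prod_type, Fin.sum_univ_three]
  simp [φ]

/-- Summation of a function that is constant on `Z`, on `D \ Z` and on `K \ D`, written without
subtraction. -/
theorem sum_const_on_chain [Fintype G] {Z D K : Subgroup G} [Fintype K] (hZD : Z ≤ D) (hDK : D ≤ K)
    (f : G → ℕ) {p q r : ℕ} (hp : ∀ x ∈ Z, f x = p) (hq : ∀ x ∈ D, x ∉ Z → f x = q)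
    (hr : ∀ x ∈ K, x ∉ D → f x = r) :
    ∑ x : K, f x + Nat.card Z * q + Nat.card D * r =
      Nat.card Z * p + Nat.card D * q + Nat.card K * r := by
  classical
  have hcount : ∀ H : Subgroup G, H ≤ K → ∀ m : ℕ,
      ∑ x : K, (if (x : G) ∈ H then m else 0) = Nat.card H * m := by
    intro H hH m
    rw [← Finset.sum_filter, Finset.sum_const, smul_eq_mul]
    congr 1
    rw [← Nat.card_congr (Subgroup.subgroupOfEquivOfLe hH).toEquiv, Nat.card_eq_fintype_card,
      Fintype.card_subtype]
    rfl
  rw [← hcount Z (hZD.trans hDK) q, ← hcount D hDK r, ← hcount Z (hZD.trans hDK) p,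
    ← hcount D hDK q, ← hcount K le_rfl r, ← Finset.sum_add_distrib, ← Finset.sum_add_distrib,
    ← Finset.sum_add_distrib, ← Finset.sum_add_distrib]
  refine Finset.sum_congr rfl fun x _ => ?_
  rw [if_pos x.2]
  by_cases h1 : (x : G) ∈ Z
  · rw [hp x h1, if_pos h1, if_pos h1, if_pos (hZD h1), if_pos (hZD h1)]
  · rw [if_neg h1, if_neg h1]
    by_cases h2 : (x : G) ∈ D
    · rw [hq x h2 h1, if_pos h2, if_pos h2]; ring
    · rw [hr x x.2 h2, if_neg h2, if_neg h2]; ring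

end Counting

/-- The rank of the centralizer `⟨a, z⟩` of the generator `a` when `a³ = z ^ α`: it is elementary
abelian of order `9` or cyclic, according to whether `z ^ α = 1`. -/
def rankA (α : ℤ) : ℕ := if (3 : ℤ) ∣ α then 2 else 1

namespace Std

variable {G : Type v} [Group G] {n : ℕ} {a b c d : G} {α β γ : ℤ}

theorem zpowers_z_le_commutator (h : Std n a b c d α β γ) (hn : 4 ≤ n) :
    Subgroup.zpowers (zElt n c d) ≤ commutator G := by
  rw [Subgroup.zpowers_le]; exact h.z_mem_commutator hn

theorem card_centralizer_a (h : Std n a b c d α β γ) (hn : 4 ≤ n) (hG : Nat.card G = 3 ^ n) :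
    Nat.card (Subgroup.centralizer {a}) = 9 := by
  have := h.finite hn
  rw [card_eq_three_mul (N := Subgroup.zpowers (zElt n c d)) (s := a), h.card_zpowers_z hn hG]
  · exact (h.zpowers_z_le_center hn).trans (Subgroup.center_le_centralizer _)
  · exact Subgroup.mem_centralizer_singleton_iff.2 rfl
  · exact fun ha => h.a_notMem hn hG
      (commutator_le_maxSub b (h.zpowers_z_le_commutator hn ha))
  · exact Subgroup.mem_zpowers_iff.2 ⟨α, h.a_pow.symm⟩
  · exact fun x hx => (h.mem_centralizer_a_iff hn hG).1 hx

theorem homRank_centralizer_a (F : Type u) [Field F] [CharP F 3] (h : Std n a b c d α β γ)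
    (hn : 4 ≤ n) (hG : Nat.card G = 3 ^ n) :
    homRank F (Subgroup.centralizer {a}) = rankA α := by
  have := h.finite hn
  have hcomm : ∀ x ∈ Subgroup.centralizer {a}, ∀ y ∈ Subgroup.centralizer {a},
      x * y = y * x := by
    intro x hx y hy
    obtain ⟨i, ζ, hζ, rfl⟩ := (h.mem_centralizer_a_iff hn hG).1 hx
    have h1 : Commute (a ^ i) y :=
      Commute.zpow_left (Subgroup.mem_centralizer_singleton_iff.1 hy).symm i
    exact (h1.mul_left (commute_of_mem_center (h.zpowers_z_le_center hn hζ) y).symm).eq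
  have hcube : ∀ (i : ℤ), ∀ ζ ∈ Subgroup.zpowers (zElt n c d),
      (a ^ i * ζ) ^ 3 = zElt n c d ^ (α * i) := by
    intro i ζ hζ
    obtain ⟨m, rfl⟩ := Subgroup.mem_zpowers_iff.1 hζ
    rw [(commute_of_mem_center (h.zpowers_z_le_center hn hζ) _).mul_pow, ← zpow_natCast,
      ← zpow_mul, mul_comm i, zpow_mul, zpow_natCast, h.a_pow, ← zpow_natCast, ← zpow_mul,
      ← zpow_mul, h.z_zpow_eq hn (k := m * (3 : ℕ)) (l := 0) ⟨m, by push_cast; ring⟩, zpow_zero,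
      mul_one]
  rw [rankA]
  split_ifs with hα
  · refine homRank_of_torsion hcomm (T := Subgroup.centralizer {a}) (fun x => ?_)
      (by rw [h.card_centralizer_a hn hG]; norm_num)
    refine ⟨fun hx => ⟨hx, ?_⟩, fun hx => hx.1⟩
    obtain ⟨i, ζ, hζ, rfl⟩ := (h.mem_centralizer_a_iff hn hG).1 hx
    rw [hcube i ζ hζ, h.z_zpow_eq_one_iff hn hG]
    exact hα.mul_right i
  · refine homRank_of_torsion hcomm (T := Subgroup.zpowers (zElt n c d)) (fun x => ?_)
      (by rw [h.card_zpowers_z hn hG]; norm_num)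
    constructor
    · intro hx
      refine ⟨(h.zpowers_z_le_center hn).trans (Subgroup.center_le_centralizer _) hx, ?_⟩
      have := hcube 0 x hx
      simpa using this
    · rintro ⟨hx, hx3⟩
      obtain ⟨i, ζ, hζ, rfl⟩ := (h.mem_centralizer_a_iff hn hG).1 hx
      rw [hcube i ζ hζ, h.z_zpow_eq_one_iff hn hG] at hx3
      obtain ⟨q, rfl⟩ := (Int.prime_three.dvd_mul.1 hx3).resolve_left hα
      refine mul_mem (Subgroup.mem_zpowers_iff.2 ⟨α * q, ?_⟩) hζ
      rw [zpow_mul, ← h.a_pow, ← zpow_natCast, ← zpow_mul]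
      rfl

theorem weight_a (F : Type u) [Field F] [CharP F 3] (h : Std n a b c d α β γ)
    (hn : 4 ≤ n) (hG : Nat.card G = 3 ^ n) : weight F a = 9 * rankA α := by
  rw [weight, h.card_centralizer_a hn hG, h.homRank_centralizer_a F hn hG]

/-- The conjugacy class of `a` is the whole coset of the derived subgroup that contains it, as it
has `3 ^ n / 9` elements. -/
theorem isConj_a (h : Std n a b c d α β γ) (hn : 4 ≤ n) (hG : Nat.card G = 3 ^ n) {x : G}
    (hx : Abelianization.of x = Abelianization.of a) : IsConj x a := by
  have := h.finite hn
  have h1 := ncard_conjClass_mul_card_centralizer a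
  rw [h.card_centralizer_a hn hG, hG] at h1
  have h2 : (ConjClasses.mk a).carrier ⊆ (fun y => a * y) '' (commutator G : Set G) := by
    intro y hy
    rw [ConjClasses.mem_carrier_iff_mk_eq, ConjClasses.mk_eq_mk_iff_isConj, isConj_iff] at hy
    obtain ⟨g, hg⟩ := hy
    refine ⟨a⁻¹ * y, ?_, mul_inv_cancel_left _ _⟩
    rw [SetLike.mem_coe, mem_commutator_iff_abelianization]
    have h3 := congrArg Abelianization.of hg
    simp only [map_mul, map_inv, mul_inv_cancel_comm] at h3 ⊢
    rw [h3, inv_mul_cancel]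
  have h3 : ((fun y => a * y) '' (commutator G : Set G)).ncard ≤ (ConjClasses.mk a).carrier.ncard := by
    rw [Set.ncard_image_of_injective _ (mul_right_injective a)]
    have h4 : (commutator G : Set G).ncard = 3 ^ (n - 2) := h.card_commutator hn hG
    have h5 : 3 ^ n = 3 ^ (n - 2) * 9 := by
      rw [show (9 : ℕ) = 3 ^ 2 by norm_num, ← pow_add]; congr 1; omega
    omega
  have h4 := Set.eq_of_subset_of_ncard_le h2 h3 (Set.toFinite _)
  have h5 : x ∈ (fun y => a * y) '' (commutator G : Set G) := by
    refine ⟨a⁻¹ * x, ?_, mul_inv_cancel_left _ _⟩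
    rw [SetLike.mem_coe, mem_commutator_iff_abelianization, map_mul, map_inv, hx, inv_mul_cancel]
  rw [← h4, ConjClasses.mem_carrier_iff_mk_eq, ConjClasses.mk_eq_mk_iff_isConj] at h5
  exact h5

theorem weight_eq (F : Type u) [Field F] [CharP F 3] (h : Std n a b c d α β γ)
    (hn : 4 ≤ n) (hG : Nat.card G = 3 ^ n) {x : G}
    (hx : Abelianization.of x = Abelianization.of a) : weight F x = 9 * rankA α := by
  rw [weight_of_isConj (h.isConj_a hn hG hx), h.weight_a F hn hG]

theorem of_a_pow (h : Std n a b c d α β γ) (hn : 4 ≤ n) :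
    (Abelianization.of a) ^ 3 = 1 := by
  rw [← map_pow, ← mem_commutator_iff_abelianization]; exact h.a_pow_mem_commutator hn

theorem of_b_pow (h : Std n a b c d α β γ) (hn : 4 ≤ n) :
    (Abelianization.of b) ^ 3 = 1 := by
  rw [← map_pow, ← mem_commutator_iff_abelianization]; exact h.b_pow_mem_commutator hn

/-- The contribution of the elements outside the maximal subgroup generated by `b` and the derived
subgroup: each of the six cosets of the derived subgroup is a conjugacy class. They are represented
by `a`, `a * b`, `a * b²` and their inverses, and `a * b`, `a * b²` may be taken as generators in
place of `a`, which changes the exponent `α`. -/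
theorem sum_outside (F : Type u) [Field F] [CharP F 3] [Fintype G] [Fintype (maxSub b)]
    (h : Std n a b c d α β γ) (hn : 4 ≤ n) (hG : Nat.card G = 3 ^ n) (hγ : 5 ≤ n ∨ γ = 0) :
    ∑ g : G, weight F g = ∑ x : maxSub b, weight F (x : G) +
      2 * 3 ^ n * (rankA α + rankA (α + β - γ) + rankA (α + 2 * β - γ)) := by
  classical
  have : Fintype (commutator G) := Fintype.ofFinite _
  have h1 := h.mul_b hn hγ
  have h2 := h1.mul_b hn hγ
  rw [show α + β - γ + (β + γ) - γ = α + 2 * β - γ by ring] at h2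
  have hA := h.of_a_pow hn
  have hB := h.of_b_pow hn
  set A := Abelianization.of a with hAdef
  set B := Abelianization.of b with hBdef
  have hw0 : ∀ x : G, Abelianization.of x = A → weight F x = 9 * rankA α :=
    fun x hx => h.weight_eq F hn hG hx
  have hw1 : ∀ x : G, Abelianization.of x = A * B → weight F x = 9 * rankA (α + β - γ) :=
    fun x hx => h1.weight_eq F hn hG (by rw [hx, map_mul])
  have hw2 : ∀ x : G, Abelianization.of x = A * B * B → weight F x = 9 * rankA (α + 2 * β - γ) :=
    fun x hx => h2.weight_eq F hn hG (by rw [hx, map_mul, map_mul])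
  have hy : ∀ y : commutator G, Abelianization.of (y : G) = 1 :=
    fun y => mem_commutator_iff_abelianization.1 y.2
  have hinv : ∀ X Y : Abelianization G, ∀ u v : ℕ, X * Y = A ^ (3 * u) * B ^ (3 * v) → X⁻¹ = Y := by
    intro X Y u v hXY
    rw [pow_mul, pow_mul, hA, hB, one_pow, one_pow, one_mul] at hXY
    exact inv_eq_of_mul_eq_one_right hXY
  have hcard : 3 ^ n = 9 * 3 ^ (n - 2) := by
    rw [show (9 : ℕ) = 3 ^ 2 by norm_num, ← pow_add]; congr 1; omega
  have hconst : ∀ (f : G → ℕ) (m : ℕ), (∀ y : commutator G, f y = 9 * m) →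
      ∑ y : commutator G, f y = 3 ^ n * m := by
    intro f m hf
    rw [Finset.sum_congr rfl fun y _ => hf y, Finset.sum_const, Finset.card_univ,
      ← Nat.card_eq_fintype_card, h.card_commutator hn hG, hcard, smul_eq_mul]
    ring
  have hdecB : ∀ f : G → ℕ, ∑ x : maxSub b, f x = ∑ y : commutator G, f y +
      ∑ y : commutator G, f (b * y) + ∑ y : commutator G, f (b ^ 2 * y) := fun f =>
    sum_eq_sum_cosets (commutator_le_maxSub b) (self_mem_maxSub b) (h.b_notMem hn hG)
      (h.b_pow_mem_commutator hn) (fun x hx => mem_maxSub.1 hx) f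
  have hdecG := sum_eq_sum_cosets (K := ⊤) (N := maxSub b) (s := a) le_top (Subgroup.mem_top _)
    (h.a_notMem hn hG) (commutator_le_maxSub b (h.a_pow_mem_commutator hn))
    (fun x _ => h.exists_a_zpow_mul hn x) (weight F)
  have htop : ∑ g : G, weight F g = ∑ g : (⊤ : Subgroup G), weight F (g : G) :=
    ((Subgroup.topEquiv (G := G)).toEquiv.sum_comp (weight F)).symm
  rw [htop, hdecG, hdecB fun x => weight F (a * x), hdecB fun x => weight F (a ^ 2 * x)]
  rw [hconst (fun y => weight F (a * y)) (rankA α),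
    hconst (fun y => weight F (a * (b * y))) (rankA (α + β - γ)),
    hconst (fun y => weight F (a * (b ^ 2 * y))) (rankA (α + 2 * β - γ)),
     hconst (fun y => weight F (a ^ 2 * y)) (rankA α),
    hconst (fun y => weight F (a ^ 2 * (b * y))) (rankA (α + 2 * β - γ)),
    hconst (fun y => weight F (a ^ 2 * (b ^ 2 * y))) (rankA (α + β - γ))]
  · ring
  · intro y
    rw [← weight_inv]
    refine hw1 _ ?_
    rw [map_inv]
    refine hinv _ _ 1 1 ?_
    simp only [map_mul, map_pow, hy, ← hAdef, ← hBdef, mul_one]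
    simp only [pow_succ, pow_zero, one_mul, mul_comm, mul_left_comm]
  · intro y
    rw [← weight_inv]
    refine hw2 _ ?_
    rw [map_inv]
    refine hinv _ _ 1 1 ?_
    simp only [map_mul, map_pow, hy, ← hAdef, ← hBdef, mul_one]
    simp only [pow_succ, pow_zero, one_mul, mul_comm, mul_left_comm]
  · intro y
    rw [← weight_inv]
    refine hw0 _ ?_
    rw [map_inv]
    refine hinv _ _ 1 0 ?_
    simp only [map_mul, map_pow, hy, ← hAdef, mul_one]
    simp only [pow_succ, pow_zero, one_mul, mul_assoc, mul_zero, mul_one]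
  · intro y
    refine hw2 _ ?_
    simp only [map_mul, map_pow, hy, ← hAdef, ← hBdef, mul_one]
    simp only [pow_succ, pow_zero, one_mul, mul_assoc]
  · intro y
    refine hw1 _ ?_
    simp only [map_mul, hy, ← hAdef, ← hBdef, mul_one]
  · intro y
    refine hw0 _ ?_
    simp only [map_mul, hy, ← hAdef, mul_one]

/-- An element outside the maximal subgroup is, up to inversion and conjugation, the generator `a`
of a possibly different system of generators with the same `b`. -/
theorem exists_isConj (h : Std n a b c d α β γ) (hn : 4 ≤ n) (hG : Nat.card G = 3 ^ n)
    (hγ : 5 ≤ n ∨ γ = 0) {s : G} (hs : s ∉ maxSub b) :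
    ∃ a' c' d' : G, ∃ α' β' : ℤ, Std n a' b c' d' α' β' γ ∧ (IsConj s a' ∨ IsConj s⁻¹ a') := by
  obtain ⟨i, y, hy, rfl⟩ := h.exists_a_zpow_mul hn s
  have h1 := h.mul_b hn hγ
  have h2 := h1.mul_b hn hγ
  have key : ∀ x ∈ maxSub b, ∃ a' c' d' : G, ∃ α' β' : ℤ, Std n a' b c' d' α' β' γ ∧
      IsConj (a * x) a' := by
    intro x hx
    obtain ⟨j, w, hw, rfl⟩ := mem_maxSub.1 hx
    obtain ⟨j', w', hw', e⟩ := exists_fin_three (h.b_pow_mem_commutator hn) j hw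
    rw [e]
    have hw1 := mem_commutator_iff_abelianization.1 hw'
    fin_cases j'
    · exact ⟨_, _, _, _, _, h, h.isConj_a hn hG (by simp [hw1])⟩
    · exact ⟨_, _, _, _, _, h1, h1.isConj_a hn hG (by simp [hw1])⟩
    · exact ⟨_, _, _, _, _, h2, h2.isConj_a hn hG (by simp [hw1, pow_two, mul_assoc])⟩
  rcases trichotomy (commutator_le_maxSub b (h.a_pow_mem_commutator hn)) (i := i) hy with
    h3 | ⟨y', hy', h3 | h3⟩
  · exact absurd h3 hs
  · obtain ⟨a', c', d', α', β', h4, h5⟩ := key y' hy'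
    exact ⟨a', c', d', α', β', h4, Or.inl (by rw [h3]; exact h5)⟩
  · obtain ⟨a', c', d', α', β', h4, h5⟩ := key y' hy'
    exact ⟨a', c', d', α', β', h4, Or.inr (by rw [h3]; exact h5)⟩

/-- The centralizer of a noncentral element of the maximal subgroup lies in the maximal
subgroup. -/
theorem centralizer_le_maxSub (h : Std n a b c d α β γ) (hn : 4 ≤ n) (hG : Nat.card G = 3 ^ n)
    (hγ : 5 ≤ n ∨ γ = 0) {g : G} (hg : g ∈ maxSub b) (hgz : g ∉ Subgroup.center G) :
    Subgroup.centralizer {g} ≤ maxSub b := by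
  intro s hsg
  by_contra hs
  apply hgz
  rw [Subgroup.mem_centralizer_singleton_iff] at hsg
  obtain ⟨a', c', d', α', β', h', h1⟩ := h.exists_isConj hn hG hγ hs
  obtain ⟨t, ht, u, hu⟩ : ∃ t, Commute g t ∧ ∃ u, u * t * u⁻¹ = a' := by
    rcases h1 with h1 | h1
    · exact ⟨s, hsg.symm, isConj_iff.1 h1⟩
    · exact ⟨s⁻¹, Commute.inv_right hsg.symm, isConj_iff.1 h1⟩
  have h2 : u * g * u⁻¹ ∈ Subgroup.center G := by
    refine h'.zpowers_z_le_center hn (h'.commute_a_mem hn hG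
      ((normal_maxSub b).conj_mem g hg u) ?_)
    rw [← hu, Commute, SemiconjBy]
    calc u * g * u⁻¹ * (u * t * u⁻¹) = u * (g * t) * u⁻¹ := by group
      _ = u * (t * g) * u⁻¹ := by rw [ht.eq]
      _ = _ := by group
  have h3 := (inferInstance : (Subgroup.center G).Normal).conj_mem _ h2 u⁻¹
  have h4 : u⁻¹ * (u * g * u⁻¹) * u⁻¹⁻¹ = g := by group
  rwa [h4] at h3

/-- The group `G` itself has rank `2`: its commutators and cubes generate the derived subgroup,
which has index `9`. -/
theorem weight_of_mem_center (F : Type u) [Field F] [CharP F 3] (h : Std n a b c d α β γ)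
    (hn : 4 ≤ n) (hG : Nat.card G = 3 ^ n) {g : G} (hg : g ∈ Subgroup.center G) :
    weight F g = 3 ^ n * 2 := by
  have := h.finite hn
  have htop : Subgroup.centralizer {g} = ⊤ := by
    rw [Subgroup.centralizer_eq_top_iff_subset, Set.singleton_subset_iff]; exact hg
  rw [weight, htop, Subgroup.card_top, hG, homRank_of_frattini (N := commutator G) (k := 2)]
  · exact fun x _ y _ => comm_mem_commutator x y
  · intro x _
    obtain ⟨i, j, k, l, rfl⟩ := h.exists_eq hn x
    rw [mem_commutator_iff_abelianization]
    have hA := h.of_a_pow hn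
    have hB := h.of_b_pow hn
    have h1 := mem_commutator_iff_abelianization.1 (h.pw_mem_commutator hn k l)
    rw [map_pow, map_mul, map_mul, h1, mul_one, mul_pow, map_zpow, map_zpow, ← zpow_natCast,
      ← zpow_natCast, ← zpow_mul, ← zpow_mul, mul_comm i, mul_comm j, zpow_mul, zpow_mul,
      zpow_natCast, zpow_natCast, hA, hB, one_zpow, one_zpow, one_mul]
  · intro x hx
    obtain ⟨k, l, rfl⟩ := (h.mem_commutator_iff hn).1 hx
    refine mul_mem (zpow_mem ?_ _) (zpow_mem ?_ _)
    · rw [h.hc]; exact comm_mem_map_cubePhi (Subgroup.mem_top _) (Subgroup.mem_top _)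
    · rw [h.hd]; exact comm_mem_map_cubePhi (Subgroup.mem_top _) (Subgroup.mem_top _)
  · rw [Subgroup.card_top, hG, h.card_commutator hn hG, ← pow_add]
    congr 1
    omega

end Std

/-! ### Elements of the maximal subgroup -/

namespace Std

variable {G : Type v} [Group G] {n : ℕ} {a b c d : G} {α β γ : ℤ}

theorem pw_mul_b_zpow (h : Std n a b c d α β γ) (hn : 4 ≤ n) (j k l : ℤ) :
    pw c d k l * b ^ j = b ^ j * pw c d k l * zElt n c d ^ (γ * k * j) := by
  have h1 : SemiconjBy (pw c d k l) b (b * zElt n c d ^ (γ * k)) := by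
    rw [SemiconjBy, h.pw_mul_b, mul_assoc, h.z_comm hn, ← mul_assoc]
  have h2 : Commute b (zElt n c d ^ (γ * k)) := h.z_comm hn _ _
  have h3 := (h1.zpow_right j).eq
  rw [h2.mul_zpow, ← zpow_mul, mul_assoc, ← h.z_comm hn, ← mul_assoc] at h3
  exact h3

theorem mul_formula (h : Std n a b c d α β γ) (hn : 4 ≤ n) (j k l j' k' l' : ℤ) :
    b ^ j * pw c d k l * (b ^ j' * pw c d k' l') =
      b ^ (j + j') * pw c d (k + k') (l + l') * zElt n c d ^ (γ * k * j') := by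
  calc b ^ j * pw c d k l * (b ^ j' * pw c d k' l')
      = b ^ j * (pw c d k l * b ^ j') * pw c d k' l' := by group
    _ = b ^ j * b ^ j' * pw c d k l * (zElt n c d ^ (γ * k * j') * pw c d k' l') := by
        rw [h.pw_mul_b_zpow hn]; group
    _ = b ^ j * b ^ j' * (pw c d k l * pw c d k' l') * zElt n c d ^ (γ * k * j') := by
        rw [← h.z_comm hn]; group
    _ = _ := by rw [← zpow_add, pw_mul h.commute_cd]

theorem commute_iff (h : Std n a b c d α β γ) (hn : 4 ≤ n) (hG : Nat.card G = 3 ^ n)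
    (j k l j' k' l' : ℤ) :
    Commute (b ^ j * pw c d k l) (b ^ j' * pw c d k' l') ↔ (3 : ℤ) ∣ γ * (k * j' - k' * j) := by
  rw [Commute, SemiconjBy, h.mul_formula hn, h.mul_formula hn, add_comm j', add_comm k',
    add_comm l', mul_right_inj, ← mul_inv_eq_one, ← zpow_neg, ← zpow_add,
    h.z_zpow_eq_one_iff hn hG]
  ring_nf

/-- The elements of order dividing `3` of the derived subgroup form a subgroup of order `9`. -/
theorem exists_torsion (h : Std n a b c d α β γ) (hn : 4 ≤ n) (hG : Nat.card G = 3 ^ n) :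
    ∃ T : Subgroup G, Nat.card T = 3 ^ 2 ∧
      ∀ x, x ∈ T ↔ x ∈ commutator G ∧ x ^ 3 = 1 := by
  obtain ⟨e, he⟩ : ∃ e, (n - 1) / 2 = e + 1 := ⟨(n - 1) / 2 - 1, by omega⟩
  obtain ⟨f, hf⟩ : ∃ f, (n - 2) / 2 = f + 1 := ⟨(n - 2) / 2 - 1, by omega⟩
  have hone := h.pw_eq_one_iff hn hG
  rw [he, hf] at hone
  have hpw : ∀ k l : ℤ, pw (c ^ 3 ^ e) (d ^ 3 ^ f) k l = pw c d (3 ^ e * k) (3 ^ f * l) := by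
    intro k l
    simp only [pw, zpow_mul]
    norm_cast
  refine ⟨pwSubgroup (h.commute_cd.pow_pow (3 ^ e) (3 ^ f)), ?_, ?_⟩
  · rw [card_pwSubgroup (M := 3) (N := 3) _ (by norm_num) (by norm_num)]
    · norm_num
    · intro k l
      rw [hpw, hone]
      push_cast
      rw [pow_succ, pow_succ, mul_dvd_mul_iff_left (by positivity),
        mul_dvd_mul_iff_left (by positivity)]
  · intro x
    rw [mem_pwSubgroup, h.mem_commutator_iff hn]
    constructor
    · rintro ⟨k, l, rfl⟩
      rw [hpw]
      refine ⟨⟨_, _, rfl⟩, ?_⟩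
      rw [pw_pow h.commute_cd, hone]
      exact ⟨⟨k, by push_cast; ring⟩, ⟨l, by push_cast; ring⟩⟩
    · rintro ⟨⟨k, l, rfl⟩, hx⟩
      rw [pw_pow h.commute_cd, hone] at hx
      push_cast at hx
      rw [pow_succ, pow_succ, mul_dvd_mul_iff_right (by norm_num),
        mul_dvd_mul_iff_right (by norm_num)] at hx
      obtain ⟨⟨p, rfl⟩, ⟨q, rfl⟩⟩ := hx
      exact ⟨p, q, (hpw p q).symm⟩

/-- Except for one group of order `81`, all elements of order `3` of the maximal subgroup lie in
the derived subgroup. -/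
theorem mem_commutator_of_cube (h : Std n a b c d α β γ) (hn : 4 ≤ n) (hG : Nat.card G = 3 ^ n)
    (hβ : 5 ≤ n ∨ ¬ (3 : ℤ) ∣ β - 1) {x : G} (hx : x ∈ maxSub b) (hx3 : x ^ 3 = 1) :
    x ∈ commutator G := by
  have key : ∀ y ∈ commutator G, (b * y) ^ 3 ≠ 1 := by
    intro y hy hy3
    obtain ⟨k, l, rfl⟩ := (h.mem_commutator_iff hn).1 hy
    rw [h.b_mul_pw_pow hn] at hy3
    obtain ⟨m, rfl | rfl⟩ := even_or_odd_form hn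
    · rw [zElt_even, ← zpow_mul, ← pw_zero_left (x := c), pw_mul h.commute_cd,
        h.pw_eq_one_iff hn hG] at hy3
      have h1 := three_dvd_of_pow_dvd (by omega) hy3.2
      rcases m with _ | m
      · rw [pow_zero] at h1
        have : ¬ (3 : ℤ) ∣ β - 1 := hβ.resolve_left (by omega)
        omega
      · rw [pow_succ', mul_assoc] at h1
        omega
    · rw [zElt_odd, ← zpow_mul, ← pw_zero_right (y := d), pw_mul h.commute_cd,
        h.pw_eq_one_iff hn hG] at hy3
      have h1 := three_dvd_of_pow_dvd (by omega) hy3.2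
      omega
  obtain ⟨j, y, hy, rfl⟩ := mem_maxSub.1 hx
  rcases trichotomy (h.b_pow_mem_commutator hn) (i := j) hy with h1 | ⟨y', hy', h1 | h1⟩
  · exact h1
  · rw [h1] at hx3
    exact absurd hx3 (key y' hy')
  · rw [← inv_eq_one, ← inv_pow, h1] at hx3
    exact absurd hx3 (key y' hy')

theorem maxSub_comm (h : Std n a b c d α β 0) (hn : 4 ≤ n) (hG : Nat.card G = 3 ^ n) :
    ∀ x ∈ maxSub b, ∀ y ∈ maxSub b, x * y = y * x := by
  intro x hx y hy
  obtain ⟨j, k, l, rfl⟩ := (h.mem_maxSub_iff hn).1 hx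
  obtain ⟨j', k', l', rfl⟩ := (h.mem_maxSub_iff hn).1 hy
  exact (h.commute_iff hn hG _ _ _ _ _ _).2 ⟨0, by ring⟩

/-- The abelian maximal subgroup has as many elements of order `3` as the derived subgroup. -/
theorem homRank_maxSub (F : Type u) [Field F] [CharP F 3] (h : Std n a b c d α β 0)
    (hn : 4 ≤ n) (hG : Nat.card G = 3 ^ n) (hβ : 5 ≤ n ∨ ¬ (3 : ℤ) ∣ β - 1) :
    homRank F (maxSub b) = 2 := by
  have := h.finite hn
  obtain ⟨T, hT, hT'⟩ := h.exists_torsion hn hG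
  refine homRank_of_torsion (h.maxSub_comm hn hG) (fun x => ?_) hT
  rw [hT']
  exact ⟨fun hx => ⟨commutator_le_maxSub b hx.1, hx.2⟩,
    fun hx => ⟨h.mem_commutator_of_cube hn hG hβ hx.1 hx.2, hx.2⟩⟩

/-- For `n = 4` and `b³ = c⁻³ d⁻¹ z = 1` the maximal subgroup is elementary abelian. -/
theorem homRank_maxSub_four (F : Type u) [Field F] [CharP F 3] (h : Std 4 a b c d α 1 0)
    (hG : Nat.card G = 3 ^ 4) : homRank F (maxSub b) = 3 := by
  have := h.finite le_rfl
  have hc3 : c ^ 3 = 1 := h.c_pow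
  have hd3 : d ^ 3 = 1 := h.d_pow
  have hb3 : b ^ 3 = 1 := by
    have h1 := h.b_mul_pw_pow le_rfl 0 0
    rw [pw_zero_zero, mul_one, zElt_even 0, ← zpow_mul, ← pw_zero_left (x := c),
      pw_mul h.commute_cd] at h1
    rw [h1]
    exact (h.pw_eq_one_iff le_rfl hG _ _).2 ⟨⟨-1, by norm_num⟩, ⟨0, by norm_num⟩⟩
  refine homRank_of_torsion (T := maxSub b) (h.maxSub_comm le_rfl hG) (fun x => ?_)
    (h.card_maxSub le_rfl hG)
  refine ⟨fun hx => ⟨hx, ?_⟩, fun hx => hx.1⟩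
  obtain ⟨j, k, l, rfl⟩ := (h.mem_maxSub_iff le_rfl).1 hx
  have h1 : Commute (b ^ j) (pw c d k l) :=
    h.maxSub_comm le_rfl hG _ (zpow_mem (self_mem_maxSub b) j) _
      (commutator_le_maxSub b (h.pw_mem_commutator le_rfl k l))
  rw [h1.mul_pow, pw_pow h.commute_cd, ← zpow_natCast, ← zpow_mul, mul_comm j, zpow_mul,
    zpow_natCast, hb3, one_zpow, one_mul, h.pw_eq_one_iff le_rfl hG]
  exact ⟨⟨k, by norm_num [mul_comm]⟩, ⟨l, by norm_num [mul_comm]⟩⟩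

theorem center_le_maxSub (h : Std n a b c d α β γ) (hn : 4 ≤ n) (hG : Nat.card G = 3 ^ n) :
    Subgroup.center G ≤ maxSub b := by
  rw [h.center_eq hn hG]
  exact (h.zpowers_z_le_commutator hn).trans (commutator_le_maxSub b)

theorem card_center (h : Std n a b c d α β γ) (hn : 4 ≤ n) (hG : Nat.card G = 3 ^ n) :
    Nat.card (Subgroup.center G) = 3 := by
  rw [h.center_eq hn hG, h.card_zpowers_z hn hG]

/-- If all elements of the maximal subgroup commute with `g`, and `g` is not central, then the
maximal subgroup is the centralizer of `g`. -/
theorem centralizer_eq_maxSub (h : Std n a b c d α β γ) (hn : 4 ≤ n) (hG : Nat.card G = 3 ^ n)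
    (hγ : 5 ≤ n ∨ γ = 0) {g : G} (hg : g ∈ maxSub b) (hgz : g ∉ Subgroup.center G)
    (hcomm : ∀ x ∈ maxSub b, x * g = g * x) : Subgroup.centralizer {g} = maxSub b :=
  le_antisymm (h.centralizer_le_maxSub hn hG hγ hg hgz) fun x hx =>
    Subgroup.mem_centralizer_singleton_iff.2 (hcomm x hx)

/-- If `γ = 0`, then the maximal subgroup `B` generated by `b`, `c`, `d` is abelian, and it is the
centralizer of each of its noncentral elements. The summand `6` is the contribution of the three
central elements. -/
theorem finrank_of_gamma_zero (F : Type u) [Field F] [CharP F 3] (h : Std n a b c d α β 0)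
    (hn : 4 ≤ n) (hG : Nat.card G = 3 ^ n) :
    Module.finrank F (HH1 F (MonoidAlgebra F G)) + homRank F (maxSub b) =
      6 + 2 * (rankA α + rankA (α + β) + rankA (α + 2 * β)) +
        homRank F (maxSub b) * 3 ^ (n - 2) := by
  have := h.finite hn
  have : Fintype G := Fintype.ofFinite _
  have : Fintype (maxSub b) := Fintype.ofFinite _
  have h1 := h.sum_outside F hn hG (Or.inr rfl)
  rw [← finrank_HH1_mul_card, hG, sub_zero, sub_zero] at h1
  have h2 := sum_const_on_chain (K := maxSub b) (h.center_le_maxSub hn hG) le_rfl (weight F)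
    (p := 3 ^ n * 2) (q := 3 ^ (n - 1) * homRank F (maxSub b)) (r := 0)
    (fun x hx => h.weight_of_mem_center F hn hG hx)
    (fun x hx hxz => by
      rw [weight, h.centralizer_eq_maxSub hn hG (Or.inr rfl) hx hxz
        fun y hy => h.maxSub_comm hn hG y hy x hx, h.card_maxSub hn hG])
    (fun x hx hx' => absurd hx hx')
  rw [h.card_center hn hG, h.card_maxSub hn hG] at h2
  obtain ⟨m, rfl⟩ : ∃ m, n = m + 2 := ⟨n - 2, by omega⟩
  simp only [show m + 2 - 1 = m + 1 by omega, Nat.add_sub_cancel] at h2 ⊢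
  apply Nat.eq_of_mul_eq_mul_right (show 0 < 3 ^ (m + 2) by positivity)
  rw [add_mul, h1]
  set S := ∑ x : maxSub b, weight F (x : G)
  set q := homRank F (maxSub b)
  set w := rankA α + rankA (α + β) + rankA (α + 2 * β)
  simp only [pow_add] at h2 ⊢
  set t := 3 ^ m
  norm_num at h2 ⊢
  nlinarith [h2]

/-- The subgroup generated by `c³` and `d`, which is the center of the maximal subgroup if that is
not abelian. -/
theorem exists_centerSub (h : Std n a b c d α β γ) (hn : 5 ≤ n) (hG : Nat.card G = 3 ^ n) :
    ∃ D : Subgroup G, Nat.card D = 3 ^ (n - 3) ∧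
      ∀ x, x ∈ D ↔ ∃ k l : ℤ, x = pw c d (3 * k) l := by
  have hpw : ∀ k l : ℤ, pw (c ^ 3) d k l = pw c d (3 * k) l := by
    intro k l
    simp only [pw, zpow_mul]
    norm_cast
  obtain ⟨e, he⟩ : ∃ e, (n - 1) / 2 = e + 1 := ⟨(n - 1) / 2 - 1, by omega⟩
  refine ⟨pwSubgroup (h.commute_cd.pow_left 3), ?_, ?_⟩
  · rw [card_pwSubgroup (M := 3 ^ e) (N := 3 ^ ((n - 2) / 2)) _ (by positivity) (by positivity)]
    · rw [← pow_add]
      congr 1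
      omega
    · intro k l
      rw [hpw, h.pw_eq_one_iff (by omega) hG, he]
      push_cast
      rw [pow_succ', mul_dvd_mul_iff_left (by norm_num)]
  · intro x
    rw [mem_pwSubgroup]
    simp only [hpw]

theorem proportional_zmod_three : ∀ j k j' k' : ZMod 3, k * j' - k' * j = 0 → ¬ (j = 0 ∧ k = 0) →
    (j' = 0 ∧ k' = 0) ∨ (j' - j = 0 ∧ k' - k = 0) ∨ (j + j' = 0 ∧ k + k' = 0) := by
  decide

/-- Over the field with three elements, a vector which is linearly dependent on a nonzero vector
`v` is `0`, `v` or `-v`. -/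
theorem proportional_mod_three {j k j' k' : ℤ} (h : (3 : ℤ) ∣ k * j' - k' * j)
    (h0 : ¬ ((3 : ℤ) ∣ j ∧ (3 : ℤ) ∣ k)) :
    ((3 : ℤ) ∣ j' ∧ (3 : ℤ) ∣ k') ∨ ((3 : ℤ) ∣ j' - j ∧ (3 : ℤ) ∣ k' - k) ∨
      ((3 : ℤ) ∣ j + j' ∧ (3 : ℤ) ∣ k + k') := by
  have hz : ∀ i : ℤ, (3 : ℤ) ∣ i ↔ (i : ZMod 3) = 0 := fun i =>
    (ZMod.intCast_zmod_eq_zero_iff_dvd i 3).symm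
  simp only [hz, Int.cast_sub, Int.cast_add, Int.cast_mul] at h h0 ⊢
  exact proportional_zmod_three _ _ _ _ h h0

section Nonabelian

variable {D : Subgroup G}

theorem z_zpow_mem_centerSub (hn : 5 ≤ n)
    (hD : ∀ x, x ∈ D ↔ ∃ k l : ℤ, x = pw c d (3 * k) l) (k : ℤ) : zElt n c d ^ k ∈ D := by
  rw [hD]
  obtain ⟨m, rfl | rfl⟩ := even_or_odd_form (n := n) (by omega)
  · exact ⟨0, (-3) ^ m * k, by rw [zElt_even, mul_zero, pw_zero_left, zpow_mul]⟩
  · refine ⟨-(-3) ^ m * k, 0, ?_⟩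
    rw [zElt_odd, pw_zero_right, ← zpow_mul]
    congr 1
    ring

theorem b_cube_mem_centerSub (h : Std n a b c d α β γ) (hn : 5 ≤ n)
    (hD : ∀ x, x ∈ D ↔ ∃ k l : ℤ, x = pw c d (3 * k) l) : b ^ 3 ∈ D := by
  have h1 := h.b_mul_pw_pow (by omega) 0 0
  rw [pw_zero_zero, mul_one] at h1
  rw [h1]
  exact mul_mem ((hD _).2 ⟨-1, -1, by norm_num⟩) (z_zpow_mem_centerSub hn hD β)

theorem mul_pw_mem_centerSub (h : Std n a b c d α β γ) (hn : 5 ≤ n)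
    (hD : ∀ x, x ∈ D ↔ ∃ k l : ℤ, x = pw c d (3 * k) l) {j k : ℤ} (hj : (3 : ℤ) ∣ j)
    (hk : (3 : ℤ) ∣ k) (l : ℤ) : b ^ j * pw c d k l ∈ D := by
  obtain ⟨j, rfl⟩ := hj
  obtain ⟨k, rfl⟩ := hk
  refine mul_mem ?_ ((hD _).2 ⟨k, l, rfl⟩)
  rw [zpow_mul, zpow_ofNat]
  exact zpow_mem (h.b_cube_mem_centerSub hn hD) j

theorem centerSub_le_commutator (h : Std n a b c d α β γ) (hn : 5 ≤ n)
    (hD : ∀ x, x ∈ D ↔ ∃ k l : ℤ, x = pw c d (3 * k) l) : D ≤ commutator G := by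
  intro x hx
  obtain ⟨k, l, rfl⟩ := (hD x).1 hx
  exact h.pw_mem_commutator (by omega) _ _

theorem centerSub_comm (h : Std n a b c d α β γ) (hn : 5 ≤ n) (hG : Nat.card G = 3 ^ n)
    (hD : ∀ x, x ∈ D ↔ ∃ k l : ℤ, x = pw c d (3 * k) l) {x y : G} (hx : x ∈ maxSub b)
    (hy : y ∈ D) : x * y = y * x := by
  obtain ⟨j, k, l, rfl⟩ := (h.mem_maxSub_iff (by omega)).1 hx
  obtain ⟨k', l', rfl⟩ := (hD _).1 hy
  have := (h.commute_iff (by omega) hG j k l 0 (3 * k') l').2 ⟨γ * (-k' * j), by ring⟩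
  rwa [zpow_zero, one_mul] at this

theorem torsion_le_centerSub (h : Std n a b c d α β γ) (hn : 5 ≤ n) (hG : Nat.card G = 3 ^ n)
    (hD : ∀ x, x ∈ D ↔ ∃ k l : ℤ, x = pw c d (3 * k) l) {x : G} (hx : x ∈ commutator G)
    (hx3 : x ^ 3 = 1) : x ∈ D := by
  obtain ⟨k, l, rfl⟩ := (h.mem_commutator_iff (by omega)).1 hx
  rw [pw_pow h.commute_cd, h.pw_eq_one_iff (by omega) hG] at hx3
  have h1 : ((3 ^ 2 : ℕ) : ℤ) ∣ k * (3 : ℕ) := by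
    refine Dvd.dvd.trans ?_ hx3.1
    exact_mod_cast pow_dvd_pow 3 (by omega : 2 ≤ (n - 1) / 2)
  obtain ⟨q, rfl⟩ : (3 : ℤ) ∣ k := by push_cast at h1; omega
  exact (hD _).2 ⟨q, l, rfl⟩

theorem comm_eq_z_zpow (h : Std n a b c d α β γ) (hn : 4 ≤ n) {x y : G} (hx : x ∈ maxSub b)
    (hy : y ∈ maxSub b) : ∃ m : ℤ, comm x y = zElt n c d ^ m := by
  obtain ⟨j, k, l, rfl⟩ := (h.mem_maxSub_iff hn).1 hx
  obtain ⟨j', k', l', rfl⟩ := (h.mem_maxSub_iff hn).1 hy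
  refine ⟨γ * k * j' - γ * k' * j, ?_⟩
  have h1 : ∀ x y : G, comm x y = (y * x)⁻¹ * (x * y) := fun x y => by simp only [comm]; group
  rw [h1, h.mul_formula hn, h.mul_formula hn, add_comm j', add_comm k', add_comm l', mul_inv_rev,
    mul_assoc, inv_mul_cancel_left, ← zpow_neg, ← zpow_add]
  congr 1
  ring

theorem cube_mem_centerSub (h : Std n a b c d α β γ) (hn : 5 ≤ n)
    (hD : ∀ x, x ∈ D ↔ ∃ k l : ℤ, x = pw c d (3 * k) l) {x : G} (hx : x ∈ maxSub b) :
    x ^ 3 ∈ D := by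
  obtain ⟨j, k, l, rfl⟩ := (h.mem_maxSub_iff (by omega)).1 hx
  have h1 : (b ^ j * pw c d k l) ^ 3 =
      b ^ (3 * j) * pw c d (3 * k) (3 * l) * zElt n c d ^ (3 * (γ * k * j)) := by
    rw [pow_succ, pow_two, h.mul_formula (by omega), mul_assoc, ← h.z_comm (by omega), ← mul_assoc,
      h.mul_formula (by omega), mul_assoc, ← zpow_add]
    congr 2
    · congr 1; ring
    · congr 1 <;> ring
    · ring
  rw [h1]
  exact mul_mem (h.mul_pw_mem_centerSub hn hD ⟨j, rfl⟩ ⟨k, rfl⟩ _)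
    (z_zpow_mem_centerSub hn hD _)

/-- The commutators and cubes of the nonabelian maximal subgroup generate its center. -/
theorem homRank_maxSub_nonabelian (F : Type u) [Field F] [CharP F 3] (h : Std n a b c d α β γ)
    (hn : 5 ≤ n) (hG : Nat.card G = 3 ^ n)
    (hD : ∀ x, x ∈ D ↔ ∃ k l : ℤ, x = pw c d (3 * k) l) (hcard : Nat.card D = 3 ^ (n - 3)) :
    homRank F (maxSub b) = 2 := by
  have := h.finite (by omega)
  refine homRank_of_frattini (N := D) (fun x hx y hy => ?_)
    (fun x hx => h.cube_mem_centerSub hn hD hx) ?_ ?_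
  · obtain ⟨m, hm⟩ := h.comm_eq_z_zpow (by omega) hx hy
    rw [hm]
    exact z_zpow_mem_centerSub hn hD m
  · have hcm : c ∈ maxSub b := commutator_le_maxSub b
      (by rw [h.hc]; exact comm_mem_commutator _ _)
    have hdm : d ∈ maxSub b := commutator_le_maxSub b
      (by rw [h.hd]; exact comm_mem_commutator _ _)
    have hc3 := cube_mem_map_cubePhi hcm
    have hd3 := cube_mem_map_cubePhi hdm
    have hb3 := cube_mem_map_cubePhi (self_mem_maxSub b)
    set Φ := (cubePhi (maxSub b)).map (maxSub b).subtype
    have hc3' : ∀ k : ℤ, c ^ (3 * k) ∈ Φ := fun k => by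
      rw [zpow_mul, zpow_ofNat]; exact zpow_mem hc3 k
    -- as `n ≥ 5`, the element `z` is the cube of a power of `c` or `d`
    have hz : zElt n c d ^ β ∈ Φ := by
      refine zpow_mem ?_ β
      obtain ⟨m, rfl | rfl⟩ := even_or_odd_form (n := n) (by omega)
      · obtain ⟨m, rfl⟩ : ∃ m', m = m' + 1 := ⟨m - 1, by omega⟩
        rw [zElt_even, pow_succ', zpow_mul]
        refine zpow_mem ?_ _
        rw [zpow_neg, zpow_ofNat]
        exact inv_mem hd3
      · rw [zElt_odd, pow_succ', zpow_mul]
        refine zpow_mem ?_ _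
        rw [zpow_neg, zpow_ofNat]
        exact inv_mem hc3
    have hd' : d ∈ Φ := by
      have h1 : d = zElt n c d ^ β * (b ^ 3)⁻¹ * c ^ (3 * (-1 : ℤ)) := by
        rw [h.b_pow, mul_inv_rev, mul_inv_rev, mul_inv_cancel_left, inv_inv, ← zpow_neg,
          mul_assoc, ← zpow_add]
        norm_num
      rw [h1]
      exact mul_mem (mul_mem hz (inv_mem hb3)) (hc3' _)
    intro x hx
    obtain ⟨k, l, rfl⟩ := (hD x).1 hx
    exact mul_mem (hc3' k) (zpow_mem hd' l)
  · rw [h.card_maxSub (by omega) hG, hcard, ← pow_add]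
    congr 1
    omega

/-- An element `g` of the nonabelian maximal subgroup outside its center `D` has the centralizer
`⟨g⟩ D`. This is abelian, and its elements of order `3` are those of the derived subgroup, so that
its rank is `2`. -/
theorem weight_of_notMem_centerSub (F : Type u) [Field F] [CharP F 3] (h : Std n a b c d α β γ)
    (hn : 5 ≤ n) (hG : Nat.card G = 3 ^ n) (hγ : ¬ (3 : ℤ) ∣ γ)
    (hD : ∀ x, x ∈ D ↔ ∃ k l : ℤ, x = pw c d (3 * k) l) (hcard : Nat.card D = 3 ^ (n - 3))
    {g : G} (hg : g ∈ maxSub b) (hgD : g ∉ D) : weight F g = 3 ^ (n - 2) * 2 := by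
  have hn' : 4 ≤ n := by omega
  have := h.finite hn'
  have hDB : D ≤ maxSub b := (h.centerSub_le_commutator hn hD).trans (commutator_le_maxSub b)
  have hgz : g ∉ Subgroup.center G := by
    rw [h.center_eq hn' hG]
    intro hg'
    obtain ⟨m, rfl⟩ := Subgroup.mem_zpowers_iff.1 hg'
    exact hgD (z_zpow_mem_centerSub hn hD m)
  have hCB := h.centralizer_le_maxSub hn' hG (Or.inl hn) hg hgz
  have hDC : D ≤ Subgroup.centralizer {g} := fun y hy =>
    Subgroup.mem_centralizer_singleton_iff.2 (h.centerSub_comm hn hG hD hg hy).symm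
  have hdec : ∀ x ∈ Subgroup.centralizer {g}, ∃ i : ℤ, ∃ y ∈ D, x = g ^ i * y := by
    intro x hx
    have hxg : Commute g x := (Subgroup.mem_centralizer_singleton_iff.1 hx).symm
    obtain ⟨j, k, l, rfl⟩ := (h.mem_maxSub_iff hn').1 hg
    obtain ⟨j', k', l', rfl⟩ := (h.mem_maxSub_iff hn').1 (hCB hx)
    rw [h.commute_iff hn' hG] at hxg
    rcases proportional_mod_three ((Int.prime_three.dvd_mul.1 hxg).resolve_left hγ)
      fun h0 => hgD (h.mul_pw_mem_centerSub hn hD h0.1 h0.2 l) with h1 | h1 | h1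
    · exact ⟨0, _, h.mul_pw_mem_centerSub hn hD h1.1 h1.2 l', by rw [zpow_zero, one_mul]⟩
    · refine ⟨1, (b ^ j * pw c d k l)⁻¹ * (b ^ j' * pw c d k' l'), ?_, by
        rw [zpow_one, mul_inv_cancel_left]⟩
      have h2 : b ^ j' * pw c d k' l' = b ^ j * pw c d k l *
          (b ^ (j' - j) * pw c d (k' - k) (l' - l) * zElt n c d ^ (-(γ * k * (j' - j)))) := by
        rw [← mul_assoc, h.mul_formula hn', mul_assoc _ (zElt n c d ^ _), ← zpow_add,
          add_neg_cancel, zpow_zero, mul_one, add_sub_cancel, add_sub_cancel, add_sub_cancel]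
      rw [h2, inv_mul_cancel_left]
      exact mul_mem (h.mul_pw_mem_centerSub hn hD h1.1 h1.2 _) (z_zpow_mem_centerSub hn hD _)
    · refine ⟨-1, b ^ j * pw c d k l * (b ^ j' * pw c d k' l'), ?_, by
        rw [zpow_neg, zpow_one, inv_mul_cancel_left]⟩
      rw [h.mul_formula hn']
      exact mul_mem (h.mul_pw_mem_centerSub hn hD h1.1 h1.2 _) (z_zpow_mem_centerSub hn hD _)
  have hC := card_eq_three_mul hDC (Subgroup.mem_centralizer_singleton_iff.2 rfl) hgD
    (h.cube_mem_centerSub hn hD hg) hdec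
  obtain ⟨T, hT, hT'⟩ := h.exists_torsion hn' hG
  have hrank : homRank F (Subgroup.centralizer {g}) = 2 := by
    refine homRank_of_torsion ?_ (fun x => ?_) hT
    · intro x hx y hy
      obtain ⟨i, w, hw, rfl⟩ := hdec x hx
      have h1 : Commute (g ^ i) y :=
        Commute.zpow_left (Subgroup.mem_centralizer_singleton_iff.1 hy).symm i
      have h2 : Commute w y := (h.centerSub_comm hn hG hD (hCB hy) hw).symm
      exact (h1.mul_left h2).eq
    · rw [hT']
      exact ⟨fun hx => ⟨hDC (h.torsion_le_centerSub hn hG hD hx.1 hx.2), hx.2⟩,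
        fun hx => ⟨h.mem_commutator_of_cube hn' hG (Or.inl hn) (hCB hx.1) hx.2, hx.2⟩⟩
  rw [weight, hrank, hC, hcard, ← pow_succ']
  congr 2
  omega

end Nonabelian

/-- If `γ ≠ 0`, then the center `D` of the maximal subgroup `B` generated by `b`, `c`, `d` has index
`9` in `B`. The three central elements of `G` contribute `6`, the elements of `D` outside `Z(G)`
contribute `2 * (3 ^ (n - 4) - 1)`, and those of `B` outside `D` contribute `16 * 3 ^ (n - 5)`. -/
theorem finrank_of_gamma_ne_zero (F : Type u) [Field F] [CharP F 3] (h : Std n a b c d α β γ)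
    (hn : 5 ≤ n) (hG : Nat.card G = 3 ^ n) (hγ : ¬ (3 : ℤ) ∣ γ) :
    Module.finrank F (HH1 F (MonoidAlgebra F G)) =
      4 + 2 * (rankA α + rankA (α + β - γ) + rankA (α + 2 * β - γ)) + 22 * 3 ^ (n - 5) := by
  have hn' : 4 ≤ n := by omega
  have := h.finite hn'
  have : Fintype G := Fintype.ofFinite _
  have : Fintype (maxSub b) := Fintype.ofFinite _
  obtain ⟨D, hcard, hD⟩ := h.exists_centerSub hn hG
  have hDB : D ≤ maxSub b := (h.centerSub_le_commutator hn hD).trans (commutator_le_maxSub b)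
  have h1 := h.sum_outside F hn' hG (Or.inl hn)
  rw [← finrank_HH1_mul_card, hG] at h1
  have hZD : Subgroup.center G ≤ D := by
    rw [h.center_eq hn' hG]
    intro x hx
    obtain ⟨m, rfl⟩ := Subgroup.mem_zpowers_iff.1 hx
    exact z_zpow_mem_centerSub hn hD m
  have h2 := sum_const_on_chain (K := maxSub b) hZD hDB (weight F)
    (p := 3 ^ n * 2) (q := 3 ^ (n - 1) * 2) (r := 3 ^ (n - 2) * 2)
    (fun x hx => h.weight_of_mem_center F hn' hG hx)
    (fun x hx hxz => by
      rw [weight, h.centralizer_eq_maxSub hn' hG (Or.inl hn) (hDB hx) hxz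
        fun y hy => h.centerSub_comm hn hG hD hy hx, h.card_maxSub hn' hG,
        h.homRank_maxSub_nonabelian F hn hG hD hcard])
    (fun x hx hx' => h.weight_of_notMem_centerSub F hn hG hγ hD hcard hx hx')
  rw [h.card_center hn' hG, h.card_maxSub hn' hG, hcard] at h2
  obtain ⟨m, rfl⟩ : ∃ m, n = m + 5 := ⟨n - 5, by omega⟩
  simp only [show m + 5 - 1 = m + 4 by omega, show m + 5 - 2 = m + 3 by omega,
    show m + 5 - 3 = m + 2 by omega, Nat.add_sub_cancel] at h2 ⊢
  apply Nat.eq_of_mul_eq_mul_right (show 0 < 3 ^ (m + 5) by positivity)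
  rw [h1]
  set S := ∑ x : maxSub b, weight F (x : G)
  set w := rankA α + rankA (α + β - γ) + rankA (α + 2 * β - γ)
  simp only [pow_add] at h2 ⊢
  set t := 3 ^ m
  norm_num at h2 ⊢
  nlinarith [h2]

end Std

end MaxClassThree

theorem proposition3p6 {F : Type u} [Field F] [CharP F 3] {G : Type v} [Group G] (n : ℕ)
    (hG : MaxClassThree.IsMaximalClass n G) :
    -- the list of groups is complete
    (Nonempty (G ≃* MaxClassThree.T1 n) ∨ Nonempty (G ≃* MaxClassThree.T2 n) ∨
      Nonempty (G ≃* MaxClassThree.T3 n) ∨ Nonempty (G ≃* MaxClassThree.T4 n) ∨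
      (5 ≤ n ∧ (Nonempty (G ≃* MaxClassThree.T5 n) ∨ Nonempty (G ≃* MaxClassThree.T6 n) ∨
        Nonempty (G ≃* MaxClassThree.T7 n)))) ∧
    -- the dimension in each case
    (Nonempty (G ≃* MaxClassThree.T1 n) →
      Module.finrank F (MaxClassThree.HH1 F (MonoidAlgebra F G)) = 16 + 2 * 3 ^ (n - 2)) ∧
    (Nonempty (G ≃* MaxClassThree.T2 n) → n ≠ 4 →
      Module.finrank F (MaxClassThree.HH1 F (MonoidAlgebra F G)) = 12 + 2 * 3 ^ (n - 2)) ∧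
    (Nonempty (G ≃* MaxClassThree.T2 n) → n = 4 →
      Module.finrank F (MaxClassThree.HH1 F (MonoidAlgebra F G)) = 38) ∧
    (Nonempty (G ≃* MaxClassThree.T3 n) →
      Module.finrank F (MaxClassThree.HH1 F (MonoidAlgebra F G)) = 12 + 2 * 3 ^ (n - 2)) ∧
    (Nonempty (G ≃* MaxClassThree.T4 n) →
      Module.finrank F (MaxClassThree.HH1 F (MonoidAlgebra F G)) = 10 + 2 * 3 ^ (n - 2)) ∧
    (5 ≤ n → Nonempty (G ≃* MaxClassThree.T5 n) →
      Module.finrank F (MaxClassThree.HH1 F (MonoidAlgebra F G)) = 12 + 22 * 3 ^ (n - 5)) ∧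
    (5 ≤ n → Nonempty (G ≃* MaxClassThree.T6 n) →
      Module.finrank F (MaxClassThree.HH1 F (MonoidAlgebra F G)) = 10 + 22 * 3 ^ (n - 5)) ∧
    (5 ≤ n → Nonempty (G ≃* MaxClassThree.T7 n) →
      Module.finrank F (MaxClassThree.HH1 F (MonoidAlgebra F G)) = 14 + 22 * 3 ^ (n - 5)) := by
  have hn := hG.four_le
  have hcard := hG.card_eq
  refine ⟨MaxClassThree.exists_mulEquiv hG, ?_, ?_, ?_, ?_, ?_, ?_, ?_, ?_⟩
  · rintro ⟨e⟩
    obtain ⟨x, y, u, v, h⟩ := MaxClassThree.exists_std_of_mulEquiv e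
    have h1 := h.finrank_of_gamma_zero F hn hcard
    rw [h.homRank_maxSub F hn hcard (Or.inr (by norm_num))] at h1
    norm_num [MaxClassThree.rankA] at h1
    omega
  · rintro ⟨e⟩ hn4
    obtain ⟨x, y, u, v, h⟩ := MaxClassThree.exists_std_of_mulEquiv e
    have h1 := h.finrank_of_gamma_zero F hn hcard
    rw [h.homRank_maxSub F hn hcard (Or.inl (by omega))] at h1
    norm_num [MaxClassThree.rankA] at h1
    omega
  · rintro ⟨e⟩ rfl
    obtain ⟨x, y, u, v, h⟩ := MaxClassThree.exists_std_of_mulEquiv e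
    have h1 := h.finrank_of_gamma_zero F hn hcard
    rw [h.homRank_maxSub_four F hcard] at h1
    norm_num [MaxClassThree.rankA] at h1
    omega
  · rintro ⟨e⟩
    obtain ⟨x, y, u, v, h⟩ := MaxClassThree.exists_std_of_mulEquiv e
    have h1 := h.finrank_of_gamma_zero F hn hcard
    rw [h.homRank_maxSub F hn hcard (Or.inr (by norm_num))] at h1
    norm_num [MaxClassThree.rankA] at h1
    omega
  · rintro ⟨e⟩
    obtain ⟨x, y, u, v, h⟩ := MaxClassThree.exists_std_of_mulEquiv e
    have h1 := h.finrank_of_gamma_zero F hn hcard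
    rw [h.homRank_maxSub F hn hcard (Or.inr (by norm_num))] at h1
    norm_num [MaxClassThree.rankA] at h1
    omega
  · rintro hn5 ⟨e⟩
    obtain ⟨x, y, u, v, h⟩ := MaxClassThree.exists_std_of_mulEquiv e
    rw [h.finrank_of_gamma_ne_zero F hn5 hcard (by norm_num)]
    norm_num [MaxClassThree.rankA]
  · rintro hn5 ⟨e⟩
    obtain ⟨x, y, u, v, h⟩ := MaxClassThree.exists_std_of_mulEquiv e
    rw [h.finrank_of_gamma_ne_zero F hn5 hcard (by norm_num)]
    norm_num [MaxClassThree.rankA]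
  · rintro hn5 ⟨e⟩
    obtain ⟨x, y, u, v, h⟩ := MaxClassThree.exists_std_of_mulEquiv e
    rw [h.finrank_of_gamma_ne_zero F hn5 hcard (by norm_num)]
    norm_num [MaxClassThree.rankA]
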